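/- Let $1<\alpha\le 2$ and $\mu\in\{1,-1\}$, let $\mathbb T=\mathbb R/2\pi\mathbb Z\cong[-\pi,\pi)$ with Lebesgue measure, $\hat f(k)=\int_{\mathbb T}f(x)e^{-ikx}\,dx$, and $\|f\|_{H^s(\mathbb T)}^2=\frac1{2\pi}\sum_{k\in\mathbb Z}(1+k^2)^s|\hat f(k)|^2$. For an integer $M\ge1$ put $h=\pi/M$ and $\mathbb T_h=\{hj:\ j=-M,\dots,M-1\}\cong\mathbb Z/2M\mathbb Z$; let $(-\Delta)^{\alpha/2}$ and $(-\Delta_h)^{\alpha/2}$ be the Fourier multipliers on $\mathbb T$ and $\mathbb T_h$ with symbols $|k|^\alpha$ and $\left|\frac2h\sin\frac{hk}2\right|^\alpha$, and let $U(t)=e^{-it(-\Delta)^{\alpha/2}}$, $U_h(t)=e^{-it(-\Delta_h)^{\alpha/2}}$. For $f\in L^2(\mathbb T)$ and $g:\mathbb T_h\to\mathbb C$ let $$d_hf(x)=\frac1h\int_x^{x+h}f(y)\,dy\quad(x\in\mathbb T_h),\qquad p_hg(x)=g(x_0)+\frac{g(x_0+h)-g(x_0)}h\,(x-x_0)\quad(x_0\in\mathbb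 T_h,\ x\in[x_0,x_0+h)).$$ For every $u_0\in H^{\alpha/2}(\mathbb T)$ there is a unique $u\in C(\mathbb R;H^{\alpha/2}(\mathbb T))$ with $$u(t)=U(t)u_0-i\mu\int_0^tU(t-\tau)\big(|u(\tau)|^2u(\tau)\big)\,d\tau\qquad(t\in\mathbb R),$$ that is, a unique solution of the fractional nonlinear Schrödinger equation $i\partial_tu=(-\Delta)^{\alpha/2}u+\mu|u|^2u$, $u(0)=u_0$; write $S(t)u_0=u(t)$. For every $h=\pi/M$ and every $v_0:\mathbb T_h\to\mathbb C$ there is a unique continuous $v:\mathbb R\to\mathbb C^{\mathbb T_h}$ with $$v(t)=U_h(t)v_0-i\mu\int_0^tU_h(t-\tau)\big(|v(\tau)|^2v(\tau)\big)\,d\tau\qquad(t\in\mathbb R);$$ write $S_h(t)v_0=v(t)$. Then for all $T>0$ and $R>0$ the set of exponents $p>0$ for which there is a constant $C>0$ (allowed to depend on $T,R,\alpha,\mu,p$, but not on $h$) such that $$\sup_{\|u_0\|_{H^{\alpha/2}(\mathbb T)}<R}\ \big\|p_hS_h(\cdot)d_hu_0-S(\cdot)u_0\big\|_{L^\infty([0,T];L^2(\mathbb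 T))}\le C\,h^p\qquad\text{for all }h=\pi/M,\ M\ge1,$$ has a maximum, and this maximum is $\dfrac{\alpha}{2+\alpha}$. -/

import Mathlib

open MeasureTheory Filter Topology
open scoped ENNReal Real

noncomputable section

namespace FracNLS

instance instFactTwoPiPos : Fact (0 < 2 * π) := ⟨Real.two_pi_pos⟩

/-! ### The torus, Sobolev norms, and the continuum equation -/

/-- The torus `𝕋 = ℝ / 2πℤ`. -/
abbrev Torus : Type := AddCircle (2 * π)

/-- The space of square integrable complex functions on the torus (modulo a.e. equality).
Mathlib normalizes Haar measure to mass one; every norm on `𝕋` that occurs in the error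
estimate is computed below with respect to `dx` of total mass `2π`. -/
abbrev L2Torus : Type := Lp ℂ 2 (AddCircle.haarAddCircle (T := 2 * π))

/-- `f̂(k) = ∫_𝕋 f(x) e^{-ikx} dx`, where `dx` has total mass `2π`. -/
def fourierTransform (f : L2Torus) (k : ℤ) : ℂ :=
  ((2 * π : ℝ) : ℂ) * fourierCoeff (f : Torus → ℂ) k

/-- The norm `‖f‖_{H^s(𝕋)} = ((2π)⁻¹ ∑_k (1 + k²)^s |f̂(k)|²)^{1/2}` with values in `[0, ∞]`;
`f` belongs to `H^s(𝕋)` if and only if it is finite. -/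
def sobolevNorm (s : ℝ) (f : L2Torus) : ℝ≥0∞ :=
  (ENNReal.ofReal (1 / (2 * π)) *
    ∑' k : ℤ, ENNReal.ofReal ((1 + (k : ℝ) ^ 2) ^ s) * ‖fourierTransform f k‖ₑ ^ 2) ^ (1 / 2 : ℝ)

/-- The norm of `L²(𝕋, dx)`, `dx` of total mass `2π`. -/
def l2Norm (f : Torus → ℂ) : ℝ≥0∞ :=
  eLpNorm f 2 (volume : Measure Torus)

/-- The symbol `e^{-it|k|^α}` of the free evolution. -/
def freeSymbol (α t : ℝ) (k : ℤ) : ℂ :=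
  Complex.exp (-(Complex.I * ((t * |(k : ℝ)| ^ α : ℝ) : ℂ)))

theorem norm_freeSymbol (α t : ℝ) (k : ℤ) : ‖freeSymbol α t k‖ = 1 := by
  rw [freeSymbol, ← mul_neg, ← Complex.ofReal_neg, mul_comm]
  exact Complex.norm_exp_ofReal_mul_I _

theorem memlp_freeSymbol_mul (α t : ℝ) (c : lp (fun _ : ℤ => ℂ) 2) :
    Memℓp (fun k : ℤ => freeSymbol α t k * c k) 2 := by
  refine (lp.memℓp c).mono' ?_
  intro k
  simp [norm_freeSymbol]

/-- The free evolution `U(t) = e^{-it(-Δ)^{α/2}}` on `L²(𝕋)`: the Fourier multiplier with symbol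
`e^{-it|k|^α}`. -/
def freeEvolution (α t : ℝ) (f : L2Torus) : L2Torus :=
  (fourierBasis (T := 2 * π)).repr.symm
    ⟨fun k : ℤ => freeSymbol α t k * (fourierBasis (T := 2 * π)).repr f k,
      memlp_freeSymbol_mul α t _⟩

open Classical in
/-- The nonlinearity `|f|² f` as an element of `L²(𝕋)`. It is meaningful for `f ∈ L⁶(𝕋)`, hence
for `f ∈ H^s(𝕋)`, `s > 1/2`. -/
def cubic (f : L2Torus) : L2Torus :=
  if hf : MemLp (fun x : Torus => ((‖f x‖ ^ 2 : ℝ) : ℂ) * f x) 2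
      (AddCircle.haarAddCircle (T := 2 * π))
  then hf.toLp _ else 0

/-- `u ∈ C(ℝ; H^{α/2}(𝕋))` solves `i ∂ₜ u = (-Δ)^{α/2} u + μ |u|² u`, `u(0) = u₀`, in the sense
of the Duhamel formula `u(t) = U(t) u₀ - iμ ∫₀ᵗ U(t-τ) (|u(τ)|² u(τ)) dτ`. -/
structure IsSolution (α μ : ℝ) (u₀ : L2Torus) (u : ℝ → L2Torus) : Prop where
  sobolevNorm_lt_top : ∀ t : ℝ, sobolevNorm (α / 2) (u t) < ∞
  continuous_sobolev : ∀ t₀ : ℝ,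
    Tendsto (fun t : ℝ => sobolevNorm (α / 2) (u t - u t₀)) (𝓝 t₀) (𝓝 0)
  duhamel : ∀ t : ℝ,
    u t = freeEvolution α t u₀ -
      (Complex.I * (μ : ℂ)) • ∫ τ in (0 : ℝ)..t, freeEvolution α (t - τ) (cubic (u τ))

open Classical in
/-- The solution operator `S(t)` of the fractional NLS on `H^{α/2}(𝕋)`. -/
def solutionMap (α μ t : ℝ) (u₀ : L2Torus) : L2Torus :=
  if h : ∃ u : ℝ → L2Torus, IsSolution α μ u₀ u then h.choose t else 0

/-! ### The lattice and the discrete equation -/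

/-- The mesh size `h = π / M`. -/
def mesh (M : ℕ) : ℝ := π / M

/-- Functions on the periodic lattice `𝕋_h`, `h = π / M`. The class of `j` in `ℤ / 2M` stands for
the lattice point `hj` modulo `2π`. The same type is used for functions on the dual lattice, where
the class of `k` stands for the frequency `k`, and the pairing `e^{ikx}` at `x = hj` is
`exp (2πi jk / 2M) = ZMod.stdAddChar (j * k)`. -/
abbrev Lattice (M : ℕ) : Type := ZMod (2 * M) → ℂ

/-- `ℱ_h[g](k) = h ∑_{x ∈ 𝕋_h} g(x) e^{-ikx}`. -/
def discreteFourier (M : ℕ) [NeZero M] (g : Lattice M) : Lattice M := fun k =>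
  (mesh M : ℂ) * ∑ j : ZMod (2 * M), g j * ZMod.stdAddChar (-(j * k))

/-- `ℱ_h⁻¹[g](x) = (2π)⁻¹ ∑_k g(k) e^{ikx}`. -/
def discreteFourierInv (M : ℕ) [NeZero M] (g : Lattice M) : Lattice M := fun j =>
  ((1 / (2 * π) : ℝ) : ℂ) * ∑ k : ZMod (2 * M), g k * ZMod.stdAddChar (j * k)

/-- The symbol `σ_h(k) = |(2/h) sin(hk/2)|^α` of `(-Δ_h)^{α/2}`. It is `2M`-periodic in `k`, so
any representative of the class of `k` can be used. -/
def discreteSymbol (α : ℝ) (M : ℕ) (k : ZMod (2 * M)) : ℝ :=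
  |2 / mesh M * Real.sin (mesh M * (k.valMinAbs : ℝ) / 2)| ^ α

/-- `U_h(t) = e^{-it(-Δ_h)^{α/2}} = ℱ_h⁻¹ e^{-itσ_h} ℱ_h`. -/
def discreteFreeEvolution (α : ℝ) (M : ℕ) [NeZero M] (t : ℝ) (g : Lattice M) : Lattice M :=
  discreteFourierInv M fun k =>
    Complex.exp (-(Complex.I * ((t * discreteSymbol α M k : ℝ) : ℂ))) * discreteFourier M g k

/-- The nonlinearity `|g|² g` on the lattice. -/
def discreteCubic (M : ℕ) (g : Lattice M) : Lattice M := fun j =>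
  ((‖g j‖ ^ 2 : ℝ) : ℂ) * g j

/-- `v` is a continuous solution of `i v̇ = (-Δ_h)^{α/2} v + μ |v|² v`, `v(0) = v₀`, in the sense
of the Duhamel formula. -/
structure IsDiscreteSolution (α μ : ℝ) (M : ℕ) [NeZero M] (v₀ : Lattice M)
    (v : ℝ → Lattice M) : Prop where
  continuous : Continuous v
  duhamel : ∀ t : ℝ,
    v t = discreteFreeEvolution α M t v₀ -
      (Complex.I * (μ : ℂ)) •
        ∫ τ in (0 : ℝ)..t, discreteFreeEvolution α M (t - τ) (discreteCubic M (v τ))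

open Classical in
/-- The solution operator `S_h(t)` of the discrete equation. -/
def discreteSolutionMap (α μ : ℝ) (M : ℕ) [NeZero M] (t : ℝ) (v₀ : Lattice M) : Lattice M :=
  if h : ∃ v : ℝ → Lattice M, IsDiscreteSolution α μ M v₀ v then h.choose t else 0

/-! ### Discretization, interpolation, and the error -/

/-- The discretization `d_h f(x) = h⁻¹ ∫_x^{x+h} f(y) dy`, `x ∈ 𝕋_h`. -/
def discretize (M : ℕ) (f : L2Torus) : Lattice M := fun j =>
  ((1 / mesh M : ℝ) : ℂ) *
    ∫ y in (mesh M * (j.valMinAbs : ℝ))..(mesh M * (j.valMinAbs : ℝ) + mesh M), f (y : Torus)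

/-- The linear interpolation
`p_h g(x) = g(x₀) + (g(x₀ + h) - g(x₀)) / h * (x - x₀)` for `x ∈ [x₀, x₀ + h)`, `x₀ ∈ 𝕋_h`;
for `x ∈ [-π, π)` one has `x₀ = h ⌊x/h⌋`. -/
def interpolate (M : ℕ) (g : Lattice M) : Torus → ℂ :=
  AddCircle.liftIco (2 * π) (-π) fun x : ℝ =>
    g ((⌊x / mesh M⌋ : ℤ) : ZMod (2 * M)) +
      (g ((⌊x / mesh M⌋ + 1 : ℤ) : ZMod (2 * M)) - g ((⌊x / mesh M⌋ : ℤ) : ZMod (2 * M))) /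
          (mesh M : ℂ) * ((x - mesh M * (⌊x / mesh M⌋ : ℝ) : ℝ) : ℂ)

/-- The error `‖p_h S_h(·) d_h u₀ - S(·) u₀‖_{L^∞([0,T]; L²(𝕋))}` for `h = π / M`. -/
def discretizationError (α μ : ℝ) (M : ℕ) [NeZero M] (T : ℝ) (u₀ : L2Torus) : ℝ≥0∞ :=
  essSup
    (fun t : ℝ => l2Norm fun x : Torus =>
      interpolate M (discreteSolutionMap α μ M t (discretize M u₀)) x - solutionMap α μ t u₀ x)
    (volume.restrict (Set.Icc 0 T))

/-- The exponents `p > 0` for which there is a constant `C` such that, for all `h = π / M`,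
`sup_{‖u₀‖_{H^{α/2}} < R} ‖p_h S_h(·) d_h u₀ - S(·) u₀‖_{L^∞([0,T]; L²(𝕋))} ≤ C h^p`. -/
def convergenceRates (α μ T R : ℝ) : Set ℝ :=
  {p : ℝ | 0 < p ∧ ∃ C : ℝ, 0 < C ∧ ∀ (M : ℕ) [NeZero M],
    ⨆ (u₀ : L2Torus) (_ : sobolevNorm (α / 2) u₀ < ENNReal.ofReal R),
      discretizationError α μ M T u₀ ≤ ENNReal.ofReal (C * mesh M ^ p)}

end FracNLS

end

open MeasureTheory Filter Topology
open scoped ENNReal Real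

noncomputable section

namespace FracNLS

/-! ### Global solutions of ordinary differential equations and Duhamel's formula -/

section Abstract

open Set Metric
open scoped NNReal

/-! The rate is decided by the linear flows. The symbols $|k|^\alpha$ and $\sigma_h(k)$ differ by
about $h^2|k|^{\alpha+2}$, so after time $T$ the two phases differ by at most $\min(2,
Th^2|k|^{\alpha+2})$. Divided by the Sobolev weight $|k|^{\alpha/2}$, this is largest near $|k|\sim
h^{-2/(2+\alpha)}$, where it is of order $h^{\alpha/(2+\alpha)}$. The other errors (averaging of the
data, linear interpolation, aliasing in the cubic term) are $O(h^{\alpha/2})$, which is of smaller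
order.

Upper bound: the discrete flow conserves mass and energy. As $\alpha>1$, the quartic part of the
energy can be absorbed for either sign of $\mu$, which bounds discrete solutions in $H^{\alpha/2}$
uniformly in $h$ (`exists_dSobLE_of_isDiscreteSolution`). Hence the trigonometric interpolant of the
discrete solution satisfies the continuum Duhamel formula up to $O(h^{\alpha/(2+\alpha)})$ in $L^2$
(`norm_trigInterp_sub_duhamel_le`), and Gronwall's inequality
(`IsBoundedGroup.norm_sub_le_of_approx_duhamel`) turns consistency into convergence.

Well-posedness: with the nonlinearity truncated at modulus $B$, both equations become ordinary
differential equations with a globally Lipschitz, bounded field, after passing to $U(-t)u(t)$. On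
the lattice, mass conservation makes the truncation inactive. On the torus, the truncated solution
is the $L^2$ limit of the interpolated discrete solutions and inherits their $H^{\alpha/2}$ bound,
hence a sup bound that removes the truncation (`exists_isSolution_and_norm_sub_le`). No conservation
law of the continuum equation is needed.

Sharpness: plane waves solve both equations explicitly. At a frequency of order $h^{-2/(2+\alpha)}$
and with amplitude of order $h^{\alpha/(2+\alpha)}$, as large as the $H^{\alpha/2}$ ball allows, the
phases of the two solutions separate by an amount of order one, so the error is at least a constant
times $h^{\alpha/(2+\alpha)}$ (`planeWave_error_ge`, `mesh_rpow_le_of_error_le`). -/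

theorem exists_global_hasDerivAt {E : Type*} [NormedAddCommGroup E] [NormedSpace ℝ E]
    [CompleteSpace E] {f : ℝ → E → E} {K L : ℝ≥0} (hK : ∀ t, LipschitzWith K (f t))
    (hc : ∀ x, Continuous fun t => f t x) (hL : ∀ t x, ‖f t x‖ ≤ L) (x₀ : E) :
    ∃ w : ℝ → E, w 0 = x₀ ∧ ∀ t, HasDerivAt w (f t (w t)) t := by
  have loc : ∀ n : ℕ, ∃ w : ℝ → E, w 0 = x₀ ∧
      ∀ t ∈ Ioo (-((n : ℝ) + 1)) ((n : ℝ) + 1), HasDerivAt w (f t (w t)) t := by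
    intro n
    have h0 : (0 : ℝ) ∈ Icc (-((n : ℝ) + 1)) ((n : ℝ) + 1) := by
      constructor <;> have := n.cast_nonneg (α := ℝ) <;> linarith
    -- A solution of speed at most `L` travels at most `L * (n + 1)` in this time, so a ball of that
    -- radius makes Picard–Lindelöf work on the whole interval.
    have hP : IsPicardLindelof f (⟨0, h0⟩ : Icc (-((n : ℝ) + 1)) ((n : ℝ) + 1)) x₀
        (L * ((n : ℝ≥0) + 1)) 0 L K :=
      { lipschitzOnWith := fun t _ => (hK t).lipschitzOnWith
        continuousOn := fun x _ => (hc x).continuousOn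
        norm_le := fun t _ x _ => hL t x
        mul_max_le := by simp }
    obtain ⟨w, hw0, hw⟩ := hP.exists_eq_forall_mem_Icc_hasDerivWithinAt₀
    exact ⟨w, hw0, fun t ht => (hw t (Ioo_subset_Icc_self ht)).hasDerivAt
      (Icc_mem_nhds ht.1 ht.2)⟩
  choose w hw0 hw using loc
  have agree : ∀ m n : ℕ, m ≤ n → EqOn (w m) (w n) (Ioo (-((m : ℝ) + 1)) ((m : ℝ) + 1)) := by
    intro m n hmn
    have hmn' : (m : ℝ) ≤ n := by exact_mod_cast hmn
    have hm0 : (0 : ℝ) ≤ m := m.cast_nonneg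
    refine ODE_solution_unique_of_mem_Ioo (v := f) (s := fun _ => univ) (K := K) (t₀ := 0)
      (fun t _ => (hK t).lipschitzOnWith) ⟨by linarith, by linarith⟩
      (fun t ht => ⟨hw m t ht, mem_univ _⟩)
      (fun t ht => ⟨hw n t ⟨by linarith [ht.1], by linarith [ht.2]⟩, mem_univ _⟩) ?_
    rw [hw0, hw0]
  -- Near any time the glued function, whose index varies with the time, coincides with a single `w
  -- n`; this makes it differentiable.
  have key : ∀ (n : ℕ) (t : ℝ), t ∈ Ioo (-((n : ℝ) + 1)) ((n : ℝ) + 1) →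
      w ⌈|t|⌉₊ t = w n t := by
    intro n t ht
    rcases le_total ⌈|t|⌉₊ n with h | h
    · refine agree _ _ h (abs_lt.mp ?_)
      exact (Nat.le_ceil _).trans_lt (by linarith)
    · exact (agree _ _ h ht).symm
  refine ⟨fun t => w ⌈|t|⌉₊ t, by simp [hw0], fun t => ?_⟩
  have ht : t ∈ Ioo (-((⌈|t|⌉₊ : ℝ) + 1)) ((⌈|t|⌉₊ : ℝ) + 1) :=
    abs_lt.mp ((Nat.le_ceil _).trans_lt (by linarith))
  refine (hw ⌈|t|⌉₊ t ht).congr_of_eventuallyEq ?_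
  filter_upwards [Ioo_mem_nhds ht.1 ht.2] with s hs using key _ _ hs

/-- Gronwall in integral form, for both directions of time. The right-hand side of the hypothesis is
differentiable although `φ` is only continuous, so the differential form applies to it; negative
times follow by reflection. -/
theorem le_mul_exp_of_le_add_abs_integral {φ : ℝ → ℝ} (hφ : Continuous φ) (h0 : ∀ t, 0 ≤ φ t)
    {δ L T : ℝ} (hL : 0 ≤ L) (h : ∀ t, |t| ≤ T → φ t ≤ δ + L * |∫ τ in (0 : ℝ)..t, φ τ|)
    {t : ℝ} (ht : |t| ≤ T) : φ t ≤ δ * Real.exp (L * |t|) := by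
  have main : ∀ ψ : ℝ → ℝ, Continuous ψ → (∀ t, 0 ≤ ψ t) →
      (∀ t, |t| ≤ T → ψ t ≤ δ + L * |∫ τ in (0 : ℝ)..t, ψ τ|) →
      ∀ t, 0 ≤ t → t ≤ T → ψ t ≤ δ * Real.exp (L * t) := by
    intro ψ hψ hp hb t ht0 htT
    have hd : ∀ s : ℝ, HasDerivAt (fun s => δ + L * ∫ τ in (0 : ℝ)..s, ψ τ) (L * ψ s) s :=
      fun s => (((hψ.integral_hasStrictDerivAt 0 s).hasDerivAt).const_mul L).const_add δ
    have hle : ∀ s, 0 ≤ s → s ≤ T → ψ s ≤ δ + L * ∫ τ in (0 : ℝ)..s, ψ τ := by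
      intro s hs hsT
      have := hb s (by rwa [abs_of_nonneg hs])
      rwa [abs_of_nonneg (intervalIntegral.integral_nonneg hs fun u _ => hp u)] at this
    have hδ : 0 ≤ δ := by simpa using (hp 0).trans (hle 0 le_rfl (ht0.trans htT))
    have := norm_le_gronwallBound_of_norm_deriv_right_le
      (f := fun s => δ + L * ∫ τ in (0 : ℝ)..s, ψ τ) (f' := fun s => L * ψ s) (δ := δ) (K := L)
      (ε := 0) (a := 0) (b := t)
      (fun s _ => (hd s).continuousAt.continuousWithinAt) (fun s _ => (hd s).hasDerivWithinAt)
      (by simp [abs_of_nonneg hδ]) ?_ t ⟨ht0, le_rfl⟩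
    · rw [gronwallBound_ε0, sub_zero] at this
      exact (hle t ht0 htT).trans ((le_abs_self _).trans this)
    · intro s hs
      rw [add_zero, norm_mul, Real.norm_of_nonneg hL, Real.norm_of_nonneg (hp s)]
      exact mul_le_mul_of_nonneg_left
        ((hle s hs.1 (hs.2.le.trans htT)).trans (le_abs_self _)) hL
  rcases le_total 0 t with h' | h'
  · rw [abs_of_nonneg h'] at ht ⊢
    exact main φ hφ h0 h t h' ht
  · rw [abs_of_nonpos h'] at ht ⊢
    have := main (fun s => φ (-s)) (hφ.comp continuous_neg) (fun s => h0 _) ?_ (-t)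
      (by linarith) ht
    · simpa using this
    · intro s hs
      have h1 := h (-s) (by rwa [abs_neg])
      have h2 : ∫ τ in (0 : ℝ)..s, φ (-τ) = -∫ τ in (0 : ℝ)..(-s), φ τ := by
        rw [intervalIntegral.integral_comp_neg, neg_zero, intervalIntegral.integral_symm]
      rwa [h2, abs_neg]

/-! ### Strongly continuous groups and Duhamel's formula. -/

variable {E : Type*} [NormedAddCommGroup E] [NormedSpace ℂ E]

/-- A strongly continuous one-parameter group of operators which is bounded by `K`. -/
structure IsBoundedGroup (U : ℝ → E →L[ℂ] E) (K : ℝ) : Prop where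
  zero : ∀ x, U 0 x = x
  add : ∀ s t x, U (s + t) x = U s (U t x)
  bound : ∀ t x, ‖U t x‖ ≤ K * ‖x‖
  continuous : ∀ x, Continuous fun t => U t x
  nonneg : 0 ≤ K

namespace IsBoundedGroup

variable {U : ℝ → E →L[ℂ] E} {K : ℝ}

theorem neg_apply (hU : IsBoundedGroup U K) (t : ℝ) (x : E) : U (-t) (U t x) = x := by
  rw [← hU.add, neg_add_cancel, hU.zero]

theorem apply_neg (hU : IsBoundedGroup U K) (t : ℝ) (x : E) : U t (U (-t) x) = x := by
  rw [← hU.add, add_neg_cancel, hU.zero]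

theorem sub_apply (hU : IsBoundedGroup U K) (s t : ℝ) (x : E) : U (s - t) x = U s (U (-t) x) := by
  rw [← hU.add, sub_eq_add_neg]

theorem continuous_comp {X : Type*} [TopologicalSpace X] (hU : IsBoundedGroup U K) {s : X → ℝ}
    {g : X → E} (hs : Continuous s) (hg : Continuous g) : Continuous fun t => U (s t) (g t) := by
  rw [continuous_iff_continuousAt]
  intro t₀
  have h1 : Tendsto (fun t => U (s t) (g t₀)) (𝓝 t₀) (𝓝 (U (s t₀) (g t₀))) :=
    ((hU.continuous (g t₀)).comp hs).continuousAt
  have h2 : Tendsto (fun t => U (s t) (g t - g t₀)) (𝓝 t₀) (𝓝 0) := by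
    refine squeeze_zero_norm (fun t => hU.bound _ _) ?_
    have : Tendsto (fun t => K * ‖g t - g t₀‖) (𝓝 t₀) (𝓝 (K * ‖g t₀ - g t₀‖)) :=
      (continuous_const.mul (hg.sub continuous_const).norm).continuousAt
    simpa using this
  have h3 := h2.add h1
  rw [zero_add] at h3
  refine h3.congr fun t => ?_
  rw [map_sub]; abel

variable [CompleteSpace E]

/-- Interaction picture: with `w t = U (-t) (u t)` the generator of `U`, possibly unbounded,
disappears, and strong continuity of the group is enough. -/
theorem duhamel_of_hasDerivAt (hU : IsBoundedGroup U K) {F : E → E} {c : ℂ} {w : ℝ → E}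
    (hw : ∀ t, HasDerivAt w (-(c • U (-t) (F (U t (w t))))) t)
    (hF : Continuous fun t => F (U t (w t))) (t : ℝ) :
    U t (w t) = U t (w 0) - c • ∫ τ in (0 : ℝ)..t, U (t - τ) (F (U τ (w τ))) := by
  have hc : Continuous fun τ => U (-τ) (F (U τ (w τ))) := hU.continuous_comp continuous_neg hF
  have h1 := intervalIntegral.integral_eq_sub_of_hasDerivAt (a := 0) (b := t)
    (fun τ _ => hw τ) ((hc.const_smul c).neg.intervalIntegrable _ _)
  rw [intervalIntegral.integral_neg, intervalIntegral.integral_smul] at h1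
  have h2 : w t = w 0 - c • ∫ τ in (0 : ℝ)..t, U (-τ) (F (U τ (w τ))) := by
    rw [sub_eq_add_neg, h1]; abel
  conv_lhs => rw [h2]
  rw [map_sub, map_smul, ← ContinuousLinearMap.intervalIntegral_comp_comm _
    (hc.intervalIntegrable _ _)]
  simp only [hU.sub_apply]

theorem eq_of_duhamel (hU : IsBoundedGroup U K) {g u : ℝ → E} {c : ℂ} {x₀ : E} {t : ℝ}
    (hg : Continuous g) (hu : u t = U t x₀ - c • ∫ τ in (0 : ℝ)..t, U (t - τ) (g τ)) :
    U (-t) (u t) = x₀ - c • ∫ τ in (0 : ℝ)..t, U (-τ) (g τ) := by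
  have hc : Continuous fun τ => U (-τ) (g τ) := hU.continuous_comp continuous_neg hg
  simp only [hU.sub_apply] at hu
  rw [ContinuousLinearMap.intervalIntegral_comp_comm _ (hc.intervalIntegrable _ _), ← map_smul,
    ← map_sub] at hu
  rw [hu, hU.neg_apply]

/-- The field `x ↦ -(c • U (-t) (F (U t x)))` is globally Lipschitz and bounded because `F` is. The
truncation of the cubic nonlinearity serves to meet these two hypotheses. -/
theorem exists_duhamel (hU : IsBoundedGroup U K) {F : E → E} {L D : ℝ≥0} (hF : LipschitzWith L F)
    (hD : ∀ x, ‖F x‖ ≤ D) (c : ℂ) (x₀ : E) :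
    ∃ u : ℝ → E, Continuous u ∧
      ∀ t, u t = U t x₀ - c • ∫ τ in (0 : ℝ)..t, U (t - τ) (F (u τ)) := by
  set K' : ℝ≥0 := ⟨K, hU.nonneg⟩
  have hLip : ∀ t, LipschitzWith K' (U t) := fun t =>
    LipschitzWith.of_dist_le_mul fun x y => by
      rw [dist_eq_norm, dist_eq_norm, ← map_sub]; exact hU.bound _ _
  have h1 : ∀ t, LipschitzWith (‖c‖₊ * (K' * (L * K'))) fun x => -(c • U (-t) (F (U t x))) := by
    intro t
    refine LipschitzWith.of_dist_le_mul fun x y => ?_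
    have := ((hLip (-t)).comp (hF.comp (hLip t))).dist_le_mul x y
    rw [dist_neg_neg, dist_smul₀]
    simpa [mul_assoc] using mul_le_mul_of_nonneg_left this (norm_nonneg c)
  have h2 : ∀ x, Continuous fun t => -(c • U (-t) (F (U t x))) := fun x =>
    ((hU.continuous_comp continuous_neg (hF.continuous.comp (hU.continuous x))).const_smul c).neg
  have h3 : ∀ t x, ‖-(c • U (-t) (F (U t x)))‖ ≤ (‖c‖₊ * (K' * D) : ℝ≥0) := by
    intro t x
    rw [norm_neg, norm_smul]
    push_cast
    refine mul_le_mul_of_nonneg_left ((hU.bound _ _).trans ?_) (norm_nonneg c)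
    exact mul_le_mul_of_nonneg_left (hD _) hU.nonneg
  obtain ⟨w, hw0, hw⟩ := exists_global_hasDerivAt h1 h2 h3 x₀
  have hcw : Continuous w := continuous_iff_continuousAt.mpr fun t => (hw t).continuousAt
  have hcu : Continuous fun t => U t (w t) := hU.continuous_comp continuous_id hcw
  exact ⟨fun t => U t (w t), hcu, fun t =>
    hw0 ▸ hU.duhamel_of_hasDerivAt hw (hF.continuous.comp hcu) t⟩

-- Stability: a curve that satisfies Duhamel's formula up to `δ` stays within a Gronwall factor
-- times `δ` of the solution. It gives convergence from consistency, and uniqueness for `δ = 0`.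
omit [CompleteSpace E] in
theorem norm_sub_le_of_approx_duhamel (hU : IsBoundedGroup U K) {F : E → E} {L : ℝ≥0}
    (hF : LipschitzWith L F) {c : ℂ} {x₀ : E} {T δ : ℝ} {u v : ℝ → E} (hu : Continuous u)
    (hv : Continuous v)
    (hus : ∀ t, |t| ≤ T → u t = U t x₀ - c • ∫ τ in (0 : ℝ)..t, U (t - τ) (F (u τ)))
    (hvs : ∀ t, |t| ≤ T →
      ‖v t - (U t x₀ - c • ∫ τ in (0 : ℝ)..t, U (t - τ) (F (v τ)))‖ ≤ δ)
    {t : ℝ} (ht : |t| ≤ T) : ‖v t - u t‖ ≤ δ * Real.exp (‖c‖ * (K * L) * |t|) := by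
  refine le_mul_exp_of_le_add_abs_integral (φ := fun t => ‖v t - u t‖) (hv.sub hu).norm
    (fun _ => norm_nonneg _) (by have := hU.nonneg; positivity) (fun s hs => ?_) ht
  have hi : ∀ w : ℝ → E, Continuous w →
      IntervalIntegrable (fun τ => U (s - τ) (F (w τ))) volume 0 s := fun w hw =>
    (hU.continuous_comp (continuous_const.sub continuous_id)
      (hF.continuous.comp hw)).intervalIntegrable _ _
  have key : v s - u s = (v s - (U s x₀ - c • ∫ τ in (0 : ℝ)..s, U (s - τ) (F (v τ)))) -
      c • ∫ τ in (0 : ℝ)..s, (U (s - τ) (F (v τ)) - U (s - τ) (F (u τ))) := by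
    rw [intervalIntegral.integral_sub (hi v hv) (hi u hu), smul_sub]
    nth_rw 1 [hus s hs]
    abel
  calc ‖v s - u s‖ ≤ δ + ‖c‖ * |∫ τ in (0 : ℝ)..s, K * (L * ‖v τ - u τ‖)| := by
        rw [key]
        refine (norm_sub_le _ _).trans (add_le_add (hvs s hs) ?_)
        rw [norm_smul]
        refine mul_le_mul_of_nonneg_left ?_ (norm_nonneg _)
        refine intervalIntegral.norm_integral_le_abs_of_norm_le
          (Eventually.of_forall fun τ => ?_) ?_
        · rw [← map_sub]
          refine (hU.bound _ _).trans (mul_le_mul_of_nonneg_left ?_ hU.nonneg)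
          rw [← dist_eq_norm, ← dist_eq_norm]
          exact hF.dist_le_mul _ _
        · exact (continuous_const.mul
            (continuous_const.mul (hv.sub hu).norm)).intervalIntegrable _ _
    _ = _ := by
        rw [intervalIntegral.integral_const_mul, intervalIntegral.integral_const_mul, abs_mul,
          abs_mul, abs_of_nonneg hU.nonneg, abs_of_nonneg L.coe_nonneg]
        ring

omit [CompleteSpace E] in
theorem eq_of_duhamel_of_lipschitz (hU : IsBoundedGroup U K) {F : E → E} {L : ℝ≥0}
    (hF : LipschitzWith L F) {c : ℂ} {x₀ : E} {T : ℝ} {u v : ℝ → E} (hu : Continuous u)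
    (hv : Continuous v)
    (hus : ∀ t, |t| ≤ T → u t = U t x₀ - c • ∫ τ in (0 : ℝ)..t, U (t - τ) (F (u τ)))
    (hvs : ∀ t, |t| ≤ T → v t = U t x₀ - c • ∫ τ in (0 : ℝ)..t, U (t - τ) (F (v τ)))
    {t : ℝ} (ht : |t| ≤ T) : v t = u t := by
  have := hU.norm_sub_le_of_approx_duhamel hF hu hv hus (δ := 0)
    (fun t ht => by rw [← hvs t ht, sub_self, norm_zero]) ht
  rw [zero_mul] at this
  exact sub_eq_zero.mp (norm_le_zero_iff.mp this)

end IsBoundedGroup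

end Abstract

/-! ### The cubic nonlinearity and its truncation -/

section Cubic

open scoped NNReal

/-- The function `z ↦ |z|² z`. -/
def cubicFun (z : ℂ) : ℂ := ((‖z‖ ^ 2 : ℝ) : ℂ) * z

theorem norm_cubicFun (z : ℂ) : ‖cubicFun z‖ = ‖z‖ ^ 3 := by
  rw [cubicFun, norm_mul, Complex.norm_real, Real.norm_of_nonneg (by positivity)]; ring

theorem norm_cubicFun_sub_le {B : ℝ} {a b : ℂ} (ha : ‖a‖ ≤ B) (hb : ‖b‖ ≤ B) :
    ‖cubicFun a - cubicFun b‖ ≤ 3 * B ^ 2 * ‖a - b‖ := by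
  have h : cubicFun a - cubicFun b =
      ((‖a‖ ^ 2 : ℝ) : ℂ) * (a - b) + ((‖a‖ ^ 2 - ‖b‖ ^ 2 : ℝ) : ℂ) * b := by
    simp only [cubicFun]; push_cast; ring
  rw [h]
  refine (norm_add_le _ _).trans ?_
  rw [norm_mul, norm_mul, Complex.norm_real, Complex.norm_real,
    Real.norm_of_nonneg (by positivity), Real.norm_eq_abs,
    show ‖a‖ ^ 2 - ‖b‖ ^ 2 = (‖a‖ + ‖b‖) * (‖a‖ - ‖b‖) by ring, abs_mul,
    abs_of_nonneg (by positivity : 0 ≤ ‖a‖ + ‖b‖)]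
  have h1 := abs_norm_sub_norm_le a b
  have h2 := norm_nonneg a
  have h3 := norm_nonneg b
  have h4 := norm_nonneg (a - b)
  have h5 : ‖a‖ ^ 2 * ‖a - b‖ ≤ B ^ 2 * ‖a - b‖ := by gcongr
  have h6 : (‖a‖ + ‖b‖) * |‖a‖ - ‖b‖| * ‖b‖ ≤ (B + B) * ‖a - b‖ * B := by
    have : 0 ≤ B := h2.trans ha
    gcongr
  nlinarith

/-- The radial projection of `ℂ` onto the closed disc of radius `B`. -/
def radialProj (B : ℝ) (z : ℂ) : ℂ := ((B / max B ‖z‖ : ℝ) : ℂ) * z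

theorem radialProj_of_norm_le {B : ℝ} {z : ℂ} (h : ‖z‖ ≤ B) : radialProj B z = z := by
  rcases eq_or_ne z 0 with rfl | hz
  · simp [radialProj]
  · have : B ≠ 0 := ((norm_pos_iff.mpr hz).trans_le h).ne'
    simp [radialProj, max_eq_left h, this]

theorem norm_radialProj_le {B : ℝ} (hB : 0 ≤ B) (z : ℂ) : ‖radialProj B z‖ ≤ B := by
  rw [radialProj, norm_mul, Complex.norm_real, Real.norm_of_nonneg (by positivity), div_mul_eq_mul_div]
  exact div_le_of_le_mul₀ (by positivity) hB (mul_le_mul_of_nonneg_left (le_max_right _ _) hB)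

theorem norm_radialProj_sub_le {B : ℝ} (hB : 0 ≤ B) (z w : ℂ) :
    ‖radialProj B z - radialProj B w‖ ≤ 2 * ‖z - w‖ := by
  rcases hB.eq_or_lt with rfl | hB
  · simp [radialProj]
  set p := max B ‖z‖ with hp
  set q := max B ‖w‖ with hq
  have hp0 : 0 < p := lt_max_of_lt_left hB
  have hq0 : 0 < q := lt_max_of_lt_left hB
  have h : radialProj B z - radialProj B w =
      ((B / p : ℝ) : ℂ) * (z - w) + ((B / p * ((q - p) / q) : ℝ) : ℂ) * w := by
    have : B / p * ((q - p) / q) = B / p - B / q := by field_simp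
    rw [this, radialProj, radialProj, ← hp, ← hq]; push_cast; ring
  have h1 : B / p ≤ 1 := div_le_one_of_le₀ (le_max_left _ _) hp0.le
  have h2 : |q - p| ≤ ‖z - w‖ := by
    have := abs_max_sub_max_le_max B ‖w‖ B ‖z‖
    rw [sub_self, abs_zero, max_eq_right (abs_nonneg (‖w‖ - ‖z‖))] at this
    rw [norm_sub_rev]
    exact this.trans (abs_norm_sub_norm_le w z)
  rw [h]
  refine (norm_add_le _ _).trans ?_
  rw [norm_mul, norm_mul, Complex.norm_real, Complex.norm_real, Real.norm_of_nonneg (by positivity),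
    Real.norm_eq_abs, abs_mul, abs_of_nonneg (by positivity : 0 ≤ B / p), abs_div, abs_of_pos hq0]
  have h3 : B / p * (|q - p| / q) * ‖w‖ ≤ 1 * ‖z - w‖ := by
    rw [mul_assoc]
    refine mul_le_mul h1 ?_ (by positivity) zero_le_one
    rw [div_mul_eq_mul_div, div_le_iff₀ hq0]
    exact mul_le_mul h2 (le_max_right _ _) (norm_nonneg _) (norm_nonneg _)
  have h4 : B / p * ‖z - w‖ ≤ 1 * ‖z - w‖ := mul_le_mul_of_nonneg_right h1 (norm_nonneg _)
  linarith

/-- The nonlinearity `z ↦ |z|² z`, truncated at `|z| = B`. -/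
def cubicTruncFun (B : ℝ) (z : ℂ) : ℂ := cubicFun (radialProj B z)

theorem cubicTruncFun_of_norm_le {B : ℝ} {z : ℂ} (h : ‖z‖ ≤ B) : cubicTruncFun B z = cubicFun z := by
  rw [cubicTruncFun, radialProj_of_norm_le h]

theorem norm_cubicTruncFun_le {B : ℝ} (hB : 0 ≤ B) (z : ℂ) : ‖cubicTruncFun B z‖ ≤ B ^ 3 := by
  rw [cubicTruncFun, norm_cubicFun]
  exact pow_le_pow_left₀ (norm_nonneg _) (norm_radialProj_le hB z) 3

/-- Mass conservation uses of the nonlinearity only that it is a real multiple of the solution;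
truncation keeps this property. -/
theorem exists_cubicTruncFun_eq (B : ℝ) (z : ℂ) : ∃ r : ℝ, cubicTruncFun B z = r * z :=
  ⟨‖radialProj B z‖ ^ 2 * (B / max B ‖z‖), by
    rw [cubicTruncFun, cubicFun]; nth_rw 2 [radialProj]; push_cast; ring⟩

theorem lipschitzWith_cubicTruncFun (B : ℝ≥0) : LipschitzWith (6 * B ^ 2) (cubicTruncFun B) := by
  refine LipschitzWith.of_dist_le_mul fun z w => ?_
  rw [dist_eq_norm, dist_eq_norm]
  have h := norm_cubicFun_sub_le (norm_radialProj_le B.coe_nonneg z)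
    (norm_radialProj_le B.coe_nonneg w)
  have h2 := mul_le_mul_of_nonneg_left (norm_radialProj_sub_le B.coe_nonneg z w)
    (by positivity : (0 : ℝ) ≤ 3 * (B : ℝ) ^ 2)
  push_cast
  exact h.trans (h2.trans_eq (by ring))

theorem cubicTruncFun_zero (B : ℝ) : cubicTruncFun B 0 = 0 := by
  simp [cubicTruncFun, cubicFun, radialProj]

/-- The truncated nonlinearity on `L²(𝕋)`. -/
def cubicTrunc (B : ℝ≥0) (f : L2Torus) : L2Torus :=
  (lipschitzWith_cubicTruncFun B).compLp (cubicTruncFun_zero B) f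

theorem lipschitzWith_cubicTrunc (B : ℝ≥0) : LipschitzWith (6 * B ^ 2) (cubicTrunc B) :=
  (lipschitzWith_cubicTruncFun B).lipschitzWith_compLp (cubicTruncFun_zero B)

theorem coeFn_cubicTrunc (B : ℝ≥0) (f : L2Torus) :
    cubicTrunc B f =ᵐ[AddCircle.haarAddCircle] fun x => cubicTruncFun B (f x) :=
  (lipschitzWith_cubicTruncFun B).coeFn_compLp (cubicTruncFun_zero B) f

theorem norm_cubicTrunc_le (B : ℝ≥0) (f : L2Torus) : ‖cubicTrunc B f‖ ≤ (B ^ 3 : ℝ≥0) := by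
  have := Lp.norm_le_of_ae_bound (f := cubicTrunc B f) (C := (B : ℝ) ^ 3) (by positivity) (by
    filter_upwards [coeFn_cubicTrunc B f] with x hx
    rw [hx]; exact norm_cubicTruncFun_le B.coe_nonneg _)
  simpa [measureUnivNNReal] using this

theorem cubicTrunc_eq_cubic {B : ℝ≥0} {f : L2Torus}
    (hf : ∀ᵐ x ∂AddCircle.haarAddCircle (T := 2 * π), ‖f x‖ ≤ B) : cubicTrunc B f = cubic f := by
  have hae : (fun x : Torus => ((‖f x‖ ^ 2 : ℝ) : ℂ) * f x)
      =ᵐ[AddCircle.haarAddCircle (T := 2 * π)] cubicTrunc B f := by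
    filter_upwards [hf, coeFn_cubicTrunc B f] with x h1 h2
    rw [h2, cubicTruncFun_of_norm_le h1, cubicFun]
  have hm : MemLp (fun x : Torus => ((‖f x‖ ^ 2 : ℝ) : ℂ) * f x) 2
      (AddCircle.haarAddCircle (T := 2 * π)) := (memLp_congr_ae hae).mpr (Lp.memLp _)
  -- A bounded `f` never meets the default value `0` of `cubic`.
  rw [cubic, dif_pos hm]
  refine Lp.ext ?_
  exact hae.symm.trans hm.coeFn_toLp.symm

/-- The truncated nonlinearity on the lattice. -/
def discreteCubicTrunc (M : ℕ) (B : ℝ) (g : Lattice M) : Lattice M := fun j => cubicTruncFun B (g j)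

theorem lipschitzWith_discreteCubicTrunc (M : ℕ) [NeZero M] (B : ℝ≥0) :
    LipschitzWith (6 * B ^ 2) (discreteCubicTrunc M B) := by
  refine LipschitzWith.of_dist_le_mul fun g g' => ?_
  refine (dist_pi_le_iff (by positivity)).mpr fun j => ?_
  exact ((lipschitzWith_cubicTruncFun B).dist_le_mul _ _).trans
    (mul_le_mul_of_nonneg_left (dist_le_pi_dist g g' j) (by positivity))

theorem norm_discreteCubicTrunc_le (M : ℕ) [NeZero M] (B : ℝ≥0) (g : Lattice M) :
    ‖discreteCubicTrunc M B g‖ ≤ (B ^ 3 : ℝ≥0) :=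
  (pi_norm_le_iff_of_nonneg (by positivity)).mpr fun j => by
    push_cast; exact norm_cubicTruncFun_le B.coe_nonneg (g j)

theorem discreteCubicTrunc_eq (M : ℕ) {B : ℝ} {g : Lattice M} (h : ∀ j, ‖g j‖ ≤ B) :
    discreteCubicTrunc M B g = discreteCubic M g := by
  funext j
  rw [discreteCubicTrunc, cubicTruncFun_of_norm_le (h j)]; rfl

theorem continuous_discreteCubic (M : ℕ) : Continuous (discreteCubic M) := by
  unfold discreteCubic; fun_prop

end Cubic

/-! ### Fourier coefficients, the free evolution and Sobolev bounds on the torus -/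

section Torus

open scoped NNReal

/-- The weight `(1 + k²)^{α/2}`. -/
def weight (α : ℝ) (k : ℤ) : ℝ := (1 + (k : ℝ) ^ 2) ^ (α / 2)

theorem weight_pos (α : ℝ) (k : ℤ) : 0 < weight α k := Real.rpow_pos_of_pos (by positivity) _

theorem one_le_weight {α : ℝ} (hα : 0 ≤ α) (k : ℤ) : 1 ≤ weight α k :=
  Real.one_le_rpow (by nlinarith [sq_nonneg (k : ℝ)]) (by positivity)

theorem abs_rpow_le_weight {α : ℝ} (hα : 0 ≤ α) (k : ℤ) : |(k : ℝ)| ^ α ≤ weight α k := by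
  have : |(k : ℝ)| ^ α = ((k : ℝ) ^ 2) ^ (α / 2) := by
    rw [← sq_abs, ← Real.rpow_natCast, ← Real.rpow_mul (abs_nonneg _)]
    congr 1; push_cast; ring
  rw [this, weight]
  exact Real.rpow_le_rpow (sq_nonneg _) (by linarith) (by positivity)

/-- The weight grows like $|k|^\alpha$. Here $\alpha>1$ enters: by Cauchy–Schwarz it makes Fourier
coefficients of $H^{\alpha/2}$ functions absolutely summable, which gives sup bounds and the algebra
property. -/
theorem summable_inv_weight {α : ℝ} (hα : 1 < α) : Summable fun k : ℤ => 1 / weight α k := by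
  -- `|0| ^ (-α)` is `0`, so the frequency `0` needs the extra term.
  have h1 : Summable fun k : ℤ => |(k : ℝ)| ^ (-α) + if k = 0 then (1 : ℝ) else 0 :=
    (Real.summable_abs_int_rpow hα).add (summable_of_hasFiniteSupport
      ((Set.finite_singleton (0 : ℤ)).subset fun k hk => by
        by_contra h; exact hk (if_neg h)))
  refine h1.of_nonneg_of_le (fun k => (one_div_pos.mpr (weight_pos α k)).le) fun k => ?_
  rcases eq_or_ne k 0 with rfl | hk
  · simp [weight, Real.zero_rpow (by linarith : -α ≠ 0)]
  · have hk' : 0 < |(k : ℝ)| := abs_pos.mpr (by exact_mod_cast hk)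
    rw [if_neg hk, add_zero, Real.rpow_neg (abs_nonneg _), ← one_div]
    exact one_div_le_one_div_of_le (Real.rpow_pos_of_pos hk' _)
      (abs_rpow_le_weight (by linarith) k)

/-- The sum `∑ₖ (wₖ + λ)⁻¹`, `wₖ = (1 + k²)^{α/2}`. -/
def weightSum (α l : ℝ) : ℝ := ∑' k : ℤ, 1 / (weight α k + l)

theorem summable_weightSum {α l : ℝ} (hα : 1 < α) (hl : 0 ≤ l) :
    Summable fun k : ℤ => 1 / (weight α k + l) :=
  (summable_inv_weight hα).of_nonneg_of_le
    (fun k => by have := weight_pos α k; positivity)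
    fun k => one_div_le_one_div_of_le (weight_pos α k) (by linarith)

theorem weightSum_nonneg {α l : ℝ} (hl : 0 ≤ l) : 0 ≤ weightSum α l :=
  tsum_nonneg fun k => by have := weight_pos α k; positivity

/-- In the bound of $\|f\|_\infty^2$ by `weightSum α l` times $\|f\|_{H^{\alpha/2}}^2 +
l\|f\|_{L^2}^2$, a large `l` makes the constant in front of the Sobolev norm small. The energy
estimate relies on this when `μ` is negative. -/
theorem tendsto_weightSum {α : ℝ} (hα : 1 < α) : Tendsto (weightSum α) atTop (𝓝 0) := by
  have := tendsto_tsum_of_dominated_convergence (𝓕 := atTop) (f := fun l k => 1 / (weight α k + l))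
    (g := fun _ => (0 : ℝ)) (summable_inv_weight hα) (fun k => ?_) ?_
  · rw [tsum_zero] at this; exact this
  · simp only [one_div]
    exact tendsto_inv_atTop_zero.comp (tendsto_atTop_add_const_left _ _ tendsto_id)
  · filter_upwards [eventually_ge_atTop 0] with l hl k
    have := weight_pos α k
    rw [Real.norm_of_nonneg (by positivity)]
    exact one_div_le_one_div_of_le this (by linarith)

theorem sq_sum_le_weightSum_mul {α l : ℝ} (hα : 1 < α) (hl : 0 ≤ l) (s : Finset ℤ) (a : ℤ → ℝ) :
    (∑ k ∈ s, a k) ^ 2 ≤ weightSum α l * ∑ k ∈ s, (weight α k + l) * a k ^ 2 := by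
  have hw : ∀ k, 0 < weight α k + l := fun k => by have := weight_pos α k; positivity
  calc (∑ k ∈ s, a k) ^ 2
      ≤ (∑ k ∈ s, 1 / (weight α k + l)) * ∑ k ∈ s, (weight α k + l) * a k ^ 2 := by
        refine Finset.sum_sq_le_sum_mul_sum_of_sq_le_mul s (fun k _ => by have := hw k; positivity)
          (fun k _ => by have := hw k; positivity) (fun k _ => ?_)
        have := (hw k).ne'
        rw [← mul_assoc, one_div, inv_mul_cancel₀ this, one_mul]
    _ ≤ _ := by
        refine mul_le_mul_of_nonneg_right ?_
          (Finset.sum_nonneg fun k _ => by have := hw k; positivity)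
        exact (summable_weightSum hα hl).sum_le_tsum s fun k _ => by have := hw k; positivity

/-- The normalized Fourier coefficient `(2π)⁻¹ f̂(k)`. -/
def coeff (k : ℤ) : L2Torus →L[ℂ] ℂ := innerSL ℂ (fourierLp (T := 2 * π) 2 k)

theorem coeff_eq_repr (k : ℤ) (f : L2Torus) : coeff k f = fourierBasis.repr f k := by
  rw [HilbertBasis.repr_apply_apply, coe_fourierBasis]; rfl

theorem coeff_eq_fourierCoeff (k : ℤ) (f : L2Torus) : coeff k f = fourierCoeff f k := by
  rw [coeff_eq_repr, fourierBasis_repr]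

theorem coeff_ext {f g : L2Torus} (h : ∀ k, coeff k f = coeff k g) : f = g := by
  apply fourierBasis.repr.injective
  ext k
  rw [← coeff_eq_repr, ← coeff_eq_repr, h]

theorem hasSum_sq_coeff (f : L2Torus) : HasSum (fun k => ‖coeff k f‖ ^ 2) (‖f‖ ^ 2) := by
  simp_rw [coeff_eq_repr]
  have : HasSum (fun i => ‖fourierBasis.repr f i‖ ^ 2) (‖fourierBasis.repr f‖ ^ 2) := by
    apply_mod_cast lp.hasSum_norm ?_ (fourierBasis.repr f)
    simp
  simpa using this

theorem coeff_fourierLp (k l : ℤ) :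
    coeff k (fourierLp (T := 2 * π) 2 l : L2Torus) = if k = l then 1 else 0 := by
  simpa [coeff] using orthonormal_iff_ite.mp (orthonormal_fourier (T := 2 * π)) k l

theorem coeff_freeEvolution (α t : ℝ) (k : ℤ) (f : L2Torus) :
    coeff k (freeEvolution α t f) = freeSymbol α t k * coeff k f := by
  rw [coeff_eq_repr, coeff_eq_repr, freeEvolution, LinearIsometryEquiv.apply_symm_apply]

/-- The free evolution as a linear isometry. -/
def freeIsometry (α t : ℝ) : L2Torus →ₗᵢ[ℂ] L2Torus where
  toFun := freeEvolution α t
  map_add' f g := coeff_ext fun k => by simp only [map_add, coeff_freeEvolution, mul_add]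
  map_smul' c f := coeff_ext fun k => by
    simp only [map_smul, coeff_freeEvolution, RingHom.id_apply, smul_eq_mul]; ring
  norm_map' f := by
    have h1 := hasSum_sq_coeff (freeEvolution α t f)
    simp only [coeff_freeEvolution, norm_mul, norm_freeSymbol, one_mul] at h1
    exact (pow_left_inj₀ (norm_nonneg _) (norm_nonneg _) two_ne_zero).mp
      (h1.unique (hasSum_sq_coeff f))

/-- The free evolution as a bounded operator. -/
def freeOp (α t : ℝ) : L2Torus →L[ℂ] L2Torus := (freeIsometry α t).toContinuousLinearMap

theorem coeff_freeOp (α t : ℝ) (k : ℤ) (f : L2Torus) :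
    coeff k (freeOp α t f) = freeSymbol α t k * coeff k f := coeff_freeEvolution α t k f

theorem norm_freeOp (α t : ℝ) (f : L2Torus) : ‖freeOp α t f‖ = ‖f‖ :=
  (freeIsometry α t).norm_map f

theorem freeSymbol_zero (α : ℝ) (k : ℤ) : freeSymbol α 0 k = 1 := by simp [freeSymbol]

theorem freeSymbol_add (α s t : ℝ) (k : ℤ) :
    freeSymbol α (s + t) k = freeSymbol α s k * freeSymbol α t k := by
  rw [freeSymbol, freeSymbol, freeSymbol, ← Complex.exp_add]
  congr 1; push_cast; ring

theorem continuous_freeSymbol (α : ℝ) (k : ℤ) : Continuous fun t => freeSymbol α t k := by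
  unfold freeSymbol; fun_prop

/-- Dominated convergence, as the symbols differ by at most `2`. The weight `1` yields strong
continuity on $L^2$, the Sobolev weight yields it on $H^{\alpha/2}$. -/
theorem tendsto_tsum_freeSymbol_sub (α : ℝ) {w : ℤ → ℝ} (hw : ∀ k, 0 ≤ w k) (f : L2Torus)
    (hf : Summable fun k => w k * ‖coeff k f‖ ^ 2) (t₀ : ℝ) :
    Tendsto (fun t => ∑' k, w k * ‖coeff k (freeOp α t f - freeOp α t₀ f)‖ ^ 2) (𝓝 t₀) (𝓝 0) := by
  have h := tendsto_tsum_of_dominated_convergence (𝓕 := 𝓝 t₀)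
    (f := fun t k => w k * ‖coeff k (freeOp α t f - freeOp α t₀ f)‖ ^ 2) (g := fun _ => (0 : ℝ))
    (hf.mul_left 4) (fun k => ?_) ?_
  · simpa using h
  · have : Continuous fun t => w k * ‖coeff k (freeOp α t f - freeOp α t₀ f)‖ ^ 2 := by
      simp only [map_sub, coeff_freeOp]
      have := continuous_freeSymbol α k
      fun_prop
    simpa using this.tendsto t₀
  · refine Eventually.of_forall fun t k => ?_
    rw [Real.norm_of_nonneg (mul_nonneg (hw k) (by positivity)), map_sub, coeff_freeOp,
      coeff_freeOp, ← sub_mul, norm_mul, mul_pow]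
    have h1 : ‖freeSymbol α t k - freeSymbol α t₀ k‖ ≤ 2 := by
      refine (norm_sub_le _ _).trans_eq ?_
      rw [norm_freeSymbol, norm_freeSymbol]; norm_num
    have h2 : ‖freeSymbol α t k - freeSymbol α t₀ k‖ ^ 2 ≤ 4 := by
      nlinarith [norm_nonneg (freeSymbol α t k - freeSymbol α t₀ k)]
    nlinarith [mul_nonneg (hw k) (sq_nonneg ‖coeff k f‖)]

theorem isBoundedGroup_freeOp (α : ℝ) : IsBoundedGroup (freeOp α) 1 where
  zero f := coeff_ext fun k => by rw [coeff_freeOp, freeSymbol_zero, one_mul]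
  add s t f := coeff_ext fun k => by
    rw [coeff_freeOp, coeff_freeOp, coeff_freeOp, freeSymbol_add, mul_assoc]
  bound t f := by rw [norm_freeOp, one_mul]
  continuous f := by
    rw [continuous_iff_continuousAt]
    intro t₀
    have h := tendsto_tsum_freeSymbol_sub α (w := fun _ => 1) (fun _ => zero_le_one) f
      (by simpa using (hasSum_sq_coeff f).summable) t₀
    simp only [one_mul, (hasSum_sq_coeff _).tsum_eq] at h
    have h2 := h.sqrt
    simp only [Real.sqrt_sq (norm_nonneg _), Real.sqrt_zero] at h2
    exact tendsto_iff_norm_sub_tendsto_zero.mpr h2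
  nonneg := zero_le_one

/-- The map that sends `f` to the weighted Fourier coefficients with index in `s`. -/
def sobTrunc (α : ℝ) (s : Finset ℤ) : L2Torus →L[ℂ] EuclideanSpace ℂ s :=
  (EuclideanSpace.equiv s ℂ).symm.toContinuousLinearMap ∘L
    ContinuousLinearMap.pi fun k : s => ((√(weight α k) : ℝ) : ℂ) • coeff (k : ℤ)

theorem norm_sq_sobTrunc (α : ℝ) (s : Finset ℤ) (f : L2Torus) :
    ‖sobTrunc α s f‖ ^ 2 = ∑ k ∈ s, weight α k * ‖coeff k f‖ ^ 2 := by
  rw [EuclideanSpace.norm_sq_eq, ← Finset.sum_coe_sort s]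
  refine Finset.sum_congr rfl fun k _ => ?_
  have : sobTrunc α s f k = ((√(weight α k) : ℝ) : ℂ) * coeff (k : ℤ) f := rfl
  rw [this, norm_mul, mul_pow, Complex.norm_real, Real.norm_of_nonneg (Real.sqrt_nonneg _),
    Real.sq_sqrt (weight_pos _ _).le]

/-- `(∑ₖ (1 + k²)^{α/2} |cₖ|²)^{1/2} ≤ A` for the normalized Fourier coefficients `cₖ` of `f`. -/
def SobLE (α A : ℝ) (f : L2Torus) : Prop := ∀ s, ‖sobTrunc α s f‖ ≤ A

namespace SobLE

variable {α A A' : ℝ} {f g : L2Torus}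

theorem nonneg (hf : SobLE α A f) : 0 ≤ A := (norm_nonneg _).trans (hf ∅)

theorem mono (hf : SobLE α A f) (h : A ≤ A') : SobLE α A' f := fun s => (hf s).trans h

theorem sum_le (hf : SobLE α A f) (s : Finset ℤ) : ∑ k ∈ s, weight α k * ‖coeff k f‖ ^ 2 ≤ A ^ 2 := by
  rw [← norm_sq_sobTrunc]
  exact pow_le_pow_left₀ (norm_nonneg _) (hf s) 2

theorem of_sum_le (hA : 0 ≤ A) (h : ∀ s : Finset ℤ, ∑ k ∈ s, weight α k * ‖coeff k f‖ ^ 2 ≤ A ^ 2) :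
    SobLE α A f := fun s => by
  rw [← pow_le_pow_iff_left₀ (norm_nonneg _) hA two_ne_zero, norm_sq_sobTrunc]
  exact h s

theorem summable (hf : SobLE α A f) : Summable fun k => weight α k * ‖coeff k f‖ ^ 2 :=
  summable_of_sum_le (fun k => mul_nonneg (weight_pos α k).le (sq_nonneg _)) hf.sum_le

theorem tsum_le (hf : SobLE α A f) : ∑' k, weight α k * ‖coeff k f‖ ^ 2 ≤ A ^ 2 :=
  hf.summable.tsum_le_of_sum_le hf.sum_le

theorem of_tsum_le (hA : 0 ≤ A) (hs : Summable fun k => weight α k * ‖coeff k f‖ ^ 2)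
    (h : ∑' k, weight α k * ‖coeff k f‖ ^ 2 ≤ A ^ 2) : SobLE α A f :=
  of_sum_le hA fun s =>
    (hs.sum_le_tsum s fun k _ => mul_nonneg (weight_pos α k).le (sq_nonneg _)).trans h

theorem add (hf : SobLE α A f) (hg : SobLE α A' g) : SobLE α (A + A') (f + g) := fun s => by
  rw [map_add]; exact (norm_add_le _ _).trans (add_le_add (hf s) (hg s))

theorem smul (hf : SobLE α A f) (c : ℂ) : SobLE α (‖c‖ * A) (c • f) := fun s => by
  rw [map_smul, norm_smul]; exact mul_le_mul_of_nonneg_left (hf s) (norm_nonneg _)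

theorem sub (hf : SobLE α A f) (hg : SobLE α A' g) : SobLE α (A + A') (f - g) := fun s => by
  rw [map_sub]; exact (norm_sub_le _ _).trans (add_le_add (hf s) (hg s))

/-- The Sobolev norm is not continuous on $L^2$, but its truncation to finitely many frequencies is;
so bounds survive $L^2$ limits. For the same reason they pass through the $L^2$-valued integrals
below. -/
theorem of_tendsto {ι : Type*} {l : Filter ι} [l.NeBot] {F : ι → L2Torus}
    (hF : ∀ᶠ i in l, SobLE α A (F i)) (h : Tendsto F l (𝓝 f)) : SobLE α A f := fun s =>
  le_of_tendsto (((sobTrunc α s).continuous.tendsto f).comp h).norm (hF.mono fun _ hi => hi s)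

theorem intervalIntegral {a b : ℝ} {G : ℝ → L2Torus} (hc : Continuous G)
    (hG : ∀ t, SobLE α A (G t)) : SobLE α (A * |b - a|) (∫ t in a..b, G t) := fun s => by
  rw [← ContinuousLinearMap.intervalIntegral_comp_comm _ (hc.intervalIntegrable _ _)]
  exact intervalIntegral.norm_integral_le_of_norm_le_const fun t _ => hG t s

theorem norm_le (hf : SobLE α A f) (hα : 0 ≤ α) : ‖f‖ ≤ A := by
  rw [← pow_le_pow_iff_left₀ (norm_nonneg _) hf.nonneg two_ne_zero]
  refine hasSum_le_of_sum_le (hasSum_sq_coeff f) fun s => le_trans ?_ (hf.sum_le s)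
  exact Finset.sum_le_sum fun k _ => le_mul_of_one_le_left (sq_nonneg _) (one_le_weight hα k)

theorem freeOp (hf : SobLE α A f) (t : ℝ) : SobLE α A (freeOp α t f) :=
  of_sum_le hf.nonneg fun s => by
    simpa only [coeff_freeOp, norm_mul, norm_freeSymbol, one_mul] using hf.sum_le s

theorem sum_norm_le (hα : 1 < α) (hf : SobLE α A f) (s : Finset ℤ) :
    ∑ k ∈ s, ‖coeff k f‖ ≤ √(weightSum α 0) * A := by
  have h := sq_sum_le_weightSum_mul hα le_rfl s fun k => ‖coeff k f‖
  simp only [add_zero] at h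
  have h2 : (∑ k ∈ s, ‖coeff k f‖) ^ 2 ≤ (√(weightSum α 0) * A) ^ 2 := by
    rw [mul_pow, Real.sq_sqrt (weightSum_nonneg le_rfl)]
    exact h.trans (mul_le_mul_of_nonneg_left (hf.sum_le s) (weightSum_nonneg le_rfl))
  exact le_of_sq_le_sq h2 (mul_nonneg (Real.sqrt_nonneg _) hf.nonneg)

/-- The Fourier series converges absolutely, hence uniformly, to a continuous function, which agrees
with `f` because the series also converges to `f` in $L^2$. -/
theorem ae_norm_le (hα : 1 < α) (hf : SobLE α A f) :
    ∀ᵐ x ∂AddCircle.haarAddCircle (T := 2 * π), ‖f x‖ ≤ √(weightSum α 0) * A := by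
  have hs : Summable fun k => ‖coeff k f‖ :=
    summable_of_sum_le (fun _ => norm_nonneg _) (hf.sum_norm_le hα)
  have hn : ∀ k, ‖coeff k f • fourier (T := 2 * π) k‖ = ‖coeff k f‖ := fun k => by
    rw [norm_smul, fourier_norm, mul_one]
  have hs' : Summable fun k => coeff k f • fourier (T := 2 * π) k :=
    Summable.of_norm (by simpa only [hn] using hs)
  obtain ⟨g, hg⟩ := hs'
  have h1 := (ContinuousMap.toLp (E := ℂ) 2 (AddCircle.haarAddCircle (T := 2 * π)) ℂ).hasSum hg
  have h2 := hasSum_fourier_series_L2 f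
  simp only [← coeff_eq_fourierCoeff] at h2
  have h3 : ContinuousMap.toLp (E := ℂ) 2 (AddCircle.haarAddCircle (T := 2 * π)) ℂ g = f := by
    refine h1.unique ?_
    convert! h2 using 2 with k
  have h4 : ‖g‖ ≤ √(weightSum α 0) * A := by
    rw [← hg.tsum_eq]
    refine (norm_tsum_le_tsum_norm (by simpa only [hn] using hs)).trans ?_
    simp only [hn]
    exact hs.tsum_le_of_sum_le (hf.sum_norm_le hα)
  filter_upwards [ContinuousMap.coeFn_toLp (p := 2) (𝕜 := ℂ)
    (AddCircle.haarAddCircle (T := 2 * π)) g] with x hx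
  rw [h3] at hx
  rw [hx]
  exact (g.norm_coe_le_norm x).trans h4

end SobLE

/-- Since $\hat f(k)$ is $2\pi$ times the normalized coefficient, the factor $1/(2\pi)$ becomes
$2\pi$; hence the $\sqrt{2\pi}$ between `sobolevNorm` and `SobLE`. -/
theorem sobolevNorm_sq (α : ℝ) (f : L2Torus) : sobolevNorm (α / 2) f ^ 2 =
    ENNReal.ofReal (2 * π) * ∑' k, ENNReal.ofReal (weight α k * ‖coeff k f‖ ^ 2) := by
  rw [sobolevNorm, ← ENNReal.rpow_natCast, ← ENNReal.rpow_mul]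
  rw [show (1 / 2 : ℝ) * (2 : ℕ) = 1 by norm_num, ENNReal.rpow_one, ← ENNReal.tsum_mul_left, ← ENNReal.tsum_mul_left]
  refine tsum_congr fun k => ?_
  rw [fourierTransform, ← coeff_eq_fourierCoeff, ← ofReal_norm, ← ENNReal.ofReal_pow
    (norm_nonneg _), ← ENNReal.ofReal_mul (by positivity), ← ENNReal.ofReal_mul (by positivity),
    ← ENNReal.ofReal_mul (by positivity), norm_mul, mul_pow, Complex.norm_real,
    Real.norm_of_nonneg (by positivity), weight]
  congr 1
  have := Real.pi_pos.ne'
  field_simp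

theorem sobolevNorm_le_iff {α A : ℝ} (hA : 0 ≤ A) (f : L2Torus) :
    sobolevNorm (α / 2) f ≤ ENNReal.ofReal (√(2 * π) * A) ↔ SobLE α A f := by
  have h0 : ∀ k, 0 ≤ weight α k * ‖coeff k f‖ ^ 2 := fun k =>
    mul_nonneg (weight_pos α k).le (sq_nonneg _)
  have hp : ENNReal.ofReal (2 * π) ≠ 0 := by simp [Real.pi_pos]
  rw [← ENNReal.pow_le_pow_left_iff two_ne_zero, sobolevNorm_sq, ← ENNReal.ofReal_pow (by positivity),
    mul_pow, Real.sq_sqrt (by positivity), ENNReal.ofReal_mul (p := 2 * π) (q := A ^ 2) (by positivity),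
    ENNReal.mul_le_mul_iff_right hp ENNReal.ofReal_ne_top]
  constructor
  · intro h
    refine SobLE.of_sum_le hA fun s => ?_
    rw [← ENNReal.ofReal_le_ofReal_iff (by positivity), ENNReal.ofReal_sum_of_nonneg fun k _ => h0 k]
    exact (ENNReal.sum_le_tsum s).trans h
  · intro h
    rw [← ENNReal.ofReal_tsum_of_nonneg h0 h.summable]
    exact ENNReal.ofReal_le_ofReal h.tsum_le

theorem exists_sobLE_of_sobolevNorm_lt_top {α : ℝ} {f : L2Torus} (h : sobolevNorm (α / 2) f < ∞) :
    ∃ A, SobLE α A f := by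
  refine ⟨(sobolevNorm (α / 2) f).toReal / √(2 * π), (sobolevNorm_le_iff (by positivity) f).mp ?_⟩
  rw [mul_div_cancel₀ _ (by positivity), ENNReal.ofReal_toReal h.ne]

theorem SobLE.sobolevNorm_lt_top {α A : ℝ} {f : L2Torus} (h : SobLE α A f) :
    sobolevNorm (α / 2) f < ∞ :=
  ((sobolevNorm_le_iff h.nonneg f).mpr h).trans_lt ENNReal.ofReal_lt_top

theorem tendsto_sobolevNorm_zero_iff {α : ℝ} {ι : Type*} {l : Filter ι} {F : ι → L2Torus} :
    Tendsto (fun i => sobolevNorm (α / 2) (F i)) l (𝓝 0) ↔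
      ∀ ε > 0, ∀ᶠ i in l, SobLE α ε (F i) := by
  rw [ENNReal.tendsto_nhds_zero]
  constructor
  · intro h ε hε
    filter_upwards [h (ENNReal.ofReal (√(2 * π) * ε)) (ENNReal.ofReal_pos.mpr (by positivity))] with i hi
    exact (sobolevNorm_le_iff hε.le _).mp hi
  · intro h ε hε
    rcases eq_or_ne ε ∞ with rfl | hε'
    · simp
    · have he : 0 < ε.toReal := ENNReal.toReal_pos hε.ne' hε'
      filter_upwards [h (ε.toReal / √(2 * π)) (by positivity)] with i hi
      have := (sobolevNorm_le_iff (by positivity) _).mpr hi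
      rwa [mul_div_cancel₀ _ (by positivity), ENNReal.ofReal_toReal hε'] at this

end Torus

/-! ### Fourier analysis on the lattice -/

section LatticeFourier

open scoped NNReal ComplexConjugate

variable (M : ℕ) [NeZero M]

theorem mesh_pos : 0 < mesh M := by
  have := Nat.pos_of_ne_zero (NeZero.ne M)
  unfold mesh; positivity

theorem mesh_mul : mesh M * M = π := by
  have := NeZero.ne M
  unfold mesh; field_simp

theorem mesh_le_pi : mesh M ≤ π := by
  have : (1 : ℝ) ≤ M := by exact_mod_cast Nat.pos_of_ne_zero (NeZero.ne M)
  exact div_le_self Real.pi_pos.le this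

/-- The normalized Fourier coefficient `(2π)⁻¹ ℱ_h[g](k)`. -/
def dcoeff (k : ZMod (2 * M)) : Lattice M →L[ℂ] ℂ :=
  ((2 * M : ℂ))⁻¹ • ∑ j : ZMod (2 * M),
    ZMod.stdAddChar (-(j * k)) • ContinuousLinearMap.proj (R := ℂ) (φ := fun _ => ℂ) j

theorem dcoeff_apply (k : ZMod (2 * M)) (g : Lattice M) :
    dcoeff M k g = (2 * M : ℂ)⁻¹ * ∑ j, g j * ZMod.stdAddChar (-(j * k)) := by
  simp [dcoeff, mul_comm]

theorem two_mul_ne_zero : (2 * M : ℂ) ≠ 0 := by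
  exact_mod_cast NeZero.ne (2 * M)

omit [NeZero M] in
theorem conj_inv_two_mul : conj ((2 * M : ℂ)⁻¹) = (2 * M : ℂ)⁻¹ := by
  rw [map_inv₀]; congr 1; exact_mod_cast Complex.conj_natCast (2 * M)

theorem sum_stdAddChar (b : ZMod (2 * M)) :
    ∑ k : ZMod (2 * M), (ZMod.stdAddChar (k * b) : ℂ) = if b = 0 then (2 * M : ℂ) else 0 := by
  rw [AddChar.sum_mulShift b (ZMod.isPrimitive_stdAddChar _), ZMod.card]
  push_cast; rfl

theorem dcoeff_synthesis (b : ZMod (2 * M) → ℂ) (k : ZMod (2 * M)) :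
    dcoeff M k (fun j => ∑ l, b l * ZMod.stdAddChar (j * l)) = b k := by
  rw [dcoeff_apply]
  have h : ∀ j : ZMod (2 * M), (∑ l, b l * (ZMod.stdAddChar (j * l) : ℂ)) * ZMod.stdAddChar (-(j * k))
      = ∑ l, b l * ZMod.stdAddChar (j * (l - k)) := by
    intro j
    rw [Finset.sum_mul]
    refine Finset.sum_congr rfl fun l _ => ?_
    rw [mul_assoc, ← AddChar.map_add_eq_mul]
    congr 2; ring
  simp only [h]
  rw [Finset.sum_comm]
  simp only [← Finset.mul_sum, sum_stdAddChar, sub_eq_zero]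
  have := two_mul_ne_zero M
  simp only [mul_ite, mul_zero, Finset.sum_ite_eq', Finset.mem_univ, if_true]
  rw [mul_comm, mul_assoc, mul_inv_cancel₀ this, mul_one]

theorem sum_dcoeff (g : Lattice M) (j : ZMod (2 * M)) :
    ∑ k, dcoeff M k g * ZMod.stdAddChar (j * k) = g j := by
  have h : ∀ k : ZMod (2 * M), dcoeff M k g * (ZMod.stdAddChar (j * k) : ℂ)
      = (2 * M : ℂ)⁻¹ * ∑ l, g l * ZMod.stdAddChar (k * (j - l)) := by
    intro k
    rw [dcoeff_apply, mul_assoc, Finset.sum_mul]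
    congr 1
    refine Finset.sum_congr rfl fun l _ => ?_
    rw [mul_assoc, ← AddChar.map_add_eq_mul]
    congr 2; ring
  simp only [h]
  rw [← Finset.mul_sum, Finset.sum_comm]
  simp only [← Finset.mul_sum, sum_stdAddChar, sub_eq_zero]
  have := two_mul_ne_zero M
  simp only [mul_ite, mul_zero, Finset.sum_ite_eq, Finset.mem_univ, if_true]
  rw [mul_comm, mul_assoc, mul_inv_cancel₀ this, mul_one]

variable {M}

theorem dcoeff_ext {f g : Lattice M} (h : ∀ k, dcoeff M k f = dcoeff M k g) : f = g := by
  funext j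
  rw [← sum_dcoeff M f, ← sum_dcoeff M g]
  simp only [h]

theorem dcoeff_eq_of_forall_eq_sum {g : Lattice M} {b : ZMod (2 * M) → ℂ}
    (h : ∀ j, g j = ∑ l, b l * ZMod.stdAddChar (j * l)) (k : ZMod (2 * M)) : dcoeff M k g = b k := by
  rw [← dcoeff_synthesis M b k]; congr 1; funext j; exact h j

theorem sum_conj_mul_dcoeff (f g : Lattice M) :
    ∑ k, conj (dcoeff M k f) * dcoeff M k g = (2 * M : ℂ)⁻¹ * ∑ j, conj (f j) * g j := by
  have h1 : ∀ k, conj (dcoeff M k f) =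
      (2 * M : ℂ)⁻¹ * ∑ j, conj (f j) * ZMod.stdAddChar (j * k) := by
    intro k
    rw [dcoeff_apply, map_mul, map_sum, conj_inv_two_mul]
    simp [AddChar.map_neg_eq_conj]
  simp only [h1, mul_assoc, Finset.sum_mul]
  rw [← Finset.mul_sum, Finset.sum_comm]
  congr 1
  refine Finset.sum_congr rfl fun j _ => ?_
  rw [← sum_dcoeff M g j, Finset.mul_sum]
  exact Finset.sum_congr rfl fun k _ => by ring

theorem sum_norm_sq_dcoeff (g : Lattice M) :
    ∑ k, ‖dcoeff M k g‖ ^ 2 = (2 * M : ℝ)⁻¹ * ∑ j, ‖g j‖ ^ 2 := by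
  have h := sum_conj_mul_dcoeff g g
  simp only [← Complex.normSq_eq_conj_mul_self, Complex.normSq_eq_norm_sq] at h
  apply Complex.ofReal_injective
  push_cast at h ⊢
  exact h

theorem norm_le_sum_norm_dcoeff (g : Lattice M) (j : ZMod (2 * M)) :
    ‖g j‖ ≤ ∑ k, ‖dcoeff M k g‖ := by
  rw [← sum_dcoeff M g j]
  exact (norm_sum_le _ _).trans (Finset.sum_le_sum fun k _ => by simp)

theorem norm_dcoeff_le (g : Lattice M) (k : ZMod (2 * M)) : ‖dcoeff M k g‖ ≤ ‖g‖ := by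
  have hM : (0 : ℝ) < 2 * M := by
    have := Nat.pos_of_ne_zero (NeZero.ne M); positivity
  rw [dcoeff_apply, norm_mul, norm_inv]
  have h : ‖∑ j, g j * (ZMod.stdAddChar (-(j * k)) : ℂ)‖ ≤ 2 * M * ‖g‖ := by
    refine (norm_sum_le _ _).trans ?_
    refine (Finset.sum_le_card_nsmul _ _ ‖g‖ fun j _ => ?_).trans_eq ?_
    · simpa using norm_le_pi_norm g j
    · rw [Finset.card_univ, ZMod.card, nsmul_eq_mul]; push_cast; ring
  have h2 : ‖(2 * M : ℂ)‖ = 2 * M := by simp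
  rw [h2]
  exact (mul_le_mul_of_nonneg_left h (by positivity)).trans_eq
    (inv_mul_cancel_left₀ hM.ne' _)

theorem dcoeff_mul (f g : Lattice M) (k : ZMod (2 * M)) :
    dcoeff M k (fun j => f j * g j) = ∑ l, dcoeff M l f * dcoeff M (k - l) g := by
  refine dcoeff_eq_of_forall_eq_sum (b := fun k => ∑ l, dcoeff M l f * dcoeff M (k - l) g)
    (fun j => ?_) k
  rw [← sum_dcoeff M f j, ← sum_dcoeff M g j, Finset.sum_mul]
  simp only [Finset.sum_mul]
  rw [Finset.sum_comm]
  refine Finset.sum_congr rfl fun l _ => ?_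
  rw [Finset.mul_sum, ← Equiv.sum_comp (Equiv.subRight l)]
  refine Finset.sum_congr rfl fun k _ => ?_
  rw [Equiv.subRight_apply, show j * k = j * l + j * (k - l) by ring, AddChar.map_add_eq_mul]
  ring

theorem dcoeff_conj (g : Lattice M) (k : ZMod (2 * M)) :
    dcoeff M k (fun j => conj (g j)) = conj (dcoeff M (-k) g) := by
  rw [dcoeff_apply, dcoeff_apply, map_mul, map_sum, conj_inv_two_mul]
  simp [AddChar.map_neg_eq_conj]

theorem abs_valMinAbs_le (k : ZMod (2 * M)) : |(k.valMinAbs : ℝ)| ≤ M := by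
  have := ZMod.natAbs_valMinAbs_le k
  rw [Nat.mul_div_cancel_left _ two_pos] at this
  rw [← Int.cast_abs, Int.abs_eq_natAbs]
  exact_mod_cast this

theorem sq_sum_le_weightSum_mul_sum {α l : ℝ} (hα : 1 < α) (hl : 0 ≤ l) (a : ZMod (2 * M) → ℝ) :
    (∑ k, a k) ^ 2 ≤ weightSum α l * ∑ k, (weight α k.valMinAbs + l) * a k ^ 2 := by
  have h := sq_sum_le_weightSum_mul hα hl
    (Finset.univ.map ⟨fun k : ZMod (2 * M) => k.valMinAbs, ZMod.injective_valMinAbs⟩)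
    (fun l => a (l : ZMod (2 * M)))
  simpa [Finset.sum_map] using h

/-- Young's inequality for $\ell^2 * \ell^1$, by Cauchy–Schwarz with `q` as weight. -/
theorem sum_sq_convolution_le {G : Type*} [AddCommGroup G] [Fintype G] {p q : G → ℝ}
    (hq : ∀ k, 0 ≤ q k) :
    ∑ k, (∑ l, p l * q (k - l)) ^ 2 ≤ (∑ l, p l ^ 2) * (∑ l, q l) ^ 2 := by
  have hs : ∀ k, ∑ l, q (k - l) = ∑ l, q l := fun k => Equiv.sum_comp (Equiv.subLeft k) q
  have h1 : ∀ k, (∑ l, p l * q (k - l)) ^ 2 ≤ (∑ l, p l ^ 2 * q (k - l)) * ∑ l, q l := by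
    intro k
    rw [← hs k]
    refine Finset.sum_sq_le_sum_mul_sum_of_sq_le_mul _ (fun l _ => mul_nonneg (sq_nonneg _) (hq _))
      (fun l _ => hq _) fun l _ => le_of_eq (by ring)
  refine (Finset.sum_le_sum fun k _ => h1 k).trans_eq ?_
  rw [← Finset.sum_mul, Finset.sum_comm, sq, ← mul_assoc]
  congr 1
  rw [Finset.sum_mul]
  refine Finset.sum_congr rfl fun l _ => ?_
  rw [← Finset.mul_sum]
  congr 1
  exact Equiv.sum_comp (Equiv.subRight l) q

theorem weight_le_of_abs_le {α : ℝ} (h0 : 0 ≤ α) (h2 : α ≤ 2) {k l m : ℤ} (h : |k| ≤ |l| + |m|) :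
    weight α k ≤ 4 * (weight α l + weight α m) := by
  wlog hlm : |m| ≤ |l| generalizing l m
  · rw [add_comm]; exact this (by rwa [add_comm]) (le_of_not_ge hlm)
  have h1 : |(k : ℝ)| ≤ 2 * |(l : ℝ)| := by
    have : |k| ≤ 2 * |l| := by linarith
    exact_mod_cast this
  have h3 : 1 + (k : ℝ) ^ 2 ≤ 4 * (1 + (l : ℝ) ^ 2) := by
    have := pow_le_pow_left₀ (abs_nonneg _) h1 2
    rw [mul_pow, sq_abs, sq_abs] at this; linarith
  have h4 : (4 : ℝ) ^ (α / 2) ≤ 4 := by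
    simpa using Real.rpow_le_rpow_of_exponent_le (by norm_num : (1 : ℝ) ≤ 4)
      (by linarith : α / 2 ≤ 1)
  calc weight α k ≤ (4 * (1 + (l : ℝ) ^ 2)) ^ (α / 2) :=
        Real.rpow_le_rpow (by positivity) h3 (by linarith)
    _ = 4 ^ (α / 2) * weight α l := Real.mul_rpow (by norm_num) (by positivity)
    _ ≤ 4 * weight α l := mul_le_mul_of_nonneg_right h4 (weight_pos α l).le
    _ ≤ _ := by linarith [weight_pos α m]

/-- The discrete analogue of `SobLE`. -/
def DSobLE (α A : ℝ) (g : Lattice M) : Prop :=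
  0 ≤ A ∧ ∑ k, weight α k.valMinAbs * ‖dcoeff M k g‖ ^ 2 ≤ A ^ 2

namespace DSobLE

variable {α A B : ℝ} {f g : Lattice M}

theorem sum_norm_dcoeff_le (hα : 1 < α) (hg : DSobLE α A g) :
    ∑ k, ‖dcoeff M k g‖ ≤ √(weightSum α 0) * A := by
  have h := sq_sum_le_weightSum_mul_sum hα le_rfl fun k => ‖dcoeff M k g‖
  simp only [add_zero] at h
  refine le_of_sq_le_sq ?_ (mul_nonneg (Real.sqrt_nonneg _) hg.1)
  rw [mul_pow, Real.sq_sqrt (weightSum_nonneg le_rfl)]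
  exact h.trans (mul_le_mul_of_nonneg_left hg.2 (weightSum_nonneg le_rfl))

theorem norm_apply_le (hα : 1 < α) (hg : DSobLE α A g) (j : ZMod (2 * M)) :
    ‖g j‖ ≤ √(weightSum α 0) * A :=
  (norm_le_sum_norm_dcoeff g j).trans (hg.sum_norm_dcoeff_le hα)

theorem sum_norm_sq_dcoeff_le (hα : 0 ≤ α) (hg : DSobLE α A g) :
    ∑ k, ‖dcoeff M k g‖ ^ 2 ≤ A ^ 2 :=
  (Finset.sum_le_sum fun _ _ => le_mul_of_one_le_left (sq_nonneg _) (one_le_weight hα _)).trans hg.2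

theorem starRing (hg : DSobLE α A g) : DSobLE α A (fun j => (starRingEnd ℂ) (g j) : Lattice M) := by
  refine ⟨hg.1, le_trans (le_of_eq ?_) hg.2⟩
  rw [← Equiv.sum_comp (Equiv.neg (ZMod (2 * M)))]
  refine Finset.sum_congr rfl fun k _ => ?_
  have : weight α (-k).valMinAbs = weight α k.valMinAbs := by
    have h := ZMod.natAbs_valMinAbs_neg k
    rw [weight, weight, ← Int.cast_pow, ← Int.cast_pow, ← Int.natAbs_sq, h, Int.natAbs_sq]
  rw [Equiv.neg_apply, dcoeff_conj, neg_neg, RCLike.norm_conj, this]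

/-- The discrete $H^{\alpha/2}$ is an algebra, uniformly in `M`: the square root of the weight is
subadditive up to a factor `2`, so the weighted coefficients of a product are dominated by two
convolutions of an $\ell^2$ with an $\ell^1$ sequence. -/
theorem mul (hα : 1 < α) (hα2 : α ≤ 2) (hf : DSobLE α A f) (hg : DSobLE α B g) :
    DSobLE α (4 * √(weightSum α 0) * A * B) (fun j => f j * g j : Lattice M) := by
  have hK := Real.sqrt_nonneg (weightSum α 0)
  refine ⟨by have := hf.1; have := hg.1; positivity, ?_⟩
  set a : ZMod (2 * M) → ℝ := fun k => ‖dcoeff M k f‖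
  set b : ZMod (2 * M) → ℝ := fun k => ‖dcoeff M k g‖
  set w : ZMod (2 * M) → ℝ := fun k => √(weight α k.valMinAbs)
  have hw : ∀ k, 0 ≤ w k := fun k => Real.sqrt_nonneg _
  have hw2 : ∀ k, w k ^ 2 = weight α k.valMinAbs := fun k => Real.sq_sqrt (weight_pos _ _).le
  -- Representatives of smallest absolute value obey the triangle inequality even when the
  -- frequencies wrap around modulo `2M`, so aliasing does no harm.
  have hsub : ∀ k l, w k ≤ 2 * (w l + w (k - l)) := by
    intro k l
    have h1 : |k.valMinAbs| ≤ |l.valMinAbs| + |(k - l).valMinAbs| := by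
      have h := ZMod.natAbs_valMinAbs_add_le l (k - l)
      rw [add_sub_cancel] at h
      have h2 := Int.natAbs_add_le l.valMinAbs (k - l).valMinAbs
      rw [Int.abs_eq_natAbs, Int.abs_eq_natAbs, Int.abs_eq_natAbs]
      exact_mod_cast h.trans h2
    have h2 := weight_le_of_abs_le (by linarith : 0 ≤ α) hα2 h1
    refine le_of_sq_le_sq ?_ (by have := hw l; have := hw (k - l); positivity)
    rw [hw2]
    refine h2.trans ?_
    rw [← hw2, ← hw2]
    nlinarith [mul_nonneg (hw l) (hw (k - l))]
  have hb : ∀ k, w k * ‖dcoeff M k (fun j => f j * g j : Lattice M)‖ ≤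
      2 * ((∑ l, (w l * a l) * b (k - l)) + ∑ l, (w l * b l) * a (k - l)) := by
    intro k
    have e : ∑ l, (w l * b l) * a (k - l) = ∑ l, (w (k - l) * b (k - l)) * a l := by
      rw [← Equiv.sum_comp (Equiv.subLeft k)]; simp
    rw [dcoeff_mul, e, ← Finset.sum_add_distrib, Finset.mul_sum]
    refine (mul_le_mul_of_nonneg_left (norm_sum_le _ _) (hw k)).trans ?_
    rw [Finset.mul_sum]
    refine Finset.sum_le_sum fun l _ => ?_
    rw [norm_mul]
    have h0 : 0 ≤ a l * b (k - l) := mul_nonneg (norm_nonneg _) (norm_nonneg _)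
    calc w k * (a l * b (k - l)) ≤ 2 * (w l + w (k - l)) * (a l * b (k - l)) :=
          mul_le_mul_of_nonneg_right (hsub k l) h0
      _ = _ := by ring
  have ha0 : ∀ k, 0 ≤ a k := fun k => norm_nonneg _
  have hb0 : ∀ k, 0 ≤ b k := fun k => norm_nonneg _
  have ha1 := hf.sum_norm_dcoeff_le hα
  have hb1 := hg.sum_norm_dcoeff_le hα
  have hP : ∑ k, (∑ l, (w l * a l) * b (k - l)) ^ 2 ≤ A ^ 2 * (√(weightSum α 0) * B) ^ 2 := by
    refine (sum_sq_convolution_le (p := fun l => w l * a l) (q := b) hb0).trans ?_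
    refine mul_le_mul ?_ (pow_le_pow_left₀ (Finset.sum_nonneg fun k _ => hb0 k) hb1 2)
      (sq_nonneg _) (sq_nonneg _)
    simpa only [mul_pow, hw2] using hf.2
  have hQ : ∑ k, (∑ l, (w l * b l) * a (k - l)) ^ 2 ≤ B ^ 2 * (√(weightSum α 0) * A) ^ 2 := by
    refine (sum_sq_convolution_le (p := fun l => w l * b l) (q := a) ha0).trans ?_
    refine mul_le_mul ?_ (pow_le_pow_left₀ (Finset.sum_nonneg fun k _ => ha0 k) ha1 2)
      (sq_nonneg _) (sq_nonneg _)
    simpa only [mul_pow, hw2] using hg.2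
  have haux : ∀ x y z : ℝ, 0 ≤ x → x ≤ 2 * (y + z) → x ^ 2 ≤ 8 * (y ^ 2 + z ^ 2) := by
    intro x y z h0 h
    refine (pow_le_pow_left₀ h0 h 2).trans ?_
    nlinarith [sq_nonneg (y - z)]
  calc ∑ k : ZMod (2 * M), weight α k.valMinAbs * ‖dcoeff M k (fun j => f j * g j : Lattice M)‖ ^ 2
      ≤ ∑ k, 8 * ((∑ l, (w l * a l) * b (k - l)) ^ 2 + (∑ l, (w l * b l) * a (k - l)) ^ 2) := by
        refine Finset.sum_le_sum fun k _ => ?_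
        rw [← hw2, ← mul_pow]
        exact haux _ _ _ (mul_nonneg (hw k) (norm_nonneg _)) (hb k)
    _ ≤ 8 * (A ^ 2 * (√(weightSum α 0) * B) ^ 2 + B ^ 2 * (√(weightSum α 0) * A) ^ 2) := by
        rw [← Finset.mul_sum, Finset.sum_add_distrib]; linarith
    _ = _ := by ring

theorem discreteCubic (hα : 1 < α) (hα2 : α ≤ 2) (hg : DSobLE α A g) :
    DSobLE α (16 * weightSum α 0 * A ^ 3) (discreteCubic M g) := by
  have h := (hg.mul hα hα2 hg.starRing).mul hα hα2 hg
  have e1 : (fun j => g j * (starRingEnd ℂ) (g j) * g j : Lattice M) =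
      FracNLS.discreteCubic M g := by
    funext j
    rw [FracNLS.discreteCubic, Complex.mul_conj, Complex.normSq_eq_norm_sq]
  rw [e1] at h
  convert h using 1
  have := Real.mul_self_sqrt (weightSum_nonneg (α := α) (le_refl (0 : ℝ)))
  linear_combination (-16 * A ^ 3) * this

end DSobLE

/-! ### Two-sided bounds for the discrete symbol, and the discrete free evolution. -/

omit [NeZero M] in
theorem discreteSymbol_nonneg (α : ℝ) (k : ZMod (2 * M)) : 0 ≤ discreteSymbol α M k :=
  Real.rpow_nonneg (abs_nonneg _) _

theorem discreteSymbol_le {α : ℝ} (hα : 0 ≤ α) (k : ZMod (2 * M)) :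
    discreteSymbol α M k ≤ |(k.valMinAbs : ℝ)| ^ α := by
  have hm := mesh_pos M
  refine Real.rpow_le_rpow (abs_nonneg _) ?_ hα
  rw [abs_mul, abs_of_pos (by positivity : 0 < 2 / mesh M)]
  refine (mul_le_mul_of_nonneg_left Real.abs_sin_le_abs (by positivity)).trans_eq ?_
  rw [abs_div, abs_mul, abs_of_pos hm, abs_two]
  field_simp

/-- For the representative in $(-M,M]$ one has $|hk/2|\le\pi/2$, where $|\sin x|\ge 2|x|/\pi\ge
|x|/2$; the constant `4` bounds $2^\alpha$. Thus the discrete kinetic energy controls the Sobolev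
norm uniformly in $h$. -/
theorem abs_rpow_le_discreteSymbol {α : ℝ} (hα : 0 ≤ α) (hα2 : α ≤ 2) (k : ZMod (2 * M)) :
    |(k.valMinAbs : ℝ)| ^ α ≤ 4 * discreteSymbol α M k := by
  have hm := mesh_pos M
  have h1 : |(k.valMinAbs : ℝ)| / 2 ≤ |2 / mesh M * Real.sin (mesh M * (k.valMinAbs : ℝ) / 2)| := by
    rw [abs_mul, abs_of_pos (by positivity : 0 < 2 / mesh M)]
    have hx : |mesh M * (k.valMinAbs : ℝ) / 2| ≤ π / 2 := by
      rw [abs_div, abs_mul, abs_of_pos hm, abs_two, ← mesh_mul M]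
      have := abs_valMinAbs_le k
      gcongr
    have h := Real.mul_abs_le_abs_sin hx
    have hp : 1 / 2 ≤ 2 / π := by
      rw [div_le_div_iff₀ two_pos Real.pi_pos]; linarith [Real.pi_le_four]
    calc |(k.valMinAbs : ℝ)| / 2
        = 2 / mesh M * (1 / 2 * |mesh M * (k.valMinAbs : ℝ) / 2|) := by
          rw [abs_div, abs_mul, abs_of_pos hm, abs_two]; field_simp
      _ ≤ 2 / mesh M * (2 / π * |mesh M * (k.valMinAbs : ℝ) / 2|) := by gcongr
      _ ≤ _ := by gcongr
  have h2 : (|(k.valMinAbs : ℝ)| / 2) ^ α ≤ discreteSymbol α M k :=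
    Real.rpow_le_rpow (by positivity) h1 hα
  rw [Real.div_rpow (abs_nonneg _) two_pos.le] at h2
  have h3 : (2 : ℝ) ^ α ≤ 4 := by
    have := Real.rpow_le_rpow_of_exponent_le (by norm_num : (1 : ℝ) ≤ 2) hα2
    norm_num at this; exact this
  have h4 : (0 : ℝ) < 2 ^ α := by positivity
  rw [div_le_iff₀ h4] at h2
  nlinarith [discreteSymbol_nonneg α k]

theorem weight_le_discreteSymbol {α : ℝ} (hα : 0 ≤ α) (hα2 : α ≤ 2) (k : ZMod (2 * M)) :
    weight α k.valMinAbs ≤ 8 * (1 + discreteSymbol α M k) := by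
  have h := abs_rpow_le_discreteSymbol hα hα2 k
  have h1 : weight α k.valMinAbs ≤ 2 * (1 + |(k.valMinAbs : ℝ)| ^ α) := by
    set x := |(k.valMinAbs : ℝ)| with hx
    have hx0 : 0 ≤ x := abs_nonneg _
    have h2 : (2 : ℝ) ^ (α / 2) ≤ 2 := by
      simpa using Real.rpow_le_rpow_of_exponent_le (by norm_num : (1 : ℝ) ≤ 2)
        (by linarith : α / 2 ≤ 1)
    have hp : 0 ≤ x ^ α := Real.rpow_nonneg hx0 _
    rw [weight, ← sq_abs, ← hx]
    rcases le_total x 1 with h1 | h1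
    · calc (1 + x ^ 2) ^ (α / 2) ≤ 2 ^ (α / 2) :=
            Real.rpow_le_rpow (by positivity) (by nlinarith) (by linarith)
        _ ≤ _ := by linarith
    · calc (1 + x ^ 2) ^ (α / 2) ≤ (2 * x ^ 2) ^ (α / 2) :=
            Real.rpow_le_rpow (by positivity) (by nlinarith) (by linarith)
        _ = 2 ^ (α / 2) * x ^ α := by
            rw [Real.mul_rpow (by norm_num) (by positivity), ← Real.rpow_natCast x 2,
              ← Real.rpow_mul hx0]
            congr 2; push_cast; ring
        _ ≤ _ := by nlinarith
  linarith

/-- The symbol `e^{-itσ_h(k)}` of the discrete free evolution. -/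
def discreteFreeSymbol (α : ℝ) (M : ℕ) (t : ℝ) (k : ZMod (2 * M)) : ℂ :=
  Complex.exp (-(Complex.I * ((t * discreteSymbol α M k : ℝ) : ℂ)))

omit [NeZero M] in
theorem norm_discreteFreeSymbol (α t : ℝ) (k : ZMod (2 * M)) :
    ‖discreteFreeSymbol α M t k‖ = 1 := by
  rw [discreteFreeSymbol, ← mul_neg, ← Complex.ofReal_neg, mul_comm]
  exact Complex.norm_exp_ofReal_mul_I _

theorem discreteFreeEvolution_apply (α t : ℝ) (g : Lattice M) (j : ZMod (2 * M)) :
    discreteFreeEvolution α M t g j =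
      ∑ k, discreteFreeSymbol α M t k * dcoeff M k g * ZMod.stdAddChar (j * k) := by
  have h : ∀ k, discreteFourier M g k = (2 * π : ℝ) * dcoeff M k g := by
    intro k
    have hM := two_mul_ne_zero M
    have : (mesh M : ℂ) = (2 * π : ℝ) * (2 * M : ℂ)⁻¹ := by
      have hM' : (M : ℂ) ≠ 0 := Nat.cast_ne_zero.mpr (NeZero.ne M)
      rw [← mesh_mul M]; push_cast; field_simp
    rw [discreteFourier, dcoeff_apply, this, mul_assoc]
  rw [discreteFreeEvolution, discreteFourierInv, Finset.mul_sum]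
  refine Finset.sum_congr rfl fun k _ => ?_
  rw [h]
  have hp : (π : ℂ) ≠ 0 := by exact_mod_cast Real.pi_ne_zero
  simp only [discreteFreeSymbol]
  push_cast
  field_simp

theorem dcoeff_discreteFreeEvolution (α t : ℝ) (g : Lattice M) (k : ZMod (2 * M)) :
    dcoeff M k (discreteFreeEvolution α M t g) = discreteFreeSymbol α M t k * dcoeff M k g :=
  dcoeff_eq_of_forall_eq_sum (b := fun k => discreteFreeSymbol α M t k * dcoeff M k g)
    (discreteFreeEvolution_apply α t g) k

/-- The discrete free evolution as a bounded operator. -/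
def discreteFreeOp (α : ℝ) (M : ℕ) [NeZero M] (t : ℝ) : Lattice M →L[ℂ] Lattice M :=
  LinearMap.toContinuousLinearMap
    { toFun := discreteFreeEvolution α M t
      map_add' := fun f g => dcoeff_ext fun k => by
        simp only [map_add, dcoeff_discreteFreeEvolution, mul_add]
      map_smul' := fun c f => dcoeff_ext fun k => by
        simp only [map_smul, dcoeff_discreteFreeEvolution, RingHom.id_apply, smul_eq_mul]; ring }

theorem discreteFreeOp_apply (α t : ℝ) (g : Lattice M) :
    discreteFreeOp α M t g = discreteFreeEvolution α M t g := rfl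

theorem dcoeff_discreteFreeOp (α t : ℝ) (g : Lattice M) (k : ZMod (2 * M)) :
    dcoeff M k (discreteFreeOp α M t g) = discreteFreeSymbol α M t k * dcoeff M k g :=
  dcoeff_discreteFreeEvolution α t g k

/-- Lattice functions carry the sup norm, for which the group is not isometric. The $h$-dependent
constant is harmless: this group structure is used only at fixed `M`. -/
theorem isBoundedGroup_discreteFreeOp (α : ℝ) :
    IsBoundedGroup (discreteFreeOp α M) (2 * M) where
  zero f := dcoeff_ext fun k => by
    rw [dcoeff_discreteFreeOp]; simp [discreteFreeSymbol]
  add s t f := dcoeff_ext fun k => by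
    rw [dcoeff_discreteFreeOp, dcoeff_discreteFreeOp, dcoeff_discreteFreeOp, ← mul_assoc]
    congr 1
    rw [discreteFreeSymbol, discreteFreeSymbol, discreteFreeSymbol, ← Complex.exp_add]
    congr 1; push_cast; ring
  bound t f := by
    refine (pi_norm_le_iff_of_nonneg (by positivity)).mpr fun j => ?_
    refine (norm_le_sum_norm_dcoeff _ j).trans ?_
    refine (Finset.sum_le_card_nsmul _ _ ‖f‖ fun k _ => ?_).trans_eq ?_
    · rw [dcoeff_discreteFreeOp, norm_mul, norm_discreteFreeSymbol, one_mul]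
      exact norm_dcoeff_le f k
    · rw [Finset.card_univ, ZMod.card, nsmul_eq_mul]; push_cast; ring
  continuous f := by
    refine continuous_pi fun j => ?_
    simp only [discreteFreeOp_apply, discreteFreeEvolution_apply, discreteFreeSymbol]
    fun_prop
  nonneg := by positivity

end LatticeFourier

/-! ### The discrete equation: well-posedness, conservation laws and a priori bounds -/

section DiscreteEquation

open scoped NNReal ComplexConjugate

variable {M : ℕ} [NeZero M]

/-- The lattice function with Fourier coefficients `-i (σ_h(k) aₖ + μ bₖ)`, where `aₖ` and `bₖ` are
the coefficients of `g` and `G`. -/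
def discreteVelocity (α μ : ℝ) (g G : Lattice M) : Lattice M := fun j =>
  ∑ k, -(Complex.I * (discreteSymbol α M k * dcoeff M k g + μ * dcoeff M k G)) *
    ZMod.stdAddChar (j * k)

theorem dcoeff_discreteVelocity (α μ : ℝ) (g G : Lattice M) (k : ZMod (2 * M)) :
    dcoeff M k (discreteVelocity α μ g G) =
      -(Complex.I * (discreteSymbol α M k * dcoeff M k g + μ * dcoeff M k G)) :=
  dcoeff_synthesis M _ k

/-- On the finite lattice the generator is bounded, so Duhamel's formula can be differentiated. This
justifies the computation of the conserved quantities. -/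
theorem hasDerivAt_of_discrete_duhamel {α μ : ℝ} {v₀ : Lattice M} {v G : ℝ → Lattice M}
    (hG : Continuous G)
    (hv : ∀ t, v t = discreteFreeOp α M t v₀ -
      (Complex.I * (μ : ℂ)) • ∫ τ in (0 : ℝ)..t, discreteFreeOp α M (t - τ) (G τ)) (t : ℝ) :
    HasDerivAt v (discreteVelocity α μ (v t) (G t)) t := by
  have hU := isBoundedGroup_discreteFreeOp (M := M) α
  have hcont : Continuous fun τ => discreteFreeOp α M (-τ) (G τ) :=
    hU.continuous_comp continuous_neg hG
  set W : ℝ → Lattice M := fun t => v₀ - (Complex.I * (μ : ℂ)) •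
    ∫ τ in (0 : ℝ)..t, discreteFreeOp α M (-τ) (G τ) with hW
  have hvW : ∀ t, v t = discreteFreeOp α M t (W t) := by
    intro t
    have := hU.eq_of_duhamel hG (hv t)
    change v t = discreteFreeOp α M t (v₀ - _)
    rw [← this, hU.apply_neg]
  have hWd : HasDerivAt W (-((Complex.I * (μ : ℂ)) • discreteFreeOp α M (-t) (G t))) t := by
    have h := ((hcont.integral_hasStrictDerivAt 0 t).hasDerivAt).fun_const_smul
      (Complex.I * (μ : ℂ))
    simpa only [neg_smul, smul_neg] using h.const_sub v₀
  have hSd : ∀ k, HasDerivAt (fun t => discreteFreeSymbol α M t k)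
      (-(Complex.I * discreteSymbol α M k) * discreteFreeSymbol α M t k) t := by
    intro k
    have h1 : HasDerivAt (fun t : ℝ => -(Complex.I * ((t * discreteSymbol α M k : ℝ) : ℂ)))
        (-(Complex.I * discreteSymbol α M k)) t := by
      have := ((((hasDerivAt_id t).mul_const (discreteSymbol α M k)).ofReal_comp).const_mul
        Complex.I).fun_neg
      simpa using this
    have := h1.cexp
    rwa [mul_comm] at this
  have hk : ∀ k, HasDerivAt (fun t => dcoeff M k (v t))
      (-(Complex.I * (discreteSymbol α M k * dcoeff M k (v t) + μ * dcoeff M k (G t)))) t := by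
    intro k
    have h1 : HasDerivAt (fun t => dcoeff M k (W t))
        (dcoeff M k (-((Complex.I * (μ : ℂ)) • discreteFreeOp α M (-t) (G t)))) t := by
      have := ((dcoeff M k).restrictScalars ℝ).hasFDerivAt.comp_hasDerivAt t hWd
      exact this
    have h2 := (hSd k).mul h1
    have h3 : (fun t => dcoeff M k (v t)) =
        (fun t => discreteFreeSymbol α M t k) * fun t => dcoeff M k (W t) := by
      funext t; rw [hvW t, dcoeff_discreteFreeOp]; rfl
    rw [h3]
    refine h2.congr_deriv ?_
    have h4 : dcoeff M k (G t) = discreteFreeSymbol α M t k *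
        dcoeff M k (discreteFreeOp α M (-t) (G t)) := by
      rw [← dcoeff_discreteFreeOp, hU.apply_neg]
    rw [hvW t, dcoeff_discreteFreeOp, h4, map_neg, map_smul, smul_eq_mul]
    ring
  rw [hasDerivAt_pi]
  intro j
  have h := HasDerivAt.fun_sum (u := Finset.univ) fun k _ =>
    (hk k).mul_const (ZMod.stdAddChar (j * k) : ℂ)
  simp only [sum_dcoeff] at h
  exact h

theorem hasDerivAt_sum_norm_sq_dcoeff {v : ℝ → Lattice M} {V : Lattice M} {t : ℝ}
    (hv : HasDerivAt v V t) (c : ZMod (2 * M) → ℝ) :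
    HasDerivAt (fun t => ∑ k, c k * ‖dcoeff M k (v t)‖ ^ 2)
      (∑ k, c k * (2 * (conj (dcoeff M k (v t)) * dcoeff M k V).re)) t := by
  refine HasDerivAt.fun_sum fun k _ => HasDerivAt.const_mul _ ?_
  have h1 : HasDerivAt (fun t => dcoeff M k (v t)) (dcoeff M k V) t :=
    ((dcoeff M k).restrictScalars ℝ).hasFDerivAt.comp_hasDerivAt t hv
  have h2 := h1.norm_sq
  rw [Complex.inner, mul_comm (dcoeff M k V)] at h2
  exact h2

/-- The linear part drops out because the symbol is real. By Parseval the nonlinear part is the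
imaginary part of a sum of `conj (v j) * G j`, and these are real. A general `G` covers the
truncated and the true cubic term. -/
theorem sum_norm_sq_dcoeff_eq_of_duhamel {α μ : ℝ} {v₀ : Lattice M} {v G : ℝ → Lattice M}
    (hG : Continuous G)
    (hv : ∀ t, v t = discreteFreeOp α M t v₀ -
      (Complex.I * (μ : ℂ)) • ∫ τ in (0 : ℝ)..t, discreteFreeOp α M (t - τ) (G τ))
    (hr : ∀ t j, ∃ r : ℝ, G t j = r * v t j) (t : ℝ) :
    ∑ k, ‖dcoeff M k (v t)‖ ^ 2 = ∑ k, ‖dcoeff M k v₀‖ ^ 2 := by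
  have hd : ∀ t, HasDerivAt (fun t => ∑ k, 1 * ‖dcoeff M k (v t)‖ ^ 2) 0 t := by
    intro t
    refine (hasDerivAt_sum_norm_sq_dcoeff (hasDerivAt_of_discrete_duhamel hG hv t)
      fun _ => 1).congr_deriv ?_
    simp only [dcoeff_discreteVelocity, one_mul]
    have h1 : ∀ k, 2 * (conj (dcoeff M k (v t)) * -(Complex.I * (discreteSymbol α M k *
        dcoeff M k (v t) + μ * dcoeff M k (G t)))).re =
        2 * μ * (conj (dcoeff M k (v t)) * dcoeff M k (G t)).im := by
      intro k
      have : conj (dcoeff M k (v t)) * -(Complex.I * (discreteSymbol α M k *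
        dcoeff M k (v t) + μ * dcoeff M k (G t))) =
        -(Complex.I * ((discreteSymbol α M k * Complex.normSq (dcoeff M k (v t)) : ℝ) : ℂ)) -
          Complex.I * ((μ : ℂ) * (conj (dcoeff M k (v t)) * dcoeff M k (G t))) := by
        push_cast
        rw [Complex.normSq_eq_conj_mul_self]; ring
      rw [this, Complex.sub_re, Complex.neg_re, Complex.I_mul_re, Complex.I_mul_re,
        Complex.ofReal_im, Complex.im_ofReal_mul]
      ring
    simp only [h1]
    rw [← Finset.mul_sum, ← Complex.im_sum, sum_conj_mul_dcoeff]
    have h2 : ∀ j, ∃ r : ℝ, conj (v t j) * G t j = r := by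
      intro j
      obtain ⟨r, hr⟩ := hr t j
      exact ⟨r * Complex.normSq (v t j), by
        rw [hr]; push_cast; rw [Complex.normSq_eq_conj_mul_self]; ring⟩
    choose r hr' using h2
    simp only [hr']
    rw [← Complex.ofReal_sum]
    have : (2 * M : ℂ)⁻¹ = (((2 * M : ℝ)⁻¹ : ℝ) : ℂ) := by push_cast; rfl
    rw [this, ← Complex.ofReal_mul, Complex.ofReal_im, mul_zero]
  have hc := is_const_of_deriv_eq_zero (fun t => (hd t).differentiableAt) fun t => (hd t).deriv
  have h := hc t 0
  simp only [one_mul] at h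
  rw [h]
  have h0 : v 0 = v₀ := by
    rw [hv 0]; simp [(isBoundedGroup_discreteFreeOp (M := M) α).zero]
  rw [h0]

theorem isDiscreteSolution_iff {α μ : ℝ} {v₀ : Lattice M} {v : ℝ → Lattice M} :
    IsDiscreteSolution α μ M v₀ v ↔ Continuous v ∧ ∀ t, v t = discreteFreeOp α M t v₀ -
      (Complex.I * (μ : ℂ)) •
        ∫ τ in (0 : ℝ)..t, discreteFreeOp α M (t - τ) (discreteCubic M (v τ)) :=
  ⟨fun h => ⟨h.1, h.2⟩, fun h => ⟨h.1, h.2⟩⟩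

theorem norm_apply_le_sqrt_sum (g : Lattice M) (j : ZMod (2 * M)) :
    ‖g j‖ ≤ √(2 * M * ∑ k, ‖dcoeff M k g‖ ^ 2) := by
  apply Real.le_sqrt_of_sq_le
  have hM : (2 * M : ℝ) ≠ 0 := by exact_mod_cast NeZero.ne (2 * M)
  rw [sum_norm_sq_dcoeff, mul_inv_cancel_left₀ hM]
  exact Finset.single_le_sum (f := fun j => ‖g j‖ ^ 2) (fun _ _ => sq_nonneg _) (Finset.mem_univ j)

/-- At fixed `M` the conserved mass bounds the sup norm. With `B` equal to that bound the truncation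
is never active along the solution. -/
theorem exists_isDiscreteSolution (α μ : ℝ) (v₀ : Lattice M) :
    ∃ v, IsDiscreteSolution α μ M v₀ v := by
  set B : ℝ≥0 := ⟨√(2 * M * ∑ k, ‖dcoeff M k v₀‖ ^ 2), Real.sqrt_nonneg _⟩ with hB
  obtain ⟨v, hvc, hv⟩ := (isBoundedGroup_discreteFreeOp (M := M) α).exists_duhamel
    (lipschitzWith_discreteCubicTrunc M B) (norm_discreteCubicTrunc_le M B) (Complex.I * μ) v₀
  refine ⟨v, isDiscreteSolution_iff.mpr ⟨hvc, fun t => ?_⟩⟩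
  have hG := (lipschitzWith_discreteCubicTrunc M B).continuous.comp hvc
  have hm := sum_norm_sq_dcoeff_eq_of_duhamel hG hv fun t j => exists_cubicTruncFun_eq B (v t j)
  have he : ∀ τ, discreteCubicTrunc M B (v τ) = discreteCubic M (v τ) := fun τ =>
    discreteCubicTrunc_eq M fun j => by
      have := norm_apply_le_sqrt_sum (v τ) j
      rwa [hm τ] at this
  simp only [he] at hv
  exact hv t

theorem IsDiscreteSolution.unique {α μ : ℝ} {v₀ : Lattice M} {u v : ℝ → Lattice M}
    (hu : IsDiscreteSolution α μ M v₀ u) (hv : IsDiscreteSolution α μ M v₀ v) : u = v := by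
  rw [isDiscreteSolution_iff] at hu hv
  funext t
  obtain ⟨C, hC⟩ := (isCompact_Icc (a := -|t|) (b := |t|)).exists_bound_of_continuousOn
    hu.1.continuousOn
  obtain ⟨D, hD⟩ := (isCompact_Icc (a := -|t|) (b := |t|)).exists_bound_of_continuousOn
    hv.1.continuousOn
  set B : ℝ≥0 := (max C D).toNNReal
  have key : ∀ w : ℝ → Lattice M, (∀ s ∈ Set.Icc (-|t|) |t|, ‖w s‖ ≤ max C D) →
      (∀ t, w t = discreteFreeOp α M t v₀ - (Complex.I * (μ : ℂ)) •
        ∫ τ in (0 : ℝ)..t, discreteFreeOp α M (t - τ) (discreteCubic M (w τ))) →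
      ∀ s, |s| ≤ |t| → w s = discreteFreeOp α M s v₀ - (Complex.I * (μ : ℂ)) •
        ∫ τ in (0 : ℝ)..s, discreteFreeOp α M (s - τ) (discreteCubicTrunc M B (w τ)) := by
    intro w hw hs s hst
    nth_rw 1 [hs s]
    congr 2
    refine intervalIntegral.integral_congr fun τ hτ => ?_
    have hτ' : τ ∈ Set.Icc (-|t|) |t| := by
      refine Set.uIcc_subset_Icc ⟨by simp, by simp⟩ (abs_le.mp hst) hτ
    rw [discreteCubicTrunc_eq M fun j => ?_]
    exact (norm_le_pi_norm _ j).trans ((hw τ hτ').trans (Real.le_coe_toNNReal _))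
  exact ((isBoundedGroup_discreteFreeOp (M := M) α).eq_of_duhamel_of_lipschitz
    (lipschitzWith_discreteCubicTrunc M B) hv.1 hu.1
    (key v (fun s hs => (hD s hs).trans (le_max_right _ _)) hv.2)
    (key u (fun s hs => (hC s hs).trans (le_max_left _ _)) hu.2) le_rfl)

theorem existsUnique_isDiscreteSolution (α μ : ℝ) (v₀ : Lattice M) :
    ∃! v, IsDiscreteSolution α μ M v₀ v := by
  obtain ⟨v, hv⟩ := exists_isDiscreteSolution α μ v₀
  exact ⟨v, hv, fun u hu => hu.unique hv⟩

theorem discreteSolutionMap_eq {α μ : ℝ} {v₀ : Lattice M} {v : ℝ → Lattice M}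
    (hv : IsDiscreteSolution α μ M v₀ v) (t : ℝ) : discreteSolutionMap α μ M t v₀ = v t := by
  have h : ∃ v, IsDiscreteSolution α μ M v₀ v := ⟨v, hv⟩
  rw [discreteSolutionMap, dif_pos h, h.choose_spec.unique hv]

/-- The discrete energy, divided by `2π`. -/
def discreteEnergy (α μ : ℝ) (g : Lattice M) : ℝ :=
  ∑ k, discreteSymbol α M k / 2 * ‖dcoeff M k g‖ ^ 2 + μ / 4 * ((2 * M : ℝ)⁻¹ * ∑ j, ‖g j‖ ^ 4)

namespace IsDiscreteSolution

variable {α μ : ℝ} {v₀ : Lattice M} {v : ℝ → Lattice M}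

theorem sum_norm_sq_dcoeff (h : IsDiscreteSolution α μ M v₀ v) (t : ℝ) :
    ∑ k, ‖dcoeff M k (v t)‖ ^ 2 = ∑ k, ‖dcoeff M k v₀‖ ^ 2 :=
  sum_norm_sq_dcoeff_eq_of_duhamel ((continuous_discreteCubic M).comp h.continuous)
    (isDiscreteSolution_iff.mp h).2 (fun t j => ⟨‖v t j‖ ^ 2, rfl⟩) t

theorem apply_zero (h : IsDiscreteSolution α μ M v₀ v) : v 0 = v₀ := by
  rw [(isDiscreteSolution_iff.mp h).2 0]
  simp [(isBoundedGroup_discreteFreeOp (M := M) α).zero]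

/-- Hamiltonian structure: on the Fourier side the velocity is $-i(\sigma_h a+\mu b)$, and $\sigma_h
a+\mu b$ is the gradient of the energy, so the derivative vanishes mode by mode. Parseval brings the
quartic term into this form. -/
theorem discreteEnergy_eq (h : IsDiscreteSolution α μ M v₀ v) (t : ℝ) :
    discreteEnergy α μ (v t) = discreteEnergy α μ v₀ := by
  have hd : ∀ t, HasDerivAt (fun t => discreteEnergy α μ (v t)) 0 t := by
    intro t
    have hv := hasDerivAt_of_discrete_duhamel
      ((continuous_discreteCubic M).comp h.continuous) (isDiscreteSolution_iff.mp h).2 t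
    rw [Function.comp_apply] at hv
    set V := discreteVelocity α μ (v t) (discreteCubic M (v t)) with hV
    set G := discreteCubic M (v t) with hG
    have h1 := hasDerivAt_sum_norm_sq_dcoeff hv fun k => discreteSymbol α M k / 2
    have h2 : HasDerivAt (fun t => ∑ j, ‖v t j‖ ^ 4) (∑ j, 4 * (conj (G j) * V j).re) t := by
      refine HasDerivAt.fun_sum fun j _ => ?_
      have h3 := (((hasDerivAt_pi.mp hv) j).norm_sq).pow 2
      have h4 : (fun t => ‖v t j‖ ^ 4) = (fun t => ‖v t j‖ ^ 2) ^ 2 := by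
        funext t; simp only [Pi.pow_apply]; ring
      rw [h4]
      refine h3.congr_deriv ?_
      rw [Complex.inner, mul_comm (V j), hG, discreteCubic, map_mul, Complex.conj_ofReal,
        mul_assoc (_ : ℂ) _ (V j), Complex.re_ofReal_mul]
      simp only [Nat.cast_ofNat, Nat.add_one_sub_one, pow_one]
      ring
    refine (h1.add ((h2.const_mul (2 * M : ℝ)⁻¹).const_mul (μ / 4))).congr_deriv ?_
    have h5 : (2 * M : ℝ)⁻¹ * ∑ j, 4 * (conj (G j) * V j).re =
        4 * ∑ k, (conj (dcoeff M k G) * dcoeff M k V).re := by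
      have := congrArg Complex.re (sum_conj_mul_dcoeff G V)
      have e : (2 * M : ℂ)⁻¹ = (((2 * M : ℝ)⁻¹ : ℝ) : ℂ) := by push_cast; rfl
      rw [e, Complex.re_ofReal_mul, Complex.re_sum, Complex.re_sum] at this
      rw [← Finset.mul_sum, this]; ring
    rw [h5, Finset.mul_sum, Finset.mul_sum, ← Finset.sum_add_distrib]
    refine Finset.sum_eq_zero fun k _ => ?_
    have hVk := dcoeff_discreteVelocity α μ (v t) G k
    rw [← hV] at hVk
    rw [hVk]
    set a := dcoeff M k (v t)
    set b := dcoeff M k G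
    simp only [Complex.mul_re, Complex.mul_im, Complex.neg_re, Complex.neg_im, Complex.conj_re,
      Complex.conj_im, Complex.add_re, Complex.add_im, Complex.ofReal_re, Complex.ofReal_im,
      Complex.I_re, Complex.I_im]
    ring
  have hc := is_const_of_deriv_eq_zero (fun t => (hd t).differentiableAt) fun t => (hd t).deriv
  rw [hc t 0, h.apply_zero]

end IsDiscreteSolution

/-- The fourth power sum is at most the squared sup norm times the mass; the parameter `l` is left
free so that the Sobolev term can be made small. -/
theorem sum_norm_pow_four_le {α l : ℝ} (hα : 1 < α) (hl : 0 ≤ l) (g : Lattice M) :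
    (2 * M : ℝ)⁻¹ * ∑ j, ‖g j‖ ^ 4 ≤ weightSum α l *
      (∑ k, weight α k.valMinAbs * ‖dcoeff M k g‖ ^ 2 + l * ∑ k, ‖dcoeff M k g‖ ^ 2) *
      ∑ k, ‖dcoeff M k g‖ ^ 2 := by
  have h1 : ∀ j, ‖g j‖ ^ 2 ≤ weightSum α l *
      (∑ k, weight α k.valMinAbs * ‖dcoeff M k g‖ ^ 2 + l * ∑ k, ‖dcoeff M k g‖ ^ 2) := by
    intro j
    refine (pow_le_pow_left₀ (norm_nonneg _) (norm_le_sum_norm_dcoeff g j) 2).trans ?_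
    refine (sq_sum_le_weightSum_mul_sum hα hl _).trans_eq ?_
    rw [Finset.mul_sum (a := l), ← Finset.sum_add_distrib]
    simp only [add_mul]
  rw [_root_.FracNLS.sum_norm_sq_dcoeff, mul_left_comm]
  refine mul_le_mul_of_nonneg_left ?_ (by positivity)
  rw [← _root_.FracNLS.sum_norm_sq_dcoeff, Finset.mul_sum]
  refine Finset.sum_le_sum fun j _ => ?_
  rw [show ‖g j‖ ^ 4 = ‖g j‖ ^ 2 * ‖g j‖ ^ 2 by ring]
  exact mul_le_mul_of_nonneg_right (h1 j) (sq_nonneg _)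

/-- Energy conservation controls the kinetic term only up to the quartic term, which has the wrong
sign for `μ = -1`. A large `l` lets it be absorbed into half of the Sobolev norm. The bound `A'` is
chosen before `μ` and `M`, hence is uniform in $h$. -/
theorem exists_dSobLE_of_isDiscreteSolution {α : ℝ} (hα : 1 < α) (hα2 : α ≤ 2) (A : ℝ) :
    ∃ A', ∀ (μ : ℝ) (M : ℕ) [NeZero M] (v₀ : Lattice M) (v : ℝ → Lattice M), |μ| ≤ 1 →
      DSobLE α A v₀ → IsDiscreteSolution α μ M v₀ v → ∀ t, DSobLE α A' (v t) := by
  -- With `N` the squared Sobolev norm and `P` the quartic term at time `t`, the energy gives `N ≤ 8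
  -- * A ^ 2 + 16 * E + 4 * P`; this choice of `l` gives `8 * P ≤ N + l * A ^ 2`, so that `4 * P`
  -- costs half of `N`.
  obtain ⟨l, hl0, hl⟩ : ∃ l, 0 ≤ l ∧ 8 * (weightSum α l * A ^ 2) ≤ 1 := by
    have h1 : Tendsto (fun l => 8 * (weightSum α l * A ^ 2)) atTop (𝓝 0) := by
      simpa using ((tendsto_weightSum hα).mul_const (A ^ 2)).const_mul 8
    obtain ⟨l, h2, h3⟩ := ((eventually_ge_atTop 0).and (h1.eventually_le_const one_pos)).exists
    exact ⟨l, h2, h3⟩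
  set E := A ^ 2 / 2 + weightSum α 0 * A ^ 2 * A ^ 2 / 4 with hE
  refine ⟨√(2 * (8 * A ^ 2 + 16 * E) + l * A ^ 2), fun μ M _ v₀ v hμ h₀ h t =>
    ⟨Real.sqrt_nonneg _, ?_⟩⟩
  have hK0 : 0 ≤ weightSum α 0 := weightSum_nonneg le_rfl
  have hKl : 0 ≤ weightSum α l := weightSum_nonneg hl0
  have hE0 : 0 ≤ E := by positivity
  rw [Real.sq_sqrt (by positivity)]
  have hm0 := h₀.sum_norm_sq_dcoeff_le (by linarith)
  have hm := h.sum_norm_sq_dcoeff t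
  have he := h.discreteEnergy_eq t
  have hp0 := sum_norm_pow_four_le hα le_rfl v₀
  have hpt := sum_norm_pow_four_le hα hl0 (v t)
  rw [hm] at hpt
  simp only [discreteEnergy] at he
  set m := ∑ k, ‖dcoeff M k v₀‖ ^ 2 with hmdef
  set N := ∑ k, weight α k.valMinAbs * ‖dcoeff M k (v t)‖ ^ 2
  set N₀ := ∑ k, weight α k.valMinAbs * ‖dcoeff M k v₀‖ ^ 2
  set P := (2 * M : ℝ)⁻¹ * ∑ j, ‖v t j‖ ^ 4
  set P₀ := (2 * M : ℝ)⁻¹ * ∑ j, ‖v₀ j‖ ^ 4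
  have hm' : 0 ≤ m := by positivity
  have hP : 0 ≤ P := by positivity
  have hP₀ : 0 ≤ P₀ := by positivity
  have hN : 0 ≤ N := Finset.sum_nonneg fun k _ => mul_nonneg (weight_pos _ _).le (sq_nonneg _)
  have hN₀ : N₀ ≤ A ^ 2 := h₀.2
  have hN₀' : 0 ≤ N₀ := Finset.sum_nonneg fun k _ => mul_nonneg (weight_pos _ _).le (sq_nonneg _)
  have hS₀ : ∑ k, discreteSymbol α M k / 2 * ‖dcoeff M k v₀‖ ^ 2 ≤ N₀ / 2 := by
    rw [Finset.sum_div]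
    refine Finset.sum_le_sum fun k _ => ?_
    have h1 := (discreteSymbol_le (by linarith : 0 ≤ α) k).trans
      (abs_rpow_le_weight (by linarith) k.valMinAbs)
    have := mul_le_mul_of_nonneg_right h1 (sq_nonneg ‖dcoeff M k v₀‖)
    linarith
  have hS : N ≤ 8 * m + 16 * ∑ k, discreteSymbol α M k / 2 * ‖dcoeff M k (v t)‖ ^ 2 := by
    rw [← hm, Finset.mul_sum, Finset.mul_sum, ← Finset.sum_add_distrib]
    refine Finset.sum_le_sum fun k _ => ?_
    have := mul_le_mul_of_nonneg_right
      (weight_le_discreteSymbol (by linarith : 0 ≤ α) hα2 k) (sq_nonneg ‖dcoeff M k (v t)‖)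
    linarith
  have hμ1 := abs_le.mp hμ
  have hP₀' : P₀ ≤ weightSum α 0 * A ^ 2 * A ^ 2 := by
    rw [zero_mul, add_zero] at hp0
    exact hp0.trans (by gcongr)
  have hPt : P ≤ weightSum α l * (N + l * A ^ 2) * A ^ 2 := hpt.trans (by gcongr)
  have hx : μ / 4 * P₀ ≤ P₀ / 4 := by nlinarith
  have hy : -(μ / 4 * P) ≤ P / 4 := by nlinarith
  have hz : 8 * (weightSum α l * (N + l * A ^ 2) * A ^ 2) ≤ N + l * A ^ 2 := by
    have : 0 ≤ N + l * A ^ 2 := by positivity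
    calc _ = 8 * (weightSum α l * A ^ 2) * (N + l * A ^ 2) := by ring
      _ ≤ 1 * (N + l * A ^ 2) := by gcongr
      _ = _ := one_mul _
  linarith

end DiscreteEquation

/-! ### Trigonometric polynomials and trigonometric interpolation -/

section TrigPoly

open scoped NNReal ComplexConjugate

variable {M : ℕ} [NeZero M]

/-- The function `x ↦ ∑ₖ cₖ e^{ikx}`, where `k` runs over the representatives of `ℤ / 2M` in
`(-M, M]`. -/
def trigFun (c : ZMod (2 * M) → ℂ) (x : Torus) : ℂ := ∑ k, c k * fourier k.valMinAbs x

/-- The function `∑ₖ cₖ e^{ikx}` as an element of `L²(𝕋)`. -/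
def trigPoly (c : ZMod (2 * M) → ℂ) : L2Torus :=
  ∑ k, c k • (fourierLp (T := 2 * π) 2 k.valMinAbs : L2Torus)

theorem continuous_trigFun (c : ZMod (2 * M) → ℂ) : Continuous (trigFun c) := by
  unfold trigFun
  exact continuous_finsetSum _ fun k _ => continuous_const.mul (fourier _).continuous

theorem coeFn_trigPoly (c : ZMod (2 * M) → ℂ) :
    trigPoly c =ᵐ[AddCircle.haarAddCircle] trigFun c := by
  have h : ∀ k : ZMod (2 * M), (c k • (fourierLp (T := 2 * π) 2 k.valMinAbs : L2Torus) : L2Torus)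
      =ᵐ[AddCircle.haarAddCircle] fun x => c k * fourier k.valMinAbs x := by
    intro k
    filter_upwards [Lp.coeFn_smul (c k) (fourierLp (T := 2 * π) 2 k.valMinAbs : L2Torus),
      coeFn_fourierLp (T := 2 * π) 2 k.valMinAbs] with x h1 h2
    rw [h1, Pi.smul_apply, h2, smul_eq_mul]
  have h' := eventually_countable_forall.mpr h
  filter_upwards [Lp.coeFn_finsetSum Finset.univ
    fun k : ZMod (2 * M) => c k • (fourierLp (T := 2 * π) 2 k.valMinAbs : L2Torus), h'] with x h1 h2
  rw [trigPoly, h1, Finset.sum_apply, trigFun]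
  exact Finset.sum_congr rfl fun k _ => h2 k

theorem coeff_trigPoly (c : ZMod (2 * M) → ℂ) (l : ℤ) :
    coeff l (trigPoly c) = ∑ k : ZMod (2 * M), if l = k.valMinAbs then c k else 0 := by
  simp [trigPoly, coeff_fourierLp]

theorem coeff_valMinAbs_trigPoly (c : ZMod (2 * M) → ℂ) (k : ZMod (2 * M)) :
    coeff k.valMinAbs (trigPoly c) = c k := by
  rw [coeff_trigPoly]
  simp [ZMod.valMinAbs_inj]

theorem coeff_trigPoly_of_notMem (c : ZMod (2 * M) → ℂ) {l : ℤ}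
    (hl : ∀ k : ZMod (2 * M), k.valMinAbs ≠ l) : coeff l (trigPoly c) = 0 := by
  rw [coeff_trigPoly]
  exact Finset.sum_eq_zero fun k _ => if_neg fun h => hl k h.symm

theorem hasSum_trigPoly (w : ℤ → ℝ) (c : ZMod (2 * M) → ℂ) :
    HasSum (fun l => w l * ‖coeff l (trigPoly c)‖ ^ 2) (∑ k, w k.valMinAbs * ‖c k‖ ^ 2) := by
  have h : HasSum (fun l => w l * ‖coeff l (trigPoly c)‖ ^ 2)
      (∑ l ∈ Finset.univ.map ⟨fun k : ZMod (2 * M) => k.valMinAbs, ZMod.injective_valMinAbs⟩,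
        w l * ‖coeff l (trigPoly c)‖ ^ 2) :=
    hasSum_sum_of_ne_finset_zero fun l hl => by
      rw [coeff_trigPoly_of_notMem c fun k hk => hl (by simp [← hk])]; simp
  rw [Finset.sum_map] at h
  simpa only [Function.Embedding.coeFn_mk, coeff_valMinAbs_trigPoly] using h

theorem norm_sq_trigPoly (c : ZMod (2 * M) → ℂ) : ‖trigPoly c‖ ^ 2 = ∑ k, ‖c k‖ ^ 2 := by
  have h := hasSum_trigPoly (fun _ => 1) c
  simp only [one_mul] at h
  exact (hasSum_sq_coeff _).unique h

theorem trigPoly_sub (c d : ZMod (2 * M) → ℂ) : trigPoly c - trigPoly d = trigPoly (c - d) := by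
  simp only [trigPoly, Pi.sub_apply, sub_smul, Finset.sum_sub_distrib]

theorem freeOp_trigPoly (α t : ℝ) (c : ZMod (2 * M) → ℂ) :
    freeOp α t (trigPoly c) = trigPoly fun k => freeSymbol α t k.valMinAbs * c k := by
  refine coeff_ext fun l => ?_
  rw [coeff_freeOp, coeff_trigPoly, coeff_trigPoly, Finset.mul_sum]
  refine Finset.sum_congr rfl fun k _ => ?_
  split_ifs with h
  · rw [h]
  · simp

/-- Trigonometric interpolation of lattice functions. -/
def trigInterp (M : ℕ) [NeZero M] : Lattice M →L[ℂ] L2Torus :=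
  ∑ k, (dcoeff M k).smulRight (fourierLp (T := 2 * π) 2 k.valMinAbs : L2Torus)

theorem trigInterp_apply (g : Lattice M) : trigInterp M g = trigPoly fun k => dcoeff M k g := by
  simp [trigInterp, trigPoly]

theorem norm_sq_trigInterp (g : Lattice M) : ‖trigInterp M g‖ ^ 2 = ∑ k, ‖dcoeff M k g‖ ^ 2 := by
  rw [trigInterp_apply, norm_sq_trigPoly]

theorem DSobLE.sobLE_trigInterp {α A : ℝ} {g : Lattice M} (hg : DSobLE α A g) :
    SobLE α A (trigInterp M g) := by
  rw [trigInterp_apply]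
  have h := hasSum_trigPoly (weight α) fun k => dcoeff M k g
  exact SobLE.of_tsum_le hg.1 h.summable (h.tsum_eq.trans_le hg.2)

/-! ### Comparison of the symbols -/

/-- Interpolates between the trivial bound `2` and the bound `y`. The exponent `β` is free, to be
tuned so that the power of the frequency in `y ^ β` equals that of the Sobolev weight. -/
theorem sq_le_four_mul_rpow {d y β : ℝ} (hd : 0 ≤ d) (hd2 : d ≤ 2) (hdy : d ≤ y) (hβ0 : 0 ≤ β)
    (hβ : β ≤ 2) : d ^ 2 ≤ 4 * y ^ β := by
  have hy : 0 ≤ y := hd.trans hdy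
  rcases le_total 1 y with h | h
  · have := Real.one_le_rpow h hβ0
    nlinarith
  · rcases hy.eq_or_lt with rfl | hy'
    · have : d = 0 := le_antisymm hdy hd
      rw [this]; have := Real.rpow_nonneg (le_refl (0 : ℝ)) β; nlinarith
    · have h1 : y ^ (2 : ℝ) ≤ y ^ β := Real.rpow_le_rpow_of_exponent_ge hy' h hβ
      rw [Real.rpow_two] at h1
      nlinarith [sq_nonneg y, pow_le_pow_left₀ hd hdy 2]

theorem sub_sin_le_cube {x : ℝ} (hx : 0 ≤ x) : x - Real.sin x ≤ x ^ 3 := by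
  rcases hx.eq_or_lt with rfl | hx
  · simp
  rcases le_total x 1 with h | h
  · have := Real.sin_gt_sub_cube hx
    have h3 : 0 < x ^ 3 := by positivity
    linarith
  · by_cases h2 : x ≤ 2
    · have hs : 0 ≤ Real.sin x := Real.sin_nonneg_of_nonneg_of_le_pi hx.le
        (h2.trans (by linarith [Real.pi_gt_three]))
      nlinarith [pow_le_pow_left₀ zero_le_one h 2]
    · push Not at h2
      have := Real.neg_one_le_sin x
      nlinarith [pow_le_pow_left₀ zero_le_one h 2]

theorem abs_rpow_sub_discreteSymbol_nonneg {α : ℝ} (hα : 0 ≤ α) (k : ZMod (2 * M)) :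
    0 ≤ |(k.valMinAbs : ℝ)| ^ α - discreteSymbol α M k :=
  sub_nonneg.mpr (discreteSymbol_le hα k)

theorem discreteSymbol_eq {α : ℝ} (k : ZMod (2 * M)) (hk : k.valMinAbs ≠ 0) :
    discreteSymbol α M k = |(k.valMinAbs : ℝ)| ^ α *
      (Real.sin (mesh M * |(k.valMinAbs : ℝ)| / 2) / (mesh M * |(k.valMinAbs : ℝ)| / 2)) ^ α := by
  have hm := mesh_pos M
  have hk0 : 0 < |(k.valMinAbs : ℝ)| := abs_pos.mpr (by exact_mod_cast hk)
  have hx : mesh M * |(k.valMinAbs : ℝ)| / 2 ≤ π / 2 := by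
    rw [← mesh_mul M]
    have := abs_valMinAbs_le k
    gcongr
  have hs : 0 ≤ Real.sin (mesh M * |(k.valMinAbs : ℝ)| / 2) :=
    Real.sin_nonneg_of_nonneg_of_le_pi (by positivity) (by linarith [Real.pi_pos])
  have h1 : |Real.sin (mesh M * (k.valMinAbs : ℝ) / 2)| =
      Real.sin (mesh M * |(k.valMinAbs : ℝ)| / 2) := by
    rw [← abs_of_nonneg hs]
    rcases abs_choice (k.valMinAbs : ℝ) with h | h <;> rw [h]
    rw [mul_neg, neg_div, Real.sin_neg, abs_neg]
  rw [discreteSymbol, abs_mul, abs_of_pos (by positivity : 0 < 2 / mesh M), h1,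
    ← Real.mul_rpow hk0.le (by positivity)]
  congr 1
  field_simp

/-- With $x=h|k|/2$ and $r=\sin x/x\in(0,1]$, the symbol is $|k|^\alpha r^\alpha$, and $r^\alpha\ge
r^2\ge 1-2x^2$ because $\alpha\le 2$. -/
theorem abs_rpow_sub_discreteSymbol_le {α : ℝ} (hα0 : 0 ≤ α) (hα2 : α ≤ 2) (k : ZMod (2 * M)) :
    |(k.valMinAbs : ℝ)| ^ α - discreteSymbol α M k ≤
      mesh M ^ 2 * |(k.valMinAbs : ℝ)| ^ (α + 2) := by
  have hm := mesh_pos M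
  rcases eq_or_ne k.valMinAbs 0 with hk | hk
  · have h := discreteSymbol_nonneg α k
    have h0 : |(k.valMinAbs : ℝ)| = 0 := by rw [hk]; simp
    rcases hα0.eq_or_lt with rfl | hα
    · have : discreteSymbol 0 M k = 1 := by simp [discreteSymbol]
      rw [this, h0]; simp
    · rw [h0, Real.zero_rpow hα.ne', Real.zero_rpow (by positivity)]; linarith
  have hk0 : 0 < |(k.valMinAbs : ℝ)| := abs_pos.mpr (by exact_mod_cast hk)
  set K := |(k.valMinAbs : ℝ)| with hK
  set x := mesh M * K / 2 with hxdef
  have hx0 : 0 < x := by positivity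
  have hx : x ≤ π / 2 := by
    rw [hxdef, ← mesh_mul M]
    have := abs_valMinAbs_le k
    gcongr
  have hs : 0 < Real.sin x := Real.sin_pos_of_pos_of_lt_pi hx0 (by linarith [Real.pi_pos])
  have hr1 : Real.sin x / x ≤ 1 := div_le_one_of_le₀ (Real.sin_le hx0.le) hx0.le
  have hr2 : 1 - x ^ 2 ≤ Real.sin x / x := by
    rw [le_div_iff₀ hx0]; have := sub_sin_le_cube hx0.le; nlinarith
  have hr3 : (Real.sin x / x) ^ (2 : ℝ) ≤ (Real.sin x / x) ^ α :=
    Real.rpow_le_rpow_of_exponent_ge (by positivity) hr1 hα2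
  rw [Real.rpow_two] at hr3
  have hr4 : 1 - (Real.sin x / x) ^ α ≤ 2 * x ^ 2 := by nlinarith [sq_nonneg (1 - Real.sin x / x)]
  rw [discreteSymbol_eq k hk, Real.rpow_add hk0, Real.rpow_two]
  have hp : 0 < K ^ α := Real.rpow_pos_of_pos hk0 _
  calc K ^ α - K ^ α * (Real.sin x / x) ^ α = K ^ α * (1 - (Real.sin x / x) ^ α) := by ring
    _ ≤ K ^ α * (2 * x ^ 2) := by gcongr
    _ ≤ _ := by
        rw [hxdef]
        have : 0 ≤ K ^ α * (mesh M ^ 2 * K ^ 2) := by positivity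
        nlinarith

theorem norm_exp_I_mul_sub_le (x y : ℝ) :
    ‖Complex.exp (-(Complex.I * (x : ℂ))) - Complex.exp (-(Complex.I * (y : ℂ)))‖ ≤ |x - y| := by
  have h : Complex.exp (-(Complex.I * (x : ℂ))) - Complex.exp (-(Complex.I * (y : ℂ))) =
      Complex.exp (Complex.I * ((-y : ℝ) : ℂ)) * (Complex.exp (Complex.I * ((y - x : ℝ) : ℂ)) - 1) := by
    rw [mul_sub, ← Complex.exp_add, mul_one]
    congr 2 <;> push_cast <;> ring
  rw [h, norm_mul, mul_comm Complex.I ((-y : ℝ) : ℂ), Complex.norm_exp_ofReal_mul_I, one_mul]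
  refine (Real.norm_exp_I_mul_ofReal_sub_one_le).trans_eq ?_
  rw [Real.norm_eq_abs, abs_sub_comm]

/-- Origin of the rate. The phases differ by at most $y=(T+1)h^2|k|^{\alpha+2}$ and by at most $2$.
Interpolating with $\beta=\alpha/(2+\alpha)$ turns $|k|^{\alpha+2}$ into $|k|^\alpha$, which the
weight absorbs, and $h^2$ into the square of $h^{\alpha/(2+\alpha)}$. -/
theorem norm_sq_discreteFreeSymbol_sub_le {α T t : ℝ} (hα0 : 0 ≤ α) (hα2 : α ≤ 2) (ht : |t| ≤ T)
    (k : ZMod (2 * M)) :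
    ‖discreteFreeSymbol α M t k - freeSymbol α t k.valMinAbs‖ ^ 2 ≤
      4 * (T + 1) * (mesh M ^ (α / (2 + α))) ^ 2 * weight α k.valMinAbs := by
  have hm := mesh_pos M
  have hT : 0 ≤ T := (abs_nonneg t).trans ht
  set K := |(k.valMinAbs : ℝ)|
  have hK : 0 ≤ K := abs_nonneg _
  have hd := abs_rpow_sub_discreteSymbol_nonneg hα0 k
  have h1 : ‖discreteFreeSymbol α M t k - freeSymbol α t k.valMinAbs‖ ≤
      (T + 1) * (mesh M ^ 2 * K ^ (α + 2)) := by
    refine (norm_exp_I_mul_sub_le _ _).trans ?_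
    rw [← mul_sub, abs_mul, abs_sub_comm, abs_of_nonneg hd]
    exact mul_le_mul (ht.trans (by linarith)) (abs_rpow_sub_discreteSymbol_le hα0 hα2 k) hd
      (by positivity)
  have h2 : ‖discreteFreeSymbol α M t k - freeSymbol α t k.valMinAbs‖ ≤ 2 := by
    refine (norm_sub_le _ _).trans_eq ?_
    rw [norm_discreteFreeSymbol, norm_freeSymbol]; norm_num
  have hβ0 : 0 ≤ α / (2 + α) := by positivity
  have hβ1 : α / (2 + α) ≤ 1 := div_le_one_of_le₀ (by linarith) (by positivity)
  have h3 := sq_le_four_mul_rpow (norm_nonneg _) h2 h1 hβ0 (hβ1.trans one_le_two)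
  refine h3.trans ?_
  rw [Real.mul_rpow (by positivity) (by positivity), Real.mul_rpow (by positivity) (by positivity),
    ← Real.rpow_mul hK, show (α + 2) * (α / (2 + α)) = α by field_simp; ring,
    ← Real.rpow_natCast (mesh M) 2, ← Real.rpow_natCast _ 2, ← Real.rpow_mul hm.le,
    ← Real.rpow_mul hm.le, mul_comm ((2 : ℕ) : ℝ)]
  have h4 : (T + 1) ^ (α / (2 + α)) ≤ T + 1 := by
    simpa using Real.rpow_le_rpow_of_exponent_le (by linarith : 1 ≤ T + 1) hβ1
  have h5 := abs_rpow_le_weight hα0 k.valMinAbs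
  have h6 : 0 ≤ mesh M ^ (α / (2 + α) * ((2 : ℕ) : ℝ)) := by positivity
  calc 4 * ((T + 1) ^ (α / (2 + α)) * (mesh M ^ (α / (2 + α) * ((2 : ℕ) : ℝ)) * K ^ α))
      ≤ 4 * ((T + 1) * (mesh M ^ (α / (2 + α) * ((2 : ℕ) : ℝ)) * weight α k.valMinAbs)) := by
        gcongr
    _ = _ := by ring

theorem norm_trigInterp_discreteFreeOp_sub_le {α A T t : ℝ} (hα0 : 0 ≤ α) (hα2 : α ≤ 2)
    (ht : |t| ≤ T) {g : Lattice M} (hg : DSobLE α A g) :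
    ‖trigInterp M (discreteFreeOp α M t g) - freeOp α t (trigInterp M g)‖ ≤
      2 * (T + 1) * A * mesh M ^ (α / (2 + α)) := by
  have hT : 0 ≤ T := (abs_nonneg t).trans ht
  have hm := mesh_pos M
  have hA := hg.1
  refine le_of_sq_le_sq ?_ (by positivity)
  rw [trigInterp_apply, trigInterp_apply, freeOp_trigPoly, trigPoly_sub, norm_sq_trigPoly]
  calc ∑ k, ‖((fun k => dcoeff M k (discreteFreeOp α M t g)) - fun k : ZMod (2 * M) =>
          freeSymbol α t k.valMinAbs * dcoeff M k g) k‖ ^ 2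
      ≤ ∑ k : ZMod (2 * M), 4 * (T + 1) * (mesh M ^ (α / (2 + α))) ^ 2 *
          (weight α k.valMinAbs * ‖dcoeff M k g‖ ^ 2) := by
        refine Finset.sum_le_sum fun k _ => ?_
        rw [Pi.sub_apply, dcoeff_discreteFreeOp, ← sub_mul, norm_mul, mul_pow, ← mul_assoc]
        exact mul_le_mul_of_nonneg_right (norm_sq_discreteFreeSymbol_sub_le hα0 hα2 ht k)
          (sq_nonneg _)
    _ ≤ 4 * (T + 1) * (mesh M ^ (α / (2 + α))) ^ 2 * A ^ 2 := by
        rw [← Finset.mul_sum]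
        exact mul_le_mul_of_nonneg_left hg.2 (by positivity)
    _ ≤ _ := by
        have : 0 ≤ (mesh M ^ (α / (2 + α))) ^ 2 * A ^ 2 := by positivity
        nlinarith [mul_nonneg hT this, mul_nonneg (mul_nonneg hT hT) this]

end TrigPoly

/-! ### Comparison of lattice functions with functions on the torus -/

section Interpolation

open scoped NNReal ComplexConjugate

variable {M : ℕ} [NeZero M]

/-- Haar measure is invariant under translation by lattice points, so averaging over these
translations reduces an $L^2$ bound on the torus to a bound on each translate of the lattice. -/
theorem eLpNorm_le_of_sum_sq_le {F : Torus → ℂ} {D : ℝ} (hD : 0 ≤ D)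
    (h : ∀ x : ℝ, ∑ j : ZMod (2 * M), ‖F ((x + mesh M * j.val : ℝ) : Torus)‖ ^ 2 ≤ 2 * M * D ^ 2) :
    eLpNorm F 2 (AddCircle.haarAddCircle (T := 2 * π)) ≤ ENNReal.ofReal D := by
  set ν := AddCircle.haarAddCircle (T := 2 * π)
  set φ : Torus → ℝ≥0∞ := fun x => ‖F x‖ₑ ^ (2 : ℝ) with hφ
  have hpos : (2 * M : ℝ≥0∞) ≠ 0 := by
    simpa using NeZero.ne M
  have htop : (2 * M : ℝ≥0∞) ≠ ∞ := ENNReal.mul_ne_top (by simp) (by simp)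
  have key : (2 * M : ℝ≥0∞) * ∫⁻ x, φ x ∂ν ≤ (2 * M : ℝ≥0∞) * ENNReal.ofReal D ^ 2 := by
    -- Only superadditivity of the lower integral is used, so `F` need not be measurable.
    have h1 : ∀ s : Finset (ZMod (2 * M)),
        ∑ j ∈ s, ∫⁻ x, φ (x + ((mesh M * j.val : ℝ) : Torus)) ∂ν ≤
          ∫⁻ x, ∑ j ∈ s, φ (x + ((mesh M * j.val : ℝ) : Torus)) ∂ν := by
      intro s
      induction s using Finset.induction_on with
      | empty => simp
      | insert a s ha ih =>
        simp only [Finset.sum_insert ha]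
        exact (add_le_add le_rfl ih).trans (le_lintegral_add _ _)
    have h2 := h1 Finset.univ
    simp only [lintegral_add_right_eq_self, Finset.sum_const, Finset.card_univ, ZMod.card,
      nsmul_eq_mul] at h2
    push_cast at h2
    refine h2.trans ?_
    have h3 : ∀ x : Torus, ∑ j : ZMod (2 * M), φ (x + ((mesh M * j.val : ℝ) : Torus)) ≤
        (2 * M : ℝ≥0∞) * ENNReal.ofReal D ^ 2 := by
      intro x
      obtain ⟨y, rfl⟩ := QuotientAddGroup.mk_surjective x
      have h4 := ENNReal.ofReal_le_ofReal (h y)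
      rw [ENNReal.ofReal_sum_of_nonneg fun _ _ => sq_nonneg _] at h4
      have e : (2 * M : ℝ≥0∞) * ENNReal.ofReal D ^ 2 = ENNReal.ofReal (2 * M * D ^ 2) := by
        rw [ENNReal.ofReal_mul (by positivity), ENNReal.ofReal_mul (by positivity),
          ENNReal.ofReal_pow hD]
        simp
      rw [e]
      refine le_trans (le_of_eq (Finset.sum_congr rfl fun j _ => ?_)) h4
      rw [hφ]
      simp only [ENNReal.rpow_two]
      rw [ENNReal.ofReal_pow (norm_nonneg _), ofReal_norm]
      rfl
    refine (lintegral_mono h3).trans ?_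
    simp [ν]
  rw [ENNReal.mul_le_mul_iff_right hpos htop] at key
  rw [eLpNorm_eq_lintegral_rpow_enorm_toReal two_ne_zero ENNReal.ofNat_ne_top]
  rw [ENNReal.toReal_ofNat, one_div]
  calc (∫⁻ x, φ x ∂ν) ^ (2 : ℝ)⁻¹ ≤ (ENNReal.ofReal D ^ 2) ^ (2 : ℝ)⁻¹ :=
        ENNReal.rpow_le_rpow key (by norm_num)
    _ = ENNReal.ofReal D := by
        rw [← ENNReal.rpow_natCast, ← ENNReal.rpow_mul]; norm_num

theorem norm_le_of_eLpNorm_le {f : L2Torus} {F : Torus → ℂ} {D : ℝ} (hD : 0 ≤ D)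
    (hf : f =ᵐ[AddCircle.haarAddCircle] F)
    (h : eLpNorm F 2 (AddCircle.haarAddCircle (T := 2 * π)) ≤ ENNReal.ofReal D) : ‖f‖ ≤ D := by
  rw [Lp.norm_def, eLpNorm_congr_ae hf]
  exact ENNReal.toReal_le_of_le_ofReal hD h

theorem fourier_coe (n : ℤ) (x : ℝ) :
    fourier (T := 2 * π) n (x : Torus) = Complex.exp (Complex.I * ((n * x : ℝ) : ℂ)) := by
  rw [fourier_coe_apply]
  congr 1
  have : (π : ℂ) ≠ 0 := by exact_mod_cast Real.pi_ne_zero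
  push_cast
  field_simp

theorem stdAddChar_intCast_mul (m : ℤ) (k : ZMod (2 * M)) :
    (ZMod.stdAddChar ((m : ZMod (2 * M)) * k) : ℂ) =
      Complex.exp (Complex.I * ((k.valMinAbs * (mesh M * m) : ℝ) : ℂ)) := by
  have h : (m : ZMod (2 * M)) * k = ((m * k.valMinAbs : ℤ) : ZMod (2 * M)) := by
    simp
  rw [h, ZMod.stdAddChar_coe]
  congr 1
  have hM : (M : ℂ) ≠ 0 := Nat.cast_ne_zero.mpr (NeZero.ne M)
  rw [mesh]
  push_cast
  field_simp

/-- The lattice function `x ↦ ∑ₖ aₖ e^{ik(x + y)}`, where `aₖ` are the coefficients of `g`. -/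
def latticeShift (y : ℝ) (g : Lattice M) : Lattice M := fun j =>
  ∑ k : ZMod (2 * M), Complex.exp (Complex.I * ((k.valMinAbs * y : ℝ) : ℂ)) * dcoeff M k g *
    ZMod.stdAddChar (j * k)

theorem dcoeff_latticeShift (y : ℝ) (g : Lattice M) (k : ZMod (2 * M)) :
    dcoeff M k (latticeShift y g) =
      Complex.exp (Complex.I * ((k.valMinAbs * y : ℝ) : ℂ)) * dcoeff M k g :=
  dcoeff_synthesis M _ k

/-- On a translate of the lattice the trigonometric interpolant is again a lattice function, with
rotated coefficients; there Parseval applies. -/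
theorem trigFun_dcoeff_add (g : Lattice M) (y : ℝ) (m : ℤ) :
    trigFun (fun k => dcoeff M k g) ((mesh M * m + y : ℝ) : Torus) =
      latticeShift y g (m : ZMod (2 * M)) := by
  rw [trigFun, latticeShift]
  refine Finset.sum_congr rfl fun k _ => ?_
  rw [fourier_coe, stdAddChar_intCast_mul, mul_add, Complex.ofReal_add, mul_add, Complex.exp_add]
  ring

theorem latticeShift_mesh (g : Lattice M) (m : ZMod (2 * M)) :
    latticeShift (mesh M) g m = g (m + 1) := by
  rw [← sum_dcoeff M g (m + 1), latticeShift]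
  refine Finset.sum_congr rfl fun k _ => ?_
  have h := stdAddChar_intCast_mul 1 k
  rw [Int.cast_one, Int.cast_one, mul_one, one_mul] at h
  rw [add_mul, one_mul, AddChar.map_add_eq_mul, h]
  ring

theorem norm_sq_exp_sub_one_le {α : ℝ} (hα0 : 0 ≤ α) (hα2 : α ≤ 2) {y : ℝ} (hy : 0 ≤ y)
    (hyh : y ≤ mesh M) (n : ℤ) :
    ‖Complex.exp (Complex.I * ((n * y : ℝ) : ℂ)) - 1‖ ^ 2 ≤ 4 * mesh M ^ α * weight α n := by
  have h1 : ‖Complex.exp (Complex.I * ((n * y : ℝ) : ℂ)) - 1‖ ≤ mesh M * |(n : ℝ)| := by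
    refine Real.norm_exp_I_mul_ofReal_sub_one_le.trans ?_
    rw [Real.norm_eq_abs, abs_mul, abs_of_nonneg hy, mul_comm]
    gcongr
  have h2 : ‖Complex.exp (Complex.I * ((n * y : ℝ) : ℂ)) - 1‖ ≤ 2 := by
    refine (norm_sub_le _ _).trans_eq ?_
    rw [mul_comm, Complex.norm_exp_ofReal_mul_I, norm_one]; norm_num
  refine (sq_le_four_mul_rpow (norm_nonneg _) h2 h1 hα0 hα2).trans ?_
  rw [Real.mul_rpow (mesh_pos M).le (abs_nonneg _), mul_assoc]
  have := abs_rpow_le_weight hα0 n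
  have := Real.rpow_nonneg (mesh_pos M).le α
  gcongr

theorem sum_norm_sq_latticeShift_sub_le {α A : ℝ} (hα0 : 0 ≤ α) (hα2 : α ≤ 2) {g : Lattice M}
    (hg : DSobLE α A g) {y : ℝ} (hy : 0 ≤ y) (hyh : y ≤ mesh M) :
    ∑ j, ‖latticeShift y g j - g j‖ ^ 2 ≤ 2 * M * (4 * mesh M ^ α * A ^ 2) := by
  have hM : (0 : ℝ) < 2 * M := by
    have := Nat.pos_of_ne_zero (NeZero.ne M); positivity
  have h := sum_norm_sq_dcoeff (latticeShift y g - g)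
  have h1 : ∑ k, ‖dcoeff M k (latticeShift y g - g)‖ ^ 2 ≤ 4 * mesh M ^ α * A ^ 2 := by
    calc _ ≤ ∑ k : ZMod (2 * M), 4 * mesh M ^ α * (weight α k.valMinAbs * ‖dcoeff M k g‖ ^ 2) := by
          refine Finset.sum_le_sum fun k _ => ?_
          rw [map_sub, dcoeff_latticeShift, ← sub_one_mul, norm_mul, mul_pow, ← mul_assoc]
          exact mul_le_mul_of_nonneg_right (norm_sq_exp_sub_one_le hα0 hα2 hy hyh _) (sq_nonneg _)
      _ ≤ _ := by
          rw [← Finset.mul_sum]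
          have := Real.rpow_nonneg (mesh_pos M).le α
          exact mul_le_mul_of_nonneg_left hg.2 (by positivity)
  rw [h, inv_mul_le_iff₀ hM] at h1
  exact h1

/-- The formula needs no representative in $[-\pi,\pi)$: a shift of `x` by $2\pi$ moves the floor by
`2M`, which vanishes in the index group. -/
theorem interpolate_coe (g : Lattice M) (x : ℝ) : interpolate M g (x : Torus) =
    g ((⌊x / mesh M⌋ : ℤ) : ZMod (2 * M)) +
      (g ((⌊x / mesh M⌋ + 1 : ℤ) : ZMod (2 * M)) - g ((⌊x / mesh M⌋ : ℤ) : ZMod (2 * M))) /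
          (mesh M : ℂ) * ((x - mesh M * (⌊x / mesh M⌋ : ℝ) : ℝ) : ℂ) := by
  have hm := mesh_pos M
  set y := toIcoMod Real.two_pi_pos (-π) x with hy
  set m := toIcoDiv Real.two_pi_pos (-π) x with hmd
  have hxy : x = y + m * (2 * π) := by
    have := toIcoMod_add_toIcoDiv_zsmul Real.two_pi_pos (-π) x
    rw [zsmul_eq_mul] at this
    exact this.symm
  have hxT : (x : Torus) = (y : Torus) := by
    rw [hxy, ← zsmul_eq_mul, AddCircle.coe_add, AddCircle.coe_zsmul, AddCircle.coe_period, smul_zero,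
      add_zero]
  have hdiv : x / mesh M = y / mesh M + ((2 * M * m : ℤ) : ℝ) := by
    rw [hxy, ← mesh_mul M]; push_cast; field_simp
  have hfl : ⌊x / mesh M⌋ = ⌊y / mesh M⌋ + 2 * M * m := by rw [hdiv, Int.floor_add_intCast]
  have hz : ((2 * M * m : ℤ) : ZMod (2 * M)) = 0 := by
    have : ((2 * M : ℕ) : ZMod (2 * M)) = 0 := ZMod.natCast_self _
    push_cast at this ⊢
    rw [this, zero_mul]
  have h1 : ((⌊x / mesh M⌋ : ℤ) : ZMod (2 * M)) = ((⌊y / mesh M⌋ : ℤ) : ZMod (2 * M)) := by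
    rw [hfl, Int.cast_add, hz, add_zero]
  have h2 : x - mesh M * (⌊x / mesh M⌋ : ℝ) = y - mesh M * (⌊y / mesh M⌋ : ℝ) := by
    rw [hfl, hxy, ← mesh_mul M]; push_cast; ring
  rw [interpolate, hxT, AddCircle.liftIco_coe_apply (toIcoMod_mem_Ico Real.two_pi_pos (-π) x)]
  rw [Int.cast_add, Int.cast_add, h1, h2]

theorem exists_interpolate_eq (g : Lattice M) (m : ℤ) {y : ℝ} (hy0 : 0 ≤ y) (hy : y < mesh M) :
    interpolate M g ((mesh M * m + y : ℝ) : Torus) =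
      g m + ((y / mesh M : ℝ) : ℂ) * (g (m + 1) - g m) := by
  have hm := mesh_pos M
  have hf : ⌊(mesh M * m + y) / mesh M⌋ = m := by
    rw [Int.floor_eq_iff, le_div_iff₀ hm, div_lt_iff₀ hm]
    constructor <;> nlinarith
  rw [interpolate_coe, hf, add_sub_cancel_left]
  push_cast
  ring

omit [NeZero M] in
theorem measurable_interpolate (g : Lattice M) : Measurable (interpolate M g) := by
  have hfl : Measurable fun x : ℝ => ⌊x / mesh M⌋ := Int.measurable_floor.comp
    (measurable_id.div_const _)
  have h1 : ∀ φ : ℤ → ℂ, Measurable fun x : ℝ => φ ⌊x / mesh M⌋ := fun φ =>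
    (measurable_from_top (f := φ)).comp hfl
  have h2 : Measurable fun x : ℝ =>
      g ((⌊x / mesh M⌋ : ℤ) : ZMod (2 * M)) +
      (g ((⌊x / mesh M⌋ + 1 : ℤ) : ZMod (2 * M)) - g ((⌊x / mesh M⌋ : ℤ) : ZMod (2 * M))) /
          (mesh M : ℂ) * ((x - mesh M * (⌊x / mesh M⌋ : ℝ) : ℝ) : ℂ) := by
    refine (h1 fun m => g m).add (((((h1 fun m => g ((m + 1 : ℤ) : ZMod (2 * M))).sub
      (h1 fun m => g m)).div_const _)).mul (Complex.measurable_ofReal.comp ?_))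
    exact measurable_id.sub (((measurable_from_top (f := fun m : ℤ => (m : ℝ))).comp hfl).const_mul _)
  exact h2.comp (measurable_subtype_coe.comp (AddCircle.measurableEquivIco (2 * π) (-π)).measurable)

theorem exists_decomposition (x : ℝ) : ∃ (m : ℤ) (y : ℝ), 0 ≤ y ∧ y < mesh M ∧
    ∀ j : ZMod (2 * M), x + mesh M * j.val = mesh M * ((m + (j.val : ℤ) : ℤ) : ℝ) + y := by
  have hm := mesh_pos M
  refine ⟨⌊x / mesh M⌋, x - mesh M * ⌊x / mesh M⌋, ?_, ?_, fun j => by push_cast; ring⟩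
  · have := Int.floor_le (x / mesh M)
    rw [le_div_iff₀ hm] at this; linarith
  · have := Int.lt_floor_add_one (x / mesh M)
    rw [div_lt_iff₀ hm] at this; linarith

theorem sum_shift_val (m : ℤ) (φ : ZMod (2 * M) → ℝ) :
    ∑ j : ZMod (2 * M), φ ((m + (j.val : ℤ) : ℤ) : ZMod (2 * M)) = ∑ j, φ j := by
  rw [← Equiv.sum_comp (Equiv.addLeft (m : ZMod (2 * M))) φ]
  refine Finset.sum_congr rfl fun j _ => ?_
  simp

/-- At distance `y` from a lattice point the difference is `y / mesh M` times the increment over one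
mesh, minus the increment of the trigonometric interpolant over `y`. Both are translation
differences over at most $h$, so each costs $h^{\alpha/2}$. -/
theorem eLpNorm_interpolate_sub_trigFun_le {α A : ℝ} (hα0 : 0 ≤ α) (hα2 : α ≤ 2) {g : Lattice M}
    (hg : DSobLE α A g) :
    eLpNorm (fun x => interpolate M g x - trigFun (fun k => dcoeff M k g) x) 2
      (AddCircle.haarAddCircle (T := 2 * π)) ≤ ENNReal.ofReal (4 * A * mesh M ^ (α / 2)) := by
  have hm := mesh_pos M
  have hA := hg.1
  have hp : (mesh M ^ (α / 2)) ^ 2 = mesh M ^ α := by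
    rw [← Real.rpow_natCast, ← Real.rpow_mul hm.le]; congr 1; push_cast; ring
  refine eLpNorm_le_of_sum_sq_le (M := M) (by positivity) fun x => ?_
  obtain ⟨m, y, hy0, hy, hj⟩ := exists_decomposition (M := M) x
  have hyh : y / mesh M ≤ 1 := div_le_one_of_le₀ hy.le hm.le
  have key : ∀ n : ℤ, ‖interpolate M g ((mesh M * n + y : ℝ) : Torus) -
      trigFun (fun k => dcoeff M k g) ((mesh M * n + y : ℝ) : Torus)‖ ^ 2 ≤
      2 * ‖latticeShift (mesh M) g (n : ZMod (2 * M)) - g n‖ ^ 2 +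
        2 * ‖latticeShift y g (n : ZMod (2 * M)) - g n‖ ^ 2 := by
    intro n
    rw [exists_interpolate_eq g n hy0 hy, trigFun_dcoeff_add, latticeShift_mesh]
    set a := g (n + 1) - g n
    set b := latticeShift y g (n : ZMod (2 * M)) - g n with hb
    have e : g n + ((y / mesh M : ℝ) : ℂ) * a - latticeShift y g (n : ZMod (2 * M)) =
        ((y / mesh M : ℝ) : ℂ) * a - b := by rw [hb]; ring
    rw [e]
    have h1 : ‖((y / mesh M : ℝ) : ℂ) * a - b‖ ≤ ‖a‖ + ‖b‖ := by
      refine (norm_sub_le _ _).trans (add_le_add ?_ le_rfl)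
      rw [norm_mul, Complex.norm_real, Real.norm_of_nonneg (by positivity)]
      exact mul_le_of_le_one_left (norm_nonneg _) hyh
    have h2 := pow_le_pow_left₀ (norm_nonneg _) h1 2
    nlinarith [sq_nonneg (‖a‖ - ‖b‖)]
  simp only [hj]
  refine (Finset.sum_le_sum fun j _ => key _).trans ?_
  rw [sum_shift_val m fun j => 2 * ‖latticeShift (mesh M) g j - g j‖ ^ 2 +
        2 * ‖latticeShift y g j - g j‖ ^ 2, Finset.sum_add_distrib, ← Finset.mul_sum,
    ← Finset.mul_sum]
  have h1 := sum_norm_sq_latticeShift_sub_le hα0 hα2 hg hm.le le_rfl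
  have h2 := sum_norm_sq_latticeShift_sub_le hα0 hα2 hg hy0 hy.le
  rw [mul_pow, mul_pow, hp]
  linarith

/-- The aliasing error. Both functions agree at the lattice points, and over a distance below $h$
each moves by $O(h^{\alpha/2})$ in $L^2$. As the truncated cubic is globally Lipschitz, the
interpolant needs no sup bound between lattice points. -/
theorem norm_trigInterp_discreteCubic_sub_le {α A A' : ℝ} (hα0 : 0 ≤ α) (hα2 : α ≤ 2)
    {g : Lattice M} (hg : DSobLE α A g) (hg' : DSobLE α A' (discreteCubic M g)) {B : ℝ≥0}
    (hB : ∀ j, ‖g j‖ ≤ B) :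
    ‖trigInterp M (discreteCubic M g) - cubicTrunc B (trigInterp M g)‖ ≤
      4 * (A' + 6 * B ^ 2 * A) * mesh M ^ (α / 2) := by
  have hm := mesh_pos M
  have hA := hg.1
  have hA' := hg'.1
  have hp : (mesh M ^ (α / 2)) ^ 2 = mesh M ^ α := by
    rw [← Real.rpow_natCast, ← Real.rpow_mul hm.le]; congr 1; push_cast; ring
  have hpα : 0 ≤ mesh M ^ α := by positivity
  set Q := trigFun (fun k => dcoeff M k g) with hQ
  set Q' := trigFun (fun k => dcoeff M k (discreteCubic M g)) with hQ'
  have hae : trigInterp M (discreteCubic M g) - cubicTrunc B (trigInterp M g)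
      =ᵐ[AddCircle.haarAddCircle] fun x => Q' x - cubicTruncFun B (Q x) := by
    rw [trigInterp_apply, trigInterp_apply]
    filter_upwards [Lp.coeFn_sub (trigPoly fun k => dcoeff M k (discreteCubic M g))
      (cubicTrunc B (trigPoly fun k => dcoeff M k g)), coeFn_trigPoly fun k => dcoeff M k g,
      coeFn_trigPoly fun k => dcoeff M k (discreteCubic M g),
      coeFn_cubicTrunc B (trigPoly fun k => dcoeff M k g)] with x h1 h2 h3 h4
    rw [h1, Pi.sub_apply, h4, h3, h2]
  refine norm_le_of_eLpNorm_le (by positivity) hae ?_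
  refine eLpNorm_le_of_sum_sq_le (M := M) (by positivity) fun x => ?_
  obtain ⟨m, y, hy0, hy, hj⟩ := exists_decomposition (M := M) x
  have key : ∀ n : ℤ, ‖Q' ((mesh M * n + y : ℝ) : Torus) -
      cubicTruncFun B (Q ((mesh M * n + y : ℝ) : Torus))‖ ^ 2 ≤
      2 * ‖latticeShift y (discreteCubic M g) (n : ZMod (2 * M)) - discreteCubic M g n‖ ^ 2 +
        2 * (6 * B ^ 2) ^ 2 * ‖latticeShift y g (n : ZMod (2 * M)) - g n‖ ^ 2 := by
    intro n
    rw [hQ, hQ', trigFun_dcoeff_add, trigFun_dcoeff_add]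
    set a := latticeShift y (discreteCubic M g) (n : ZMod (2 * M)) - discreteCubic M g n with ha
    set b := latticeShift y g (n : ZMod (2 * M)) - g n with hb
    have h0 : discreteCubic M g n = cubicTruncFun B (g n) := by
      rw [cubicTruncFun_of_norm_le (hB _)]; rfl
    have h1 := (lipschitzWith_cubicTruncFun B).dist_le_mul (latticeShift y g n) (g n)
    rw [dist_eq_norm, dist_eq_norm, ← h0, ← hb] at h1
    push_cast at h1
    set d := cubicTruncFun B (latticeShift y g (n : ZMod (2 * M))) - discreteCubic M g n with hd
    have e : latticeShift y (discreteCubic M g) (n : ZMod (2 * M)) -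
        cubicTruncFun B (latticeShift y g (n : ZMod (2 * M))) = a - d := by rw [ha, hd]; ring
    rw [e]
    have h2 : ‖a - d‖ ≤ ‖a‖ + 6 * B ^ 2 * ‖b‖ := (norm_sub_le _ _).trans (add_le_add le_rfl h1)
    have h3 := pow_le_pow_left₀ (norm_nonneg _) h2 2
    nlinarith [sq_nonneg (‖a‖ - 6 * B ^ 2 * ‖b‖)]
  simp only [hj]
  refine (Finset.sum_le_sum fun j _ => key _).trans ?_
  rw [sum_shift_val m fun j => 2 * ‖latticeShift y (discreteCubic M g) j - discreteCubic M g j‖ ^ 2 +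
        2 * (6 * (B : ℝ) ^ 2) ^ 2 * ‖latticeShift y g j - g j‖ ^ 2, Finset.sum_add_distrib,
    ← Finset.mul_sum, ← Finset.mul_sum]
  have h1 := sum_norm_sq_latticeShift_sub_le hα0 hα2 hg' hy0 hy.le
  have h2 := mul_le_mul_of_nonneg_left (sum_norm_sq_latticeShift_sub_le hα0 hα2 hg hy0 hy.le)
    (by positivity : (0 : ℝ) ≤ 2 * (6 * (B : ℝ) ^ 2) ^ 2)
  rw [mul_pow, mul_pow, hp]
  have h3 : 0 ≤ (M : ℝ) * (mesh M ^ α) * (A' * (6 * B ^ 2 * A)) := by positivity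
  have h4 : 0 ≤ (M : ℝ) * (mesh M ^ α) * A' ^ 2 := by positivity
  have h5 : 0 ≤ (M : ℝ) * (mesh M ^ α) * (6 * B ^ 2 * A) ^ 2 := by positivity
  nlinarith

end Interpolation

/-! ### The discretization -/

section Discretization

open scoped NNReal ComplexConjugate

variable {M : ℕ} [NeZero M]

theorem mesh_le_two_pi : mesh M ≤ 2 * π := (mesh_le_pi M).trans (by linarith [Real.pi_pos])

theorem ae_restrict_of_ae_torus {P : Torus → Prop}
    (h : ∀ᵐ x ∂AddCircle.haarAddCircle (T := 2 * π), P x) (a : ℝ) :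
    ∀ᵐ y : ℝ ∂volume.restrict (Set.Ioc a (a + mesh M)), P (y : Torus) := by
  have h1 : ∀ᵐ x ∂(volume : Measure Torus), P x := by
    rw [AddCircle.volume_eq_smul_haarAddCircle]
    exact Measure.ae_smul_measure h _
  exact ae_mono (Measure.restrict_mono
    (Set.Ioc_subset_Ioc_right (by linarith [mesh_le_two_pi (M := M)])) le_rfl)
    ((AddCircle.measurePreserving_mk (2 * π) a).quasiMeasurePreserving.ae h1)

theorem memLp_restrict_torus (f : L2Torus) (a : ℝ) :
    MemLp (fun y : ℝ => f (y : Torus)) 2 (volume.restrict (Set.Ioc a (a + mesh M))) := by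
  have h1 : MemLp (f : Torus → ℂ) 2 (volume : Measure Torus) :=
    memLp_haarAddCircle_iff.mp (Lp.memLp f)
  have h2 := h1.comp_measurePreserving (AddCircle.measurePreserving_mk (2 * π) a)
  exact h2.mono_measure (Measure.restrict_mono
    (Set.Ioc_subset_Ioc_right (by linarith [mesh_le_two_pi (M := M)])) le_rfl)

theorem integrable_restrict_torus (f : L2Torus) (a : ℝ) :
    Integrable (fun y : ℝ => f (y : Torus)) (volume.restrict (Set.Ioc a (a + mesh M))) :=
  (memLp_restrict_torus f a).integrable one_le_two

theorem discretize_apply (f : L2Torus) (j : ZMod (2 * M)) :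
    discretize M f j = ((1 / mesh M : ℝ) : ℂ) *
      ∫ y in Set.Ioc (mesh M * (j.valMinAbs : ℝ)) (mesh M * (j.valMinAbs : ℝ) + mesh M),
        f (y : Torus) := by
  rw [discretize, intervalIntegral.integral_of_le (by linarith [mesh_pos M])]

theorem discretize_sub (f g : L2Torus) : discretize M (f - g) = discretize M f - discretize M g := by
  funext j
  rw [Pi.sub_apply, discretize_apply, discretize_apply, discretize_apply, ← mul_sub,
    ← integral_sub (integrable_restrict_torus f _) (integrable_restrict_torus g _)]
  congr 1
  refine integral_congr_ae ?_
  filter_upwards [ae_restrict_of_ae_torus (M := M) (Lp.coeFn_sub f g) _] with y hy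
  rw [hy, Pi.sub_apply]

theorem sum_lintegral_le (φ : Torus → ℝ≥0∞) :
    ∑ j : ZMod (2 * M), ∫⁻ y in Set.Ioc (mesh M * (j.valMinAbs : ℝ))
      (mesh M * (j.valMinAbs : ℝ) + mesh M), φ (y : Torus) ≤ ∫⁻ x, φ x := by
  have hm := mesh_pos M
  -- The representatives fill $(-M,M]$, so the cells lie in $(-\pi+h,\pi+h]$; hence this fundamental
  -- domain.
  rw [← lintegral_biUnion_finset (s := Finset.univ) ?_ (fun _ _ => measurableSet_Ioc),
    ← AddCircle.lintegral_preimage (2 * π) (-π + mesh M)]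
  · refine lintegral_mono_set (Set.iUnion₂_subset fun j _ => Set.Ioc_subset_Ioc ?_ ?_)
    · have h := (ZMod.valMinAbs_mem_Ioc j).1
      have h1 : -(M : ℤ) + 1 ≤ j.valMinAbs := by push_cast at h; linarith
      have h2 : -(M : ℝ) + 1 ≤ j.valMinAbs := by exact_mod_cast h1
      rw [← mesh_mul M]; nlinarith
    · have h := (ZMod.valMinAbs_mem_Ioc j).2
      have h1 : j.valMinAbs ≤ (M : ℤ) := by push_cast at h; linarith
      have h2 : (j.valMinAbs : ℝ) ≤ M := by exact_mod_cast h1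
      rw [← mesh_mul M]; nlinarith
  · have key : ∀ i j : ZMod (2 * M), i.valMinAbs < j.valMinAbs →
        Disjoint (Set.Ioc (mesh M * (i.valMinAbs : ℝ)) (mesh M * (i.valMinAbs : ℝ) + mesh M))
          (Set.Ioc (mesh M * (j.valMinAbs : ℝ)) (mesh M * (j.valMinAbs : ℝ) + mesh M)) := by
      intro i j hij
      have h1 : (i.valMinAbs : ℝ) + 1 ≤ j.valMinAbs := by exact_mod_cast hij
      refine Set.disjoint_left.mpr fun x hx hy => ?_
      have := hx.2
      have := hy.1
      nlinarith
    intro i _ j _ hij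
    rcases lt_or_gt_of_ne (fun h => hij (ZMod.injective_valMinAbs h)) with h | h
    · exact key i j h
    · exact (key j i h).symm

theorem enorm_sq_integral_le (f : L2Torus) (a : ℝ) :
    ‖∫ y in Set.Ioc a (a + mesh M), f (y : Torus)‖ₑ ^ 2 ≤
      ENNReal.ofReal (mesh M) * ∫⁻ y in Set.Ioc a (a + mesh M), ‖f (y : Torus)‖ₑ ^ 2 := by
  set ν := volume.restrict (Set.Ioc a (a + mesh M))
  have h1 := enorm_integral_le_lintegral_enorm (μ := ν) fun y : ℝ => f (y : Torus)
  rw [← eLpNorm_one_eq_lintegral_enorm] at h1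
  have h2 := h1.trans (eLpNorm_le_eLpNorm_mul_rpow_measure_univ one_le_two
    (memLp_restrict_torus f a).aestronglyMeasurable)
  have h3 : ν Set.univ = ENNReal.ofReal (mesh M) := by
    rw [Measure.restrict_apply_univ, Real.volume_Ioc, add_sub_cancel_left]
  have h4 := pow_le_pow_left₀ zero_le h2 2
  refine h4.trans (le_of_eq ?_)
  rw [mul_pow, h3, mul_comm, ← ENNReal.rpow_natCast, ← ENNReal.rpow_mul,
    eLpNorm_eq_lintegral_rpow_enorm_toReal two_ne_zero ENNReal.ofNat_ne_top,
    ← ENNReal.rpow_natCast (_ ^ _) 2, ← ENNReal.rpow_mul]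
  norm_num

/-- Averaging is an $L^2$ contraction, by Cauchy–Schwarz on each cell. -/
theorem sum_norm_sq_dcoeff_discretize_le (f : L2Torus) :
    ∑ k, ‖dcoeff M k (discretize M f)‖ ^ 2 ≤ ‖f‖ ^ 2 := by
  have hm := mesh_pos M
  have hM : (0 : ℝ) < 2 * M := by
    have := Nat.pos_of_ne_zero (NeZero.ne M); positivity
  have key : ∑ j, ‖discretize M f j‖ₑ ^ 2 ≤
      ENNReal.ofReal (1 / mesh M) * (ENNReal.ofReal (2 * π) * ENNReal.ofReal (‖f‖ ^ 2)) := by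
    have h1 : ∀ j, ‖discretize M f j‖ₑ ^ 2 ≤ ENNReal.ofReal (1 / mesh M) *
        ∫⁻ y in Set.Ioc (mesh M * (j.valMinAbs : ℝ)) (mesh M * (j.valMinAbs : ℝ) + mesh M),
          ‖f (y : Torus)‖ₑ ^ 2 := by
      intro j
      rw [discretize_apply, enorm_mul, mul_pow]
      refine (mul_le_mul_right (enorm_sq_integral_le (M := M) f _) _).trans_eq ?_
      rw [← mul_assoc]
      congr 1
      rw [← ofReal_norm, Complex.norm_real, Real.norm_of_nonneg (by positivity),
        ← ENNReal.ofReal_pow (by positivity), ← ENNReal.ofReal_mul (by positivity)]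
      congr 1
      field_simp
    refine (Finset.sum_le_sum fun j _ => h1 j).trans ?_
    rw [← Finset.mul_sum]
    refine mul_le_mul_right ((sum_lintegral_le (M := M) fun x => ‖f x‖ₑ ^ 2).trans_eq ?_) _
    rw [AddCircle.volume_eq_smul_haarAddCircle, lintegral_smul_measure, smul_eq_mul]
    congr 1
    rw [ENNReal.ofReal_pow (norm_nonneg _), ofReal_norm, Lp.enorm_def,
      eLpNorm_eq_lintegral_rpow_enorm_toReal two_ne_zero ENNReal.ofNat_ne_top,
      ← ENNReal.rpow_natCast (_ ^ _) 2, ← ENNReal.rpow_mul]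
    norm_num
  have h2 : ∑ j, ‖discretize M f j‖ₑ ^ 2 = ENNReal.ofReal (∑ j, ‖discretize M f j‖ ^ 2) := by
    rw [ENNReal.ofReal_sum_of_nonneg fun _ _ => sq_nonneg _]
    exact Finset.sum_congr rfl fun j _ => by rw [ENNReal.ofReal_pow (norm_nonneg _), ofReal_norm]
  rw [h2, ← ENNReal.ofReal_mul (by positivity), ← ENNReal.ofReal_mul (by positivity),
    ENNReal.ofReal_le_ofReal_iff (by positivity)] at key
  rw [sum_norm_sq_dcoeff, inv_mul_le_iff₀ hM]
  refine key.trans_eq ?_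
  have hpi := mesh_mul M
  generalize ‖f‖ = n
  rw [← hpi]
  field_simp

/-- The average of `e^{iky}` over `[0, h]`. -/
def avgSymbol (M : ℕ) (k : ℤ) : ℂ :=
  ((1 / mesh M : ℝ) : ℂ) * ∫ y in (0 : ℝ)..mesh M, Complex.exp (Complex.I * ((k * y : ℝ) : ℂ))

theorem norm_avgSymbol_sub_one_le {k : ℤ} {C : ℝ}
    (h : ∀ y : ℝ, 0 ≤ y → y ≤ mesh M → ‖Complex.exp (Complex.I * ((k * y : ℝ) : ℂ)) - 1‖ ≤ C) :
    ‖avgSymbol M k - 1‖ ≤ C := by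
  have hm := mesh_pos M
  have hmc : (mesh M : ℂ) ≠ 0 := by exact_mod_cast hm.ne'
  have h1 : avgSymbol M k - 1 = ((1 / mesh M : ℝ) : ℂ) *
      ∫ y in (0 : ℝ)..mesh M, (Complex.exp (Complex.I * ((k * y : ℝ) : ℂ)) - 1) := by
    rw [intervalIntegral.integral_sub
      (Continuous.intervalIntegrable (by fun_prop) _ _) (by simp), avgSymbol, mul_sub]
    congr 1
    simp only [intervalIntegral.integral_const, sub_zero]
    rw [Complex.real_smul]
    push_cast
    field_simp
  have h2 := intervalIntegral.norm_integral_le_of_norm_le_const (a := 0) (b := mesh M)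
    (f := fun y : ℝ => Complex.exp (Complex.I * ((k * y : ℝ) : ℂ)) - 1) (C := C) fun y hy => by
      rw [Set.uIoc_of_le hm.le] at hy
      exact h y hy.1.le hy.2
  rw [h1, norm_mul, Complex.norm_real, Real.norm_of_nonneg (by positivity)]
  rw [sub_zero, abs_of_pos hm] at h2
  calc 1 / mesh M * _ ≤ 1 / mesh M * (C * mesh M) := by gcongr
    _ = C := by field_simp

theorem norm_avgSymbol_le_one (k : ℤ) : ‖avgSymbol M k‖ ≤ 1 := by
  have hm := mesh_pos M
  have h2 := intervalIntegral.norm_integral_le_of_norm_le_const (a := 0) (b := mesh M)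
    (f := fun y : ℝ => Complex.exp (Complex.I * ((k * y : ℝ) : ℂ))) (C := 1) fun y hy => by
      rw [mul_comm, Complex.norm_exp_ofReal_mul_I]
  rw [avgSymbol, norm_mul, Complex.norm_real, Real.norm_of_nonneg (by positivity)]
  rw [sub_zero, abs_of_pos hm] at h2
  calc 1 / mesh M * _ ≤ 1 / mesh M * (1 * mesh M) := by gcongr
    _ = 1 := by field_simp

theorem norm_sq_avgSymbol_sub_one_le {α : ℝ} (hα0 : 0 ≤ α) (hα2 : α ≤ 2) (k : ℤ) :
    ‖avgSymbol M k - 1‖ ^ 2 ≤ 4 * mesh M ^ α * weight α k := by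
  have h0 : 0 ≤ 4 * mesh M ^ α * weight α k := by
    have := Real.rpow_nonneg (mesh_pos M).le α
    have := weight_pos α k
    positivity
  have h1 := norm_avgSymbol_sub_one_le (M := M) (k := k) (C := √(4 * mesh M ^ α * weight α k))
    fun y hy0 hy => Real.le_sqrt_of_sq_le (norm_sq_exp_sub_one_le hα0 hα2 hy0 hy k)
  calc _ ≤ (√(4 * mesh M ^ α * weight α k)) ^ 2 := pow_le_pow_left₀ (norm_nonneg _) h1 2
    _ = _ := Real.sq_sqrt h0

/-- For frequencies in $(-M,M]$ there is no aliasing, and $d_h$ acts as a Fourier multiplier. -/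
theorem dcoeff_discretize_trigPoly (c : ZMod (2 * M) → ℂ) (k : ZMod (2 * M)) :
    dcoeff M k (discretize M (trigPoly c)) = c k * avgSymbol M k.valMinAbs := by
  refine dcoeff_eq_of_forall_eq_sum (b := fun k => c k * avgSymbol M k.valMinAbs) (fun j => ?_) k
  set a := mesh M * (j.valMinAbs : ℝ) with ha
  have h1 : ∫ y in Set.Ioc a (a + mesh M), trigPoly c (y : Torus) =
      ∫ y in Set.Ioc a (a + mesh M), trigFun c (y : Torus) :=
    integral_congr_ae (ae_restrict_of_ae_torus (M := M) (coeFn_trigPoly c) a)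
  have h2 : ∀ y : ℝ, trigFun c ((y + a : ℝ) : Torus) =
      ∑ k : ZMod (2 * M), c k * ZMod.stdAddChar (j * k) *
        Complex.exp (Complex.I * ((k.valMinAbs * y : ℝ) : ℂ)) := by
    intro y
    rw [trigFun]
    refine Finset.sum_congr rfl fun k _ => ?_
    have h3 := stdAddChar_intCast_mul j.valMinAbs k
    rw [ZMod.coe_valMinAbs] at h3
    rw [fourier_coe, h3, mul_assoc, ← Complex.exp_add, ← mul_add, ← Complex.ofReal_add, mul_add,
      add_comm]
  rw [discretize_apply, h1, ← intervalIntegral.integral_of_le (by linarith [mesh_pos M])]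
  have h4 := intervalIntegral.integral_comp_add_right (a := 0) (b := mesh M)
    (fun y : ℝ => trigFun c (y : Torus)) a
  rw [zero_add, add_comm (mesh M)] at h4
  rw [← h4]
  simp only [h2]
  rw [intervalIntegral.integral_finsetSum fun k _ =>
    Continuous.intervalIntegrable (by fun_prop) _ _, Finset.mul_sum]
  refine Finset.sum_congr rfl fun k _ => ?_
  rw [intervalIntegral.integral_const_mul, avgSymbol]
  ring

/-- The truncated Fourier series of `f` with frequencies in `(-M, M]`. -/
def fourierTrunc (M : ℕ) [NeZero M] (f : L2Torus) : L2Torus :=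
  trigPoly fun k : ZMod (2 * M) => coeff k.valMinAbs f

theorem coeff_sub_fourierTrunc (f : L2Torus) (l : ℤ) :
    coeff l (f - fourierTrunc M f) = 0 ∨
      coeff l (f - fourierTrunc M f) = coeff l f ∧ (M : ℝ) ≤ |(l : ℝ)| := by
  rw [map_sub, fourierTrunc]
  by_cases h : ∃ k : ZMod (2 * M), k.valMinAbs = l
  · obtain ⟨k, rfl⟩ := h
    left
    rw [coeff_valMinAbs_trigPoly, sub_self]
  · push Not at h
    right
    refine ⟨by rw [coeff_trigPoly_of_notMem _ h, sub_zero], ?_⟩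
    by_contra hl
    push Not at hl
    refine h (l : ZMod (2 * M)) ((ZMod.valMinAbs_spec _ _).mpr ⟨rfl, ?_⟩)
    have h1 : |l| < (M : ℤ) := by exact_mod_cast hl
    have h2 := abs_lt.mp h1
    constructor <;> push_cast <;> linarith

omit [NeZero M] in
theorem rpow_le_weight_of_le {α : ℝ} (hα0 : 0 ≤ α) {l : ℤ} (h : (M : ℝ) ≤ |(l : ℝ)|) :
    (M : ℝ) ^ α ≤ weight α l :=
  (Real.rpow_le_rpow (by positivity) h hα0).trans (abs_rpow_le_weight hα0 l)

theorem norm_sq_sub_fourierTrunc_le {α A : ℝ} (hα0 : 0 ≤ α) {f : L2Torus} (hf : SobLE α A f) :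
    (M : ℝ) ^ α * ‖f - fourierTrunc M f‖ ^ 2 ≤ A ^ 2 := by
  refine hasSum_le_of_sum_le ((hasSum_sq_coeff (f - fourierTrunc M f)).mul_left _) fun s =>
    le_trans (Finset.sum_le_sum fun l _ => ?_) (hf.sum_le s)
  rcases coeff_sub_fourierTrunc (M := M) f l with h | ⟨h, hl⟩
  · rw [h]
    have := weight_pos α l
    simpa using mul_nonneg this.le (sq_nonneg ‖coeff l f‖)
  · rw [h]
    exact mul_le_mul_of_nonneg_right (rpow_le_weight_of_le hα0 hl) (sq_nonneg _)

theorem sum_weight_mul_coeff_le {α A : ℝ} {f : L2Torus} (hf : SobLE α A f) :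
    ∑ k : ZMod (2 * M), weight α k.valMinAbs * ‖coeff k.valMinAbs f‖ ^ 2 ≤ A ^ 2 := by
  have h := hf.sum_le
    (Finset.univ.map ⟨fun k : ZMod (2 * M) => k.valMinAbs, ZMod.injective_valMinAbs⟩)
  simpa [Finset.sum_map] using h

theorem mesh_rpow_ge {α : ℝ} (hα0 : 0 ≤ α) : 1 ≤ (M : ℝ) ^ α * mesh M ^ α := by
  rw [← Real.mul_rpow (by positivity) (mesh_pos M).le, mul_comm, mesh_mul]
  exact Real.one_le_rpow (by linarith [Real.pi_gt_three]) hα0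

/-- On frequencies in $(-M,M]$ the multiplier has modulus at most one. The rest has squared $L^2$
norm at most $M^{-\alpha}A^2$, $d_h$ contracts it, and discrete weights are at most $2M^\alpha$.
Together this gives $2A^2+4A^2\le(3A)^2$. -/
theorem SobLE.dSobLE_discretize {α A : ℝ} (hα0 : 0 ≤ α) (hα2 : α ≤ 2) {f : L2Torus}
    (hf : SobLE α A f) : DSobLE α (3 * A) (discretize M f) := by
  have hM1 : (1 : ℝ) ≤ M := by exact_mod_cast Nat.pos_of_ne_zero (NeZero.ne M)
  refine ⟨mul_nonneg (by norm_num) hf.nonneg, ?_⟩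
  set P := fourierTrunc M f with hP
  have hsplit : discretize M f =
      discretize M P + discretize M (f - P) := by
    rw [discretize_sub]; abel
  have h1 : ∑ k : ZMod (2 * M), weight α k.valMinAbs *
      ‖dcoeff M k (discretize M P)‖ ^ 2 ≤ A ^ 2 := by
    refine le_trans (Finset.sum_le_sum fun k _ => ?_) (sum_weight_mul_coeff_le (M := M) hf)
    rw [hP, fourierTrunc, dcoeff_discretize_trigPoly, norm_mul]
    refine mul_le_mul_of_nonneg_left (pow_le_pow_left₀ (by positivity) ?_ 2) (weight_pos _ _).le
    exact mul_le_of_le_one_right (norm_nonneg _) (norm_avgSymbol_le_one _)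
  have hw : ∀ k : ZMod (2 * M), weight α k.valMinAbs ≤ 2 * (M : ℝ) ^ α := by
    intro k
    have h2 : 1 + (k.valMinAbs : ℝ) ^ 2 ≤ 2 * (M : ℝ) ^ 2 := by
      have := pow_le_pow_left₀ (abs_nonneg _) (abs_valMinAbs_le k) 2
      rw [sq_abs] at this; nlinarith
    have h4 : (2 : ℝ) ^ (α / 2) ≤ 2 := by
      simpa using Real.rpow_le_rpow_of_exponent_le (by norm_num : (1 : ℝ) ≤ 2)
        (by linarith : α / 2 ≤ 1)
    calc weight α k.valMinAbs ≤ (2 * (M : ℝ) ^ 2) ^ (α / 2) :=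
          Real.rpow_le_rpow (by positivity) h2 (by linarith)
      _ = 2 ^ (α / 2) * (M : ℝ) ^ α := by
          rw [Real.mul_rpow (by norm_num) (by positivity), ← Real.rpow_natCast (M : ℝ) 2,
            ← Real.rpow_mul (by positivity)]
          congr 2; push_cast; ring
      _ ≤ _ := by gcongr
  have h2 : ∑ k : ZMod (2 * M), weight α k.valMinAbs *
      ‖dcoeff M k (discretize M (f - P))‖ ^ 2 ≤ 2 * A ^ 2 := by
    calc _ ≤ ∑ k : ZMod (2 * M), 2 * (M : ℝ) ^ α * ‖dcoeff M k (discretize M (f - P))‖ ^ 2 :=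
          Finset.sum_le_sum fun k _ => mul_le_mul_of_nonneg_right (hw k) (sq_nonneg _)
      _ ≤ 2 * (M : ℝ) ^ α * ‖f - P‖ ^ 2 := by
          rw [← Finset.mul_sum]
          exact mul_le_mul_of_nonneg_left (sum_norm_sq_dcoeff_discretize_le _) (by positivity)
      _ ≤ _ := by
          rw [mul_assoc]
          exact mul_le_mul_of_nonneg_left (norm_sq_sub_fourierTrunc_le hα0 hf) zero_le_two
  calc _ ≤ ∑ k : ZMod (2 * M), (2 * (weight α k.valMinAbs *
          ‖dcoeff M k (discretize M P)‖ ^ 2) + 2 * (weight α k.valMinAbs *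
          ‖dcoeff M k (discretize M (f - P))‖ ^ 2)) := by
        refine Finset.sum_le_sum fun k _ => ?_
        rw [hsplit, map_add]
        set a := dcoeff M k (discretize M P)
        set b := dcoeff M k (discretize M (f - P))
        have h3 := pow_le_pow_left₀ (norm_nonneg _) (norm_add_le a b) 2
        have h4 : ‖a + b‖ ^ 2 ≤ 2 * ‖a‖ ^ 2 + 2 * ‖b‖ ^ 2 := by
          nlinarith [sq_nonneg (‖a‖ - ‖b‖)]
        have := mul_le_mul_of_nonneg_left h4 (weight_pos α k.valMinAbs).le
        linarith
    _ ≤ _ := by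
        rw [Finset.sum_add_distrib, ← Finset.mul_sum, ← Finset.mul_sum]
        nlinarith [sq_nonneg A]

/-- The frequencies outside $(-M,M]$ cost $Ah^{\alpha/2}$ twice, before and after discretization; on
the others the multiplier is close to one, at a cost of $2Ah^{\alpha/2}$. -/
theorem norm_trigInterp_discretize_sub_le {α A : ℝ} (hα0 : 0 ≤ α) (hα2 : α ≤ 2) {f : L2Torus}
    (hf : SobLE α A f) : ‖trigInterp M (discretize M f) - f‖ ≤ 4 * A * mesh M ^ (α / 2) := by
  have hm := mesh_pos M
  have hA := hf.nonneg
  have hp : (mesh M ^ (α / 2)) ^ 2 = mesh M ^ α := by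
    rw [← Real.rpow_natCast, ← Real.rpow_mul hm.le]; congr 1; push_cast; ring
  set P := fourierTrunc M f with hP
  have h0 : ‖f - P‖ ≤ A * mesh M ^ (α / 2) := by
    refine le_of_sq_le_sq ?_ (by positivity)
    rw [mul_pow, hp]
    have h1 := norm_sq_sub_fourierTrunc_le (M := M) hα0 hf
    have h2 := mesh_rpow_ge (M := M) hα0
    have h3 : 0 ≤ mesh M ^ α := by positivity
    calc ‖f - P‖ ^ 2 ≤ ((M : ℝ) ^ α * mesh M ^ α) * ‖f - P‖ ^ 2 :=
          le_mul_of_one_le_left (sq_nonneg _) h2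
      _ = ((M : ℝ) ^ α * ‖f - P‖ ^ 2) * mesh M ^ α := by ring
      _ ≤ _ := mul_le_mul_of_nonneg_right h1 h3
  have h1 : ‖trigInterp M (discretize M (f - P))‖ ≤ A * mesh M ^ (α / 2) := by
    refine le_trans (le_of_sq_le_sq ?_ (norm_nonneg _)) h0
    rw [norm_sq_trigInterp]
    exact sum_norm_sq_dcoeff_discretize_le _
  have h2 : ‖trigInterp M (discretize M P) - P‖ ≤ 2 * A * mesh M ^ (α / 2) := by
    refine le_of_sq_le_sq ?_ (by positivity)
    rw [trigInterp_apply, hP, fourierTrunc, trigPoly_sub, norm_sq_trigPoly, mul_pow, hp]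
    calc _ ≤ ∑ k : ZMod (2 * M), 4 * mesh M ^ α *
            (weight α k.valMinAbs * ‖coeff k.valMinAbs f‖ ^ 2) := by
          refine Finset.sum_le_sum fun k _ => ?_
          rw [Pi.sub_apply, dcoeff_discretize_trigPoly, ← mul_sub_one, norm_mul, mul_pow]
          have := mul_le_mul_of_nonneg_left (norm_sq_avgSymbol_sub_one_le (M := M) hα0 hα2
            k.valMinAbs) (sq_nonneg ‖coeff k.valMinAbs f‖)
          linarith
      _ ≤ _ := by
          rw [← Finset.mul_sum]
          have h3 : 0 ≤ mesh M ^ α := by positivity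
          nlinarith [mul_le_mul_of_nonneg_left (sum_weight_mul_coeff_le (M := M) hf) h3]
  have e : trigInterp M (discretize M f) - f = trigInterp M (discretize M (f - P)) +
      (trigInterp M (discretize M P) - P) - (f - P) := by
    rw [discretize_sub, map_sub]; abel
  rw [e]
  refine (norm_sub_le _ _).trans ?_
  have := norm_add_le (trigInterp M (discretize M (f - P))) (trigInterp M (discretize M P) - P)
  linarith

end Discretization

/-! ### The continuum equation: well-posedness and convergence of the discrete solutions -/

section Convergence

open scoped NNReal

theorem isSolution_iff {α μ : ℝ} {f : L2Torus} {u : ℝ → L2Torus} : IsSolution α μ f u ↔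
    (∀ t, sobolevNorm (α / 2) (u t) < ∞) ∧
    (∀ t₀, Tendsto (fun t => sobolevNorm (α / 2) (u t - u t₀)) (𝓝 t₀) (𝓝 0)) ∧
    ∀ t, u t = freeOp α t f - (Complex.I * (μ : ℂ)) •
        ∫ τ in (0 : ℝ)..t, freeOp α (t - τ) (cubic (u τ)) :=
  ⟨fun h => ⟨h.1, h.2, h.3⟩, fun h => ⟨h.1, h.2.1, h.2.2⟩⟩

/-- Besides removing the truncation, this upgrades continuity from $L^2$ to $H^{\alpha/2}$: the
increment of `u` is a Duhamel integral over a short interval, small by the bound `A''` on the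
nonlinearity, plus a free evolution of fixed data. -/
theorem isSolution_of_duhamel_cubicTrunc {α μ A' A'' : ℝ} {B : ℝ≥0} {f : L2Torus}
    {u : ℝ → L2Torus} (hα : 1 < α) (hu : Continuous u)
    (hd : ∀ t, u t = freeOp α t f - (Complex.I * (μ : ℂ)) •
        ∫ τ in (0 : ℝ)..t, freeOp α (t - τ) (cubicTrunc B (u τ)))
    (hA' : ∀ t, SobLE α A' (u t)) (hA'' : ∀ t, SobLE α A'' (cubicTrunc B (u t)))
    (hB : √(weightSum α 0) * A' ≤ B) : IsSolution α μ f u := by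
  have hU := isBoundedGroup_freeOp α
  have hG : Continuous fun t => cubicTrunc B (u t) := (lipschitzWith_cubicTrunc B).continuous.comp hu
  refine isSolution_iff.mpr ⟨fun t => (hA' t).sobolevNorm_lt_top, fun t₀ => ?_, fun t => ?_⟩
  · rw [tendsto_sobolevNorm_zero_iff]
    intro ε hε
    have hUG : Continuous fun τ => freeOp α (-τ) (cubicTrunc B (u τ)) :=
      hU.continuous_comp continuous_neg hG
    set z := freeOp α (-t₀) (u t₀) with hz
    have hzS : SobLE α A' z := (hA' t₀).freeOp _
    set c : ℂ := Complex.I * (μ : ℂ) with hc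
    have h1 : ∀ t, u t - u t₀ = freeOp α t ((-c) • ∫ τ in t₀..t,
        freeOp α (-τ) (cubicTrunc B (u τ))) + (freeOp α t z - freeOp α t₀ z) := by
      intro t
      have e1 := hU.eq_of_duhamel hG (hd t)
      have e2 := hU.eq_of_duhamel hG (hd t₀)
      have e3 : (-c) • ∫ τ in t₀..t, freeOp α (-τ) (cubicTrunc B (u τ)) =
          freeOp α (-t) (u t) - z := by
        rw [hz, e1, e2, ← intervalIntegral.integral_interval_sub_left
          (hUG.intervalIntegrable 0 t) (hUG.intervalIntegrable 0 t₀)]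
        rw [neg_smul, smul_sub]
        abel
      rw [e3, map_sub, hU.apply_neg, hz, hU.apply_neg]
      abel
    have h2 : ∀ᶠ t in 𝓝 t₀, ‖-c‖ * (A'' * |t - t₀|) < ε / 2 := by
      have : Tendsto (fun t => ‖-c‖ * (A'' * |t - t₀|)) (𝓝 t₀) (𝓝 (‖-c‖ * (A'' * |t₀ - t₀|))) :=
        Continuous.tendsto (by fun_prop) t₀
      rw [sub_self, abs_zero, mul_zero, mul_zero] at this
      exact this.eventually_lt_const (by linarith)
    have h3 := (tendsto_tsum_freeSymbol_sub α (fun k => (weight_pos α k).le) z hzS.summable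
      t₀).eventually_le_const (show (0 : ℝ) < (ε / 2) ^ 2 by positivity)
    filter_upwards [h2, h3] with t ht2 ht3
    rw [h1 t, ← add_halves ε]
    refine SobLE.add ?_ ?_
    · exact ((SobLE.intervalIntegral hUG fun τ => (hA'' τ).freeOp _).smul _).freeOp t |>.mono ht2.le
    · exact SobLE.of_tsum_le (by linarith) ((hzS.freeOp t).sub (hzS.freeOp t₀)).summable ht3
  · have he : ∀ τ, cubicTrunc B (u τ) = cubic (u τ) := fun τ => cubicTrunc_eq_cubic <| by
      filter_upwards [(hA' τ).ae_norm_le hα] with x hx using hx.trans hB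
    simp only [he] at hd
    exact hd t

namespace IsSolution

variable {α μ : ℝ} {f : L2Torus} {u v : ℝ → L2Torus}

theorem continuous (hα : 0 ≤ α) (h : IsSolution α μ f u) : Continuous u := by
  rw [continuous_iff_continuousAt]
  intro t₀
  rw [ContinuousAt, Metric.tendsto_nhds]
  intro ε hε
  filter_upwards [tendsto_sobolevNorm_zero_iff.mp (h.continuous_sobolev t₀) (ε / 2)
    (by linarith)] with t ht
  rw [dist_eq_norm]
  exact (ht.norm_le hα).trans_lt (by linarith)

theorem exists_sobLE_Icc (h : IsSolution α μ f u) (a b : ℝ) :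
    ∃ A, ∀ t ∈ Set.Icc a b, SobLE α A (u t) := by
  refine isCompact_Icc.induction_on (p := fun s => ∃ A, ∀ t ∈ s, SobLE α A (u t)) ⟨0, by simp⟩
    (fun s t hst ⟨A, hA⟩ => ⟨A, fun x hx => hA x (hst hx)⟩)
    (fun s t ⟨A, hA⟩ ⟨A', hA'⟩ => ⟨max A A', fun x hx => ?_⟩) fun t₀ _ => ?_
  · rcases hx with hx | hx
    · exact (hA x hx).mono (le_max_left _ _)
    · exact (hA' x hx).mono (le_max_right _ _)
  · obtain ⟨A, hA⟩ := exists_sobLE_of_sobolevNorm_lt_top (h.sobolevNorm_lt_top t₀)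
    refine ⟨_, mem_nhdsWithin_of_mem_nhds
      (tendsto_sobolevNorm_zero_iff.mp (h.continuous_sobolev t₀) 1 one_pos), 1 + A, fun t ht => ?_⟩
    simpa using SobLE.add (Set.mem_ofPred.mp ht) hA

/-- On a compact time interval two solutions are bounded in $H^{\alpha/2}$, hence in sup norm, so
both solve the equation with one common truncation. -/
theorem unique (hα : 1 < α) (hu : IsSolution α μ f u) (hv : IsSolution α μ f v) : u = v := by
  funext t
  obtain ⟨C, hC⟩ := hu.exists_sobLE_Icc (-|t|) |t|
  obtain ⟨D, hD⟩ := hv.exists_sobLE_Icc (-|t|) |t|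
  set B : ℝ≥0 := (√(weightSum α 0) * max C D).toNNReal with hB
  have key : ∀ w : ℝ → L2Torus, (∀ s ∈ Set.Icc (-|t|) |t|, SobLE α (max C D) (w s)) →
      (∀ t, w t = freeOp α t f - (Complex.I * (μ : ℂ)) •
        ∫ τ in (0 : ℝ)..t, freeOp α (t - τ) (cubic (w τ))) →
      ∀ s, |s| ≤ |t| → w s = freeOp α s f - (Complex.I * (μ : ℂ)) •
        ∫ τ in (0 : ℝ)..s, freeOp α (s - τ) (cubicTrunc B (w τ)) := by
    intro w hw hs s hst
    nth_rw 1 [hs s]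
    congr 2
    refine intervalIntegral.integral_congr fun τ hτ => ?_
    have hτ' : τ ∈ Set.Icc (-|t|) |t| :=
      Set.uIcc_subset_Icc ⟨by simp, by simp⟩ (abs_le.mp hst) hτ
    rw [cubicTrunc_eq_cubic]
    filter_upwards [(hw τ hτ').ae_norm_le hα] with x hx
    exact hx.trans (Real.le_coe_toNNReal _)
  exact (isBoundedGroup_freeOp α).eq_of_duhamel_of_lipschitz (lipschitzWith_cubicTrunc B)
    (hv.continuous (by linarith)) (hu.continuous (by linarith))
    (key v (fun s hs => (hD s hs).mono (le_max_right _ _)) (isSolution_iff.mp hv).2.2)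
    (key u (fun s hs => (hC s hs).mono (le_max_left _ _)) (isSolution_iff.mp hu).2.2) le_rfl

end IsSolution

theorem solutionMap_eq {α μ : ℝ} (hα : 1 < α) {f : L2Torus} {u : ℝ → L2Torus}
    (hu : IsSolution α μ f u) (t : ℝ) : solutionMap α μ t f = u t := by
  have h : ∃ u, IsSolution α μ f u := ⟨u, hu⟩
  rw [solutionMap, dif_pos h, h.choose_spec.unique hα hu]

/-- Since $h$ may exceed one, comparing the two powers costs a constant; as $h\le\pi$, the factor
`4` suffices. -/
theorem mesh_rpow_half_le (M : ℕ) [NeZero M] {α : ℝ} (hα0 : 0 ≤ α) (hα2 : α ≤ 2) :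
    mesh M ^ (α / 2) ≤ 4 * mesh M ^ (α / (2 + α)) := by
  have hm := mesh_pos M
  have h2 : (0 : ℝ) < 2 + α := by linarith
  have h0 : 0 ≤ α / 2 - α / (2 + α) := by
    rw [sub_nonneg]
    exact div_le_div_of_nonneg_left hα0 two_pos (by linarith)
  have h1 : α / 2 - α / (2 + α) ≤ 1 := by
    have : 0 ≤ α / (2 + α) := by positivity
    linarith
  rw [show α / 2 = (α / 2 - α / (2 + α)) + α / (2 + α) by ring, Real.rpow_add hm]
  refine mul_le_mul_of_nonneg_right ?_ (by positivity)
  calc mesh M ^ (α / 2 - α / (2 + α)) ≤ π ^ (α / 2 - α / (2 + α)) :=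
        Real.rpow_le_rpow hm.le (mesh_le_pi M) h0
    _ ≤ π ^ (1 : ℝ) := Real.rpow_le_rpow_of_exponent_le (by linarith [Real.pi_gt_three]) h1
    _ ≤ 4 := by rw [Real.rpow_one]; exact Real.pi_le_four

theorem norm_I_mul_le {μ : ℝ} (hμ : |μ| ≤ 1) : ‖Complex.I * (μ : ℂ)‖ ≤ 1 := by
  rwa [norm_mul, Complex.norm_I, one_mul, Complex.norm_real]

theorem norm_trigInterp_sub_duhamel_le {M : ℕ} [NeZero M] {α μ A A' A'' T t : ℝ} {B : ℝ≥0}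
    {f : L2Torus} {v : ℝ → Lattice M} (hα0 : 0 ≤ α) (hα2 : α ≤ 2) (hμ : |μ| ≤ 1)
    (hf : SobLE α A f) (hv : IsDiscreteSolution α μ M (discretize M f) v)
    (hA' : ∀ t, DSobLE α A' (v t)) (hA'' : ∀ t, DSobLE α A'' (discreteCubic M (v t)))
    (hB : ∀ t j, ‖v t j‖ ≤ B) (ht : |t| ≤ T) :
    ‖trigInterp M (v t) - (freeOp α t f - (Complex.I * (μ : ℂ)) •
        ∫ τ in (0 : ℝ)..t, freeOp α (t - τ) (cubicTrunc B (trigInterp M (v τ))))‖ ≤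
      (6 * (T + 1) * A + 16 * A + (2 * (T + 1) * A'' + 16 * (A'' + 6 * B ^ 2 * A')) * T) *
        mesh M ^ (α / (2 + α)) := by
  have hU := isBoundedGroup_freeOp α
  have hUh := isBoundedGroup_discreteFreeOp (M := M) α
  have hT : 0 ≤ T := (abs_nonneg t).trans ht
  have hA0 := hf.nonneg
  have hA'0 := (hA' 0).1
  have hA''0 := (hA'' 0).1
  have hmp := mesh_rpow_half_le M hα0 hα2
  set p := mesh M ^ (α / (2 + α)) with hp
  have hp0 : 0 ≤ p := Real.rpow_nonneg (mesh_pos M).le _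
  have hc1 : Continuous fun τ => discreteFreeOp α M (t - τ) (discreteCubic M (v τ)) :=
    hUh.continuous_comp (by fun_prop) ((continuous_discreteCubic M).comp hv.continuous)
  have hc2 : Continuous fun τ => freeOp α (t - τ) (cubicTrunc B (trigInterp M (v τ))) :=
    hU.continuous_comp (by fun_prop) ((lipschitzWith_cubicTrunc B).continuous.comp
      ((trigInterp M).continuous.comp hv.continuous))
  have hc3 : Continuous fun τ =>
      trigInterp M (discreteFreeOp α M (t - τ) (discreteCubic M (v τ))) :=
    (trigInterp M).continuous.comp hc1
  -- The defect splits into the symbol error on the data, the discretization error of the data, and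
  -- an integral that collects the symbol error on the cubic term and the aliasing error.
  have e : trigInterp M (v t) - (freeOp α t f - (Complex.I * (μ : ℂ)) •
        ∫ τ in (0 : ℝ)..t, freeOp α (t - τ) (cubicTrunc B (trigInterp M (v τ)))) =
      (trigInterp M (discreteFreeOp α M t (discretize M f)) -
        freeOp α t (trigInterp M (discretize M f))) +
      freeOp α t (trigInterp M (discretize M f) - f) -
      (Complex.I * (μ : ℂ)) • ∫ τ in (0 : ℝ)..t,
        (trigInterp M (discreteFreeOp α M (t - τ) (discreteCubic M (v τ))) -
          freeOp α (t - τ) (cubicTrunc B (trigInterp M (v τ)))) := by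
    rw [intervalIntegral.integral_sub (hc3.intervalIntegrable _ _) (hc2.intervalIntegrable _ _),
      ContinuousLinearMap.intervalIntegral_comp_comm _ (hc1.intervalIntegrable _ _)]
    nth_rw 1 [(isDiscreteSolution_iff.mp hv).2 t]
    rw [map_sub, map_smul, map_sub, smul_sub]
    abel
  have h1 := norm_trigInterp_discreteFreeOp_sub_le hα0 hα2 ht (hf.dSobLE_discretize (M := M) hα0 hα2)
  have h2 : ‖freeOp α t (trigInterp M (discretize M f) - f)‖ ≤ 16 * A * p := by
    rw [norm_freeOp]
    refine (norm_trigInterp_discretize_sub_le hα0 hα2 hf).trans ?_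
    nlinarith
  have h3 : ‖∫ τ in (0 : ℝ)..t,
        (trigInterp M (discreteFreeOp α M (t - τ) (discreteCubic M (v τ))) -
          freeOp α (t - τ) (cubicTrunc B (trigInterp M (v τ))))‖ ≤
      (2 * (T + 1) * A'' + 16 * (A'' + 6 * B ^ 2 * A')) * p * |t - 0| := by
    refine intervalIntegral.norm_integral_le_of_norm_le_const fun τ hτ => ?_
    have hτ' : |t - τ| ≤ T := by
      rcases Set.mem_uIoc.mp hτ with h | h
      · rw [abs_of_nonneg (by linarith)]; linarith [abs_le.mp ht]
      · rw [abs_of_nonpos (by linarith)]; linarith [abs_le.mp ht]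
    have h4 := norm_trigInterp_discreteFreeOp_sub_le hα0 hα2 hτ' (hA'' τ)
    have h5 := norm_trigInterp_discreteCubic_sub_le hα0 hα2 (hA' τ) (hA'' τ) (hB τ)
    rw [← norm_freeOp α (t - τ), map_sub] at h5
    have h6 : 4 * (A'' + 6 * (B : ℝ) ^ 2 * A') * mesh M ^ (α / 2) ≤
        4 * (A'' + 6 * (B : ℝ) ^ 2 * A') * (4 * p) := by gcongr
    refine (norm_sub_le_norm_sub_add_norm_sub _
      (freeOp α (t - τ) (trigInterp M (discreteCubic M (v τ)))) _).trans ?_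
    linarith
  have h7 : (2 * (T + 1) * A'' + 16 * (A'' + 6 * (B : ℝ) ^ 2 * A')) * p * |t - 0| ≤
      (2 * (T + 1) * A'' + 16 * (A'' + 6 * (B : ℝ) ^ 2 * A')) * p * T := by
    rw [sub_zero]; gcongr
  have h8 := norm_smul_le (Complex.I * (μ : ℂ)) (∫ τ in (0 : ℝ)..t,
        (trigInterp M (discreteFreeOp α M (t - τ) (discreteCubic M (v τ))) -
          freeOp α (t - τ) (cubicTrunc B (trigInterp M (v τ)))))
  have h9 := mul_le_of_le_one_left (norm_nonneg (∫ τ in (0 : ℝ)..t,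
        (trigInterp M (discreteFreeOp α M (t - τ) (discreteCubic M (v τ))) -
          freeOp α (t - τ) (cubicTrunc B (trigInterp M (v τ)))))) (norm_I_mul_le hμ)
  rw [e]
  refine (norm_sub_le _ _).trans ((add_le_add (norm_add_le _ _) le_rfl).trans ?_)
  linarith

theorem tendsto_mesh_rpow {p : ℝ} (hp : 0 < p) :
    Tendsto (fun n : ℕ => mesh (n + 1) ^ p) atTop (𝓝 0) := by
  have h1 : Tendsto (fun n : ℕ => mesh (n + 1)) atTop (𝓝 0) :=
    (tendsto_add_atTop_iff_nat (f := mesh) 1).mpr (tendsto_const_div_atTop_nhds_zero_nat π)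
  simpa [Real.zero_rpow hp.ne'] using h1.rpow_const (Or.inr hp.le)

/-- Existence and convergence come together. The truncated equation has a global solution in $L^2$
to which the interpolants converge; their uniform Sobolev bounds pass to the limit and show that the
truncation is inactive. -/
theorem exists_isSolution_and_norm_sub_le {α A T : ℝ} (hα : 1 < α) (hα2 : α ≤ 2) :
    ∃ C A' : ℝ, 0 < C ∧ ∀ (μ : ℝ) (f : L2Torus), |μ| ≤ 1 → SobLE α A f →
      ∃ u, IsSolution α μ f u ∧ ∀ (M : ℕ) [NeZero M] (v : ℝ → Lattice M),
        IsDiscreteSolution α μ M (discretize M f) v → ∀ t, DSobLE α A' (v t) ∧ (|t| ≤ T →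
          ‖trigInterp M (v t) - u t‖ ≤ C * mesh M ^ (α / (2 + α))) := by
  have hα0 : 0 ≤ α := by linarith
  obtain ⟨A', hA'⟩ := exists_dSobLE_of_isDiscreteSolution hα hα2 (3 * A)
  set A'' := 16 * weightSum α 0 * A' ^ 3 with hA''
  set B : ℝ≥0 := (√(weightSum α 0) * A').toNNReal with hB
  have hBle : √(weightSum α 0) * A' ≤ B := Real.le_coe_toNNReal _
  -- The constant is kept as a function of the time horizon because the limit below is taken at
  -- every real time.
  set C : ℝ → ℝ := fun T => (6 * (T + 1) * A + 16 * A +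
    (2 * (T + 1) * A'' + 16 * (A'' + 6 * B ^ 2 * A')) * T) * Real.exp (6 * B ^ 2 * T) with hC
  refine ⟨max (C T) 1, A', by positivity, fun μ f hμ hf => ?_⟩
  obtain ⟨u, huc, hu⟩ := (isBoundedGroup_freeOp α).exists_duhamel (lipschitzWith_cubicTrunc B)
    (norm_cubicTrunc_le B) (Complex.I * μ) f
  have hDS : ∀ (M : ℕ) [NeZero M] (v : ℝ → Lattice M),
      IsDiscreteSolution α μ M (discretize M f) v → ∀ t, DSobLE α A' (v t) :=
    fun M _ v hv => hA' μ M _ v hμ (hf.dSobLE_discretize hα0 hα2) hv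
  have key : ∀ (M : ℕ) [NeZero M] (v : ℝ → Lattice M),
      IsDiscreteSolution α μ M (discretize M f) v → ∀ T t, |t| ≤ T →
        ‖trigInterp M (v t) - u t‖ ≤ C T * mesh M ^ (α / (2 + α)) := by
    intro M _ v hv T t ht
    have h1 := (isBoundedGroup_freeOp α).norm_sub_le_of_approx_duhamel (lipschitzWith_cubicTrunc B)
      huc ((trigInterp M).continuous.comp hv.continuous) (fun t (_ : |t| ≤ T) => hu t)
      (fun t ht => norm_trigInterp_sub_duhamel_le hα0 hα2 hμ hf hv (hDS M v hv)
        (fun t => (hDS M v hv t).discreteCubic hα hα2)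
        (fun t j => ((hDS M v hv t).norm_apply_le hα j).trans hBle) ht) ht
    refine h1.trans ?_
    rw [hC]
    beta_reduce
    rw [mul_right_comm]
    have hT : 0 ≤ T := (abs_nonneg t).trans ht
    have hA0 := hf.nonneg
    have hA'0 := (hDS M v hv 0).1
    have hA''0 : 0 ≤ A'' := ((hDS M v hv 0).discreteCubic hα hα2).1
    refine mul_le_mul_of_nonneg_right (mul_le_mul_of_nonneg_left (Real.exp_le_exp.mpr ?_)
      (by positivity)) (Real.rpow_nonneg (mesh_pos M).le _)
    have h2 : ‖Complex.I * (μ : ℂ)‖ * (1 * ((6 * B ^ 2 : ℝ≥0) : ℝ)) ≤ 6 * B ^ 2 := by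
      rw [one_mul]
      refine (mul_le_of_le_one_left (by positivity) (norm_I_mul_le hμ)).trans_eq ?_
      push_cast; rfl
    calc _ ≤ 6 * (B : ℝ) ^ 2 * |t| := mul_le_mul_of_nonneg_right h2 (abs_nonneg t)
      _ ≤ _ := by gcongr
  choose v hv using fun n : ℕ => exists_isDiscreteSolution (M := n + 1) α μ (discretize (n + 1) f)
  have hlim : ∀ t, Tendsto (fun n => trigInterp (n + 1) (v n t)) atTop (𝓝 (u t)) := by
    intro t
    rw [tendsto_iff_norm_sub_tendsto_zero]
    refine squeeze_zero (fun _ => norm_nonneg _) (fun n => key (n + 1) (v n) (hv n) |t| t le_rfl) ?_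
    simpa using (tendsto_mesh_rpow (show 0 < α / (2 + α) by positivity)).const_mul (C |t|)
  have hS' : ∀ t, SobLE α A' (u t) := fun t =>
    SobLE.of_tendsto (Eventually.of_forall fun n => (hDS _ _ (hv n) t).sobLE_trigInterp) (hlim t)
  -- As the aliasing error tends to zero, `cubicTrunc B (u t)` is the limit of the interpolated
  -- discrete cubic terms, which are bounded by the algebra property. No algebra property on the
  -- torus is needed.
  have hS'' : ∀ t, SobLE α A'' (cubicTrunc B (u t)) := by
    intro t
    have hD := fun n => hDS _ _ (hv n) t
    refine SobLE.of_tendsto (l := atTop) (Eventually.of_forall fun n : ℕ =>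
      ((hD n).discreteCubic hα hα2).sobLE_trigInterp) ?_
    have h1 : Tendsto (fun n => cubicTrunc B (trigInterp (n + 1) (v n t))) atTop
        (𝓝 (cubicTrunc B (u t))) :=
      ((lipschitzWith_cubicTrunc B).continuous.tendsto _).comp (hlim t)
    have h2 : Tendsto (fun n => trigInterp (n + 1) (discreteCubic (n + 1) (v n t)) -
        cubicTrunc B (trigInterp (n + 1) (v n t))) atTop (𝓝 0) := by
      refine squeeze_zero_norm (fun n => norm_trigInterp_discreteCubic_sub_le hα0 hα2 (hD n)
        ((hD n).discreteCubic hα hα2) fun j => ((hD n).norm_apply_le hα j).trans hBle) ?_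
      simpa using (tendsto_mesh_rpow (show 0 < α / 2 by positivity)).const_mul
        (4 * (A'' + 6 * (B : ℝ) ^ 2 * A'))
    simpa using h2.add h1
  refine ⟨u, isSolution_of_duhamel_cubicTrunc hα huc hu hS' hS'' hBle, fun M _ v hv t =>
    ⟨hDS M v hv t, fun ht => (key M v hv T t ht).trans ?_⟩⟩
  exact mul_le_mul_of_nonneg_right (le_max_left _ _) (Real.rpow_nonneg (mesh_pos M).le _)

theorem existsUnique_isSolution {α μ : ℝ} (hα : 1 < α) (hα2 : α ≤ 2) (hμ : |μ| ≤ 1) {f : L2Torus}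
    (hf : sobolevNorm (α / 2) f < ∞) : ∃! u, IsSolution α μ f u := by
  obtain ⟨A, hA⟩ := exists_sobLE_of_sobolevNorm_lt_top hf
  obtain ⟨C, A', -, h⟩ := exists_isSolution_and_norm_sub_le (A := A) (T := 0) hα hα2
  obtain ⟨u, hu, -⟩ := h μ f hμ hA
  exact ⟨u, hu, fun v hv => hv.unique hα hu⟩

theorem l2Norm_eq (F : Torus → ℂ) : l2Norm F =
    ENNReal.ofReal (√(2 * π)) * eLpNorm F 2 (AddCircle.haarAddCircle (T := 2 * π)) := by
  rw [l2Norm, AddCircle.volume_eq_smul_haarAddCircle,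
    eLpNorm_smul_measure_of_ne_top ENNReal.ofNat_ne_top, smul_eq_mul, Real.sqrt_eq_rpow,
    ← ENNReal.ofReal_rpow_of_pos Real.two_pi_pos]
  norm_num

theorem eLpNorm_interpolate_sub_le {M : ℕ} [NeZero M] {α A D : ℝ} (hα0 : 0 ≤ α) (hα2 : α ≤ 2)
    {g : Lattice M} (hg : DSobLE α A g) {f : L2Torus} (hD : ‖trigInterp M g - f‖ ≤ D) :
    eLpNorm (fun x => interpolate M g x - f x) 2 (AddCircle.haarAddCircle (T := 2 * π)) ≤
      ENNReal.ofReal (4 * A * mesh M ^ (α / 2) + D) := by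
  have hA := hg.1
  have hm := (mesh_pos M).le
  have h1 := eLpNorm_interpolate_sub_trigFun_le hα0 hα2 hg
  have h2 : eLpNorm (fun x => trigFun (fun k => dcoeff M k g) x - f x) 2
      (AddCircle.haarAddCircle (T := 2 * π)) ≤ ENNReal.ofReal D := by
    have e : (fun x => trigFun (fun k => dcoeff M k g) x - f x) =ᵐ[AddCircle.haarAddCircle]
        ((trigInterp M g - f : L2Torus) : Torus → ℂ) := by
      rw [trigInterp_apply]
      filter_upwards [Lp.coeFn_sub (trigPoly fun k => dcoeff M k g) f,
        coeFn_trigPoly fun k => dcoeff M k g] with x hx1 hx2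
      rw [hx1, Pi.sub_apply, hx2]
    rw [eLpNorm_congr_ae e]
    have h3 : eLpNorm ((trigInterp M g - f : L2Torus) : Torus → ℂ) 2
        (AddCircle.haarAddCircle (T := 2 * π)) = ENNReal.ofReal ‖trigInterp M g - f‖ := by
      rw [Lp.norm_def, ENNReal.ofReal_toReal (Lp.eLpNorm_ne_top _)]
    rw [h3]
    exact ENNReal.ofReal_le_ofReal hD
  have e : (fun x => interpolate M g x - f x) =
      (fun x => interpolate M g x - trigFun (fun k => dcoeff M k g) x) +
        fun x => trigFun (fun k => dcoeff M k g) x - f x := by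
    funext x; simp
  rw [e, ENNReal.ofReal_add (by positivity) ((norm_nonneg _).trans hD)]
  refine (eLpNorm_add_le ?_ ?_ one_le_two).trans (add_le_add h1 h2)
  · exact ((measurable_interpolate g).sub (continuous_trigFun _).measurable).aestronglyMeasurable
  · exact (continuous_trigFun _).aestronglyMeasurable.sub (Lp.aestronglyMeasurable f)

theorem exists_discretizationError_le {α A T : ℝ} (hα : 1 < α) (hα2 : α ≤ 2) :
    ∃ C : ℝ, 0 < C ∧ ∀ (μ : ℝ) (f : L2Torus), |μ| ≤ 1 → SobLE α A f → ∀ (M : ℕ) [NeZero M],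
      discretizationError α μ M T f ≤ ENNReal.ofReal (C * mesh M ^ (α / (2 + α))) := by
  have hα0 : 0 ≤ α := by linarith
  obtain ⟨C, A', hC, h⟩ := exists_isSolution_and_norm_sub_le (A := A) (T := T) hα hα2
  -- The factor $\sqrt{2\pi}$ passes from normalized Haar measure to $dx$; `max A' 0` ensures
  -- positivity before any solution shows that `A'` is nonnegative.
  refine ⟨√(2 * π) * (16 * max A' 0 + C), by positivity, fun μ f hμ hf M _ => ?_⟩
  obtain ⟨u, hu, huv⟩ := h μ f hμ hf
  obtain ⟨v, hv⟩ := exists_isDiscreteSolution (M := M) α μ (discretize M f)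
  refine essSup_le_of_ae_le _ ((ae_restrict_mem measurableSet_Icc).mono fun t ht => ?_)
  obtain ⟨hg, hd⟩ := huv M v hv t
  have h1 := eLpNorm_interpolate_sub_le hα0 hα2 hg (hd (abs_le.mpr ⟨by linarith [ht.1, ht.2], ht.2⟩))
  simp only [solutionMap_eq hα hu, discreteSolutionMap_eq hv]
  rw [l2Norm_eq, mul_assoc, ENNReal.ofReal_mul (Real.sqrt_nonneg _)]
  gcongr
  refine h1.trans (ENNReal.ofReal_le_ofReal ?_)
  have h2 := mesh_rpow_half_le M hα0 hα2
  have h3 := mul_le_mul_of_nonneg_left h2 (mul_nonneg four_pos.le hg.1)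
  rw [max_eq_left hg.1]
  linarith

end Convergence

/-! ### Plane waves -/

section PlaneWaves

open scoped NNReal

/-- The phase factor `e^{-ix}`. -/
def phase (x : ℝ) : ℂ := Complex.exp (-(Complex.I * (x : ℂ)))

theorem phase_add (x y : ℝ) : phase (x + y) = phase x * phase y := by
  rw [phase, phase, phase, ← Complex.exp_add]
  congr 1; push_cast; ring

theorem norm_phase (x : ℝ) : ‖phase x‖ = 1 := by
  rw [phase, ← mul_neg, ← Complex.ofReal_neg, mul_comm]
  exact Complex.norm_exp_ofReal_mul_I _

theorem continuous_phase : Continuous phase := by unfold phase; fun_prop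

theorem hasDerivAt_phase_mul (c t : ℝ) :
    HasDerivAt (fun t : ℝ => phase (t * c)) (-(Complex.I * c) * phase (t * c)) t := by
  have h1 : HasDerivAt (fun t : ℝ => -(Complex.I * ((t * c : ℝ) : ℂ))) (-(Complex.I * c)) t := by
    have := ((((hasDerivAt_id t).mul_const c).ofReal_comp).const_mul Complex.I).fun_neg
    simpa using this
  have := h1.cexp
  rwa [mul_comm] at this

/-- On the line spanned by `e` the group rotates and `F` multiplies by the squared modulus, which is
constant in time; so the solution is one rotation. Stated abstractly to cover the torus and the
lattice. -/
theorem IsBoundedGroup.duhamel_phase {E : Type*} [NormedAddCommGroup E] [NormedSpace ℂ E]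
    [CompleteSpace E] {U : ℝ → E →L[ℂ] E} {K l μ : ℝ} {F : E → E} {e : E} {z : ℂ}
    (hU : IsBoundedGroup U K) (hUe : ∀ t (y : ℂ), U t (y • e) = (phase (t * l) * y) • e)
    (hF : ∀ y : ℂ, ‖y‖ = ‖z‖ → F (y • e) = (((‖y‖ ^ 2 : ℝ) : ℂ) * y) • e) (t : ℝ) :
    (phase (t * (l + μ * ‖z‖ ^ 2)) * z) • e = U t (z • e) - (Complex.I * (μ : ℂ)) •
      ∫ τ in (0 : ℝ)..t, U (t - τ) (F ((phase (τ * (l + μ * ‖z‖ ^ 2)) * z) • e)) := by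
  have h1 : ∀ t, U t ((phase (t * (μ * ‖z‖ ^ 2)) * z) • e) =
      (phase (t * (l + μ * ‖z‖ ^ 2)) * z) • e := fun t => by
    rw [hUe, mul_add t, phase_add, mul_assoc]
  have h2 : ∀ t, F ((phase (t * (l + μ * ‖z‖ ^ 2)) * z) • e) =
      (((‖z‖ ^ 2 : ℝ) : ℂ) * (phase (t * (l + μ * ‖z‖ ^ 2)) * z)) • e := fun t => by
    have h : ‖phase (t * (l + μ * ‖z‖ ^ 2)) * z‖ = ‖z‖ := by rw [norm_mul, norm_phase, one_mul]
    rw [hF _ h, h]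
  have h3 := hU.duhamel_of_hasDerivAt (F := F) (c := Complex.I * (μ : ℂ))
    (w := fun t => (phase (t * (μ * ‖z‖ ^ 2)) * z) • e) (fun t => ?_) ?_ t
  · simpa only [h1, zero_mul, show phase 0 = 1 by simp [phase], one_mul] using h3
  · have h4 := ((hasDerivAt_phase_mul (μ * ‖z‖ ^ 2) t).mul_const z).smul_const e
    refine h4.congr_deriv ?_
    rw [h1, h2, mul_smul (((‖z‖ ^ 2 : ℝ) : ℂ)), ← h1, map_smul, hU.neg_apply, smul_smul, smul_smul,
      ← neg_smul]
    congr 1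
    push_cast; ring
  · simp only [h1, h2]
    exact (continuous_const.mul ((continuous_phase.comp (by fun_prop)).mul
      continuous_const)).smul continuous_const

/-- The function `e^{iNx}` as an element of `L²(𝕋)`. -/
abbrev planeWave (N : ℤ) : L2Torus := fourierLp (T := 2 * π) 2 N

theorem coeff_smul_planeWave (l N : ℤ) (z : ℂ) :
    coeff l (z • planeWave N) = if l = N then z else 0 := by
  rw [map_smul, coeff_fourierLp, smul_eq_mul, mul_ite, mul_one, mul_zero]

theorem norm_smul_planeWave (N : ℤ) (z : ℂ) : ‖z • planeWave N‖ = ‖z‖ := by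
  rw [norm_smul, orthonormal_fourier.norm_eq_one N, mul_one]

theorem freeOp_smul_planeWave (α t : ℝ) (N : ℤ) (z : ℂ) :
    freeOp α t (z • planeWave N) = (phase (t * |(N : ℝ)| ^ α) * z) • planeWave N := by
  refine coeff_ext fun l => ?_
  rw [coeff_freeOp, coeff_smul_planeWave, coeff_smul_planeWave]
  split_ifs with h
  · rw [h]; rfl
  · rw [mul_zero]

theorem cubicTrunc_smul_planeWave {B : ℝ≥0} (N : ℤ) {z : ℂ} (hz : ‖z‖ ≤ B) :
    cubicTrunc B (z • planeWave N) = (((‖z‖ ^ 2 : ℝ) : ℂ) * z) • planeWave N := by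
  refine Lp.ext ?_
  filter_upwards [coeFn_cubicTrunc B (z • planeWave N), Lp.coeFn_smul z (planeWave N),
    Lp.coeFn_smul (((‖z‖ ^ 2 : ℝ) : ℂ) * z) (planeWave N),
    coeFn_fourierLp (T := 2 * π) 2 N] with x h1 h2 h3 h4
  have h5 : ‖z * fourier N x‖ = ‖z‖ := by
    rw [norm_mul, fourier_apply, Circle.norm_coe, mul_one]
  rw [h1, h2, h3, Pi.smul_apply, Pi.smul_apply, h4, smul_eq_mul, smul_eq_mul,
    cubicTruncFun_of_norm_le (h5.trans_le hz), cubicFun, h5, mul_assoc]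

theorem sobLE_smul_planeWave {α A : ℝ} (N : ℤ) {z : ℂ} (hA : √(weight α N) * ‖z‖ ≤ A) :
    SobLE α A (z • planeWave N) := by
  have h0 : 0 ≤ √(weight α N) * ‖z‖ := by positivity
  refine SobLE.of_sum_le (h0.trans hA) fun s => le_trans ?_ (pow_le_pow_left₀ h0 hA 2)
  rw [mul_pow, Real.sq_sqrt (weight_pos _ _).le]
  have h1 : ∀ k ∈ s, weight α k * ‖coeff k (z • planeWave N)‖ ^ 2 =
      if k = N then weight α N * ‖z‖ ^ 2 else 0 := by
    intro k _
    rw [coeff_smul_planeWave]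
    split_ifs with h
    · rw [h]
    · simp
  rw [Finset.sum_congr rfl h1, Finset.sum_ite_eq']
  split_ifs
  · exact le_rfl
  · exact mul_nonneg (weight_pos _ _).le (sq_nonneg _)

theorem isSolution_planeWave {α : ℝ} (hα : 1 < α) (μ : ℝ) (N : ℤ) (z : ℂ) :
    IsSolution α μ (z • planeWave N)
      fun t => (phase (t * (|(N : ℝ)| ^ α + μ * ‖z‖ ^ 2)) * z) • planeWave N := by
  have hn : ∀ x, ‖phase x * z‖ = ‖z‖ := fun x => by rw [norm_mul, norm_phase, one_mul]
  set A' := √(weight α N) * ‖z‖ with hA'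
  -- `B` must dominate the Sobolev sup bound, to remove the truncation, and `‖z‖`, so that it does
  -- not act on the wave itself.
  set B : ℝ≥0 := max (√(weightSum α 0) * A').toNNReal ‖z‖₊ with hB
  have hzB : ‖z‖ ≤ B := by
    have : ‖z‖₊ ≤ B := le_max_right _ _
    exact_mod_cast this
  have hF : ∀ y : ℂ, ‖y‖ = ‖z‖ →
      cubicTrunc B (y • planeWave N) = (((‖y‖ ^ 2 : ℝ) : ℂ) * y) • planeWave N :=
    fun y hy => cubicTrunc_smul_planeWave N (hy.trans_le hzB)
  refine isSolution_of_duhamel_cubicTrunc (B := B) (A' := A') (A'' := ‖z‖ ^ 2 * A') hα ?_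
    (fun t => (isBoundedGroup_freeOp α).duhamel_phase (freeOp_smul_planeWave α · N ·) hF t)
    (fun t => sobLE_smul_planeWave N ?_) (fun t => ?_)
    ((Real.le_coe_toNNReal _).trans (NNReal.coe_le_coe.mpr (le_max_left _ _)))
  · exact ((continuous_phase.comp (by fun_prop)).mul continuous_const).smul continuous_const
  · rw [hn]
  · rw [hF _ (hn _)]
    refine sobLE_smul_planeWave N ?_
    rw [norm_mul, hn, Complex.norm_real, Real.norm_of_nonneg (sq_nonneg _), hA']
    exact (mul_left_comm _ _ _).le

/-! ### Plane waves on the lattice. -/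

variable {M : ℕ} [NeZero M]

/-- The lattice function `e^{ikx}`. -/
def latticeWave (k : ZMod (2 * M)) : Lattice M := fun j => ZMod.stdAddChar (j * k)

theorem dcoeff_smul_latticeWave (k l : ZMod (2 * M)) (z : ℂ) :
    dcoeff M l (z • latticeWave k) = if l = k then z else 0 :=
  dcoeff_eq_of_forall_eq_sum (b := fun l => if l = k then z else 0)
    (fun j => by simp [latticeWave]) l

theorem trigInterp_smul_latticeWave (k : ZMod (2 * M)) (z : ℂ) :
    trigInterp M (z • latticeWave k) = z • planeWave k.valMinAbs := by
  rw [trigInterp_apply]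
  simp only [dcoeff_smul_latticeWave]
  simp [trigPoly]

theorem discreteFreeOp_smul_latticeWave (α t : ℝ) (k : ZMod (2 * M)) (z : ℂ) :
    discreteFreeOp α M t (z • latticeWave k) =
      (phase (t * discreteSymbol α M k) * z) • latticeWave k := by
  refine dcoeff_ext fun l => ?_
  rw [dcoeff_discreteFreeOp, dcoeff_smul_latticeWave, dcoeff_smul_latticeWave]
  split_ifs with h
  · rw [h]; rfl
  · rw [mul_zero]

theorem discreteCubic_smul_latticeWave (k : ZMod (2 * M)) (z : ℂ) :
    discreteCubic M (z • latticeWave k) = (((‖z‖ ^ 2 : ℝ) : ℂ) * z) • latticeWave k := by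
  funext j
  have h : ‖(z • latticeWave k : Lattice M) j‖ = ‖z‖ := by
    rw [Pi.smul_apply, norm_smul, latticeWave, AddChar.norm_apply, mul_one]
  rw [discreteCubic, h, Pi.smul_apply, Pi.smul_apply, smul_eq_mul, smul_eq_mul, mul_assoc]

theorem isDiscreteSolution_latticeWave (α μ : ℝ) (k : ZMod (2 * M)) (z : ℂ) :
    IsDiscreteSolution α μ M (z • latticeWave k)
      fun t => (phase (t * (discreteSymbol α M k + μ * ‖z‖ ^ 2)) * z) • latticeWave k :=
  isDiscreteSolution_iff.mpr
    ⟨((continuous_phase.comp (by fun_prop)).mul continuous_const).smul continuous_const,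
      (isBoundedGroup_discreteFreeOp α).duhamel_phase (discreteFreeOp_smul_latticeWave α · k ·)
        fun y _ => discreteCubic_smul_latticeWave k y⟩

theorem discretize_smul_planeWave (k : ZMod (2 * M)) (z : ℂ) :
    discretize M (z • planeWave k.valMinAbs) = (z * avgSymbol M k.valMinAbs) • latticeWave k := by
  have h : z • planeWave k.valMinAbs = trigPoly fun l => if l = k then z else 0 := by
    simp [trigPoly]
  rw [h]
  refine dcoeff_ext fun l => ?_
  rw [dcoeff_discretize_trigPoly, dcoeff_smul_latticeWave]
  split_ifs with h
  · rw [h]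
  · rw [zero_mul]

theorem dSobLE_smul_latticeWave {α A : ℝ} (k : ZMod (2 * M)) {z : ℂ}
    (hA : √(weight α k.valMinAbs) * ‖z‖ ≤ A) : DSobLE α A (z • latticeWave k) := by
  have h0 : 0 ≤ √(weight α k.valMinAbs) * ‖z‖ := by positivity
  refine ⟨h0.trans hA, le_trans ?_ (pow_le_pow_left₀ h0 hA 2)⟩
  rw [mul_pow, Real.sq_sqrt (weight_pos _ _).le, Finset.sum_eq_single k]
  · rw [dcoeff_smul_latticeWave, if_pos rfl]
  · intro l _ hl
    rw [dcoeff_smul_latticeWave, if_neg hl]; simp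
  · simp

theorem norm_trigInterp_sub_le_of_eLpNorm_le {α A D : ℝ} (hα0 : 0 ≤ α) (hα2 : α ≤ 2) (hD : 0 ≤ D)
    {g : Lattice M} (hg : DSobLE α A g) {f : L2Torus}
    (h : eLpNorm (fun x => interpolate M g x - f x) 2 (AddCircle.haarAddCircle (T := 2 * π)) ≤
      ENNReal.ofReal D) : ‖trigInterp M g - f‖ ≤ 4 * A * mesh M ^ (α / 2) + D := by
  have hA := hg.1
  have hm := (mesh_pos M).le
  have h1 := eLpNorm_interpolate_sub_trigFun_le hα0 hα2 hg
  refine norm_le_of_eLpNorm_le (F := fun x => (interpolate M g x - f x) -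
    (interpolate M g x - trigFun (fun k => dcoeff M k g) x)) (by positivity) ?_ ?_
  · rw [trigInterp_apply]
    filter_upwards [Lp.coeFn_sub (trigPoly fun k => dcoeff M k g) f,
      coeFn_trigPoly fun k => dcoeff M k g] with x hx1 hx2
    rw [hx1, Pi.sub_apply, hx2]
    ring
  · rw [ENNReal.ofReal_add (by positivity) hD, add_comm]
    refine (eLpNorm_sub_le ?_ ?_ one_le_two).trans (add_le_add h h1)
    · exact (measurable_interpolate g).aestronglyMeasurable.sub (Lp.aestronglyMeasurable f)
    · exact ((measurable_interpolate g).sub (continuous_trigFun _).measurable).aestronglyMeasurable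

/-- An essential supremum bounds almost every time only; the interval `[T / 2, T]` has positive
measure and stays away from `0`, where the phases have not yet separated. -/
theorem exists_l2Norm_le_of_discretizationError_le {α μ T : ℝ} {f : L2Torus} {D : ℝ≥0∞} (hT : 0 < T)
    (h : discretizationError α μ M T f ≤ D) : ∃ t ∈ Set.Icc (T / 2) T,
      l2Norm (fun x => interpolate M (discreteSolutionMap α μ M t (discretize M f)) x -
        solutionMap α μ t f x) ≤ D := by
  have h1 := ENNReal.ae_le_essSup (μ := volume.restrict (Set.Icc 0 T)) fun t : ℝ =>
    l2Norm fun x => interpolate M (discreteSolutionMap α μ M t (discretize M f)) x -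
      solutionMap α μ t f x
  have h2 := h1.filter_mono (ae_mono (Measure.restrict_mono
    (Set.Icc_subset_Icc_left (by linarith : 0 ≤ T / 2)) (le_refl (volume : Measure ℝ))))
  have hne : (ae ((volume : Measure ℝ).restrict (Set.Icc (T / 2) T))).NeBot := by
    rw [ae_restrict_neBot, Real.volume_Icc, ne_eq, ENNReal.ofReal_eq_zero]
    linarith
  obtain ⟨t, ht1, ht2⟩ := (h2.and (ae_restrict_mem measurableSet_Icc)).exists
  exact ⟨t, ht2, ht1.trans h⟩

end PlaneWaves

/-! ### Sharpness of the rate -/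

section Sharpness

open scoped NNReal

theorem sin_div_le {x : ℝ} (hx0 : 0 < x) (hx1 : x ≤ 1) : Real.sin x / x ≤ 1 - x ^ 2 / 10 := by
  have h := (abs_le.mp (Real.sin_bound (by rwa [abs_of_pos hx0] : |x| ≤ 1))).2
  rw [abs_of_pos hx0] at h
  rw [div_le_iff₀ hx0]
  have h1 : x ^ 5 ≤ x ^ 3 := pow_le_pow_of_le_one hx0.le hx1 (by norm_num)
  have h2 : 0 < x ^ 3 := by positivity
  nlinarith

theorem phase_sub_le (x y : ℝ) : ‖phase x - phase y‖ ≤ |x - y| := norm_exp_I_mul_sub_le x y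

theorem le_norm_phase_sub {x y : ℝ} (h0 : x ≤ y) (h1 : y - x ≤ 1) :
    2 / π * (y - x) ≤ ‖phase x - phase y‖ := by
  have h2 : phase x - phase y = phase y * (Complex.exp (Complex.I * ((y - x : ℝ) : ℂ)) - 1) := by
    rw [phase, phase, mul_sub, ← Complex.exp_add, mul_one]
    congr 2; push_cast; ring
  have h3 := Real.mul_le_sin (x := (y - x) / 2) (by linarith) (by linarith [Real.pi_gt_three])
  rw [h2, norm_mul, norm_phase, one_mul, Complex.norm_exp_I_mul_ofReal_sub_one]
  refine le_trans ?_ (Real.le_norm_self _)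
  linarith

variable {M : ℕ} [NeZero M]

/-- With $x=hk/2$ and $r=\sin x/x$, one has $r^\alpha\le r\le 1-x^2/10$ since $\alpha\ge1$; this
shows that the $h^2|k|^{\alpha+2}$ discrepancy is attained in order. -/
theorem le_rpow_sub_discreteSymbol {α : ℝ} (hα : 1 ≤ α) {k : ZMod (2 * M)}
    (hk : 1 ≤ k.valMinAbs) (hkM : mesh M * (k.valMinAbs : ℝ) ≤ 1) :
    mesh M ^ 2 * (k.valMinAbs : ℝ) ^ (α + 2) / 40 ≤
      (k.valMinAbs : ℝ) ^ α - discreteSymbol α M k := by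
  have hm := mesh_pos M
  have hK : (1 : ℝ) ≤ k.valMinAbs := by exact_mod_cast hk
  rw [discreteSymbol_eq k (by omega)]
  set K : ℝ := (k.valMinAbs : ℝ)
  rw [abs_of_pos (by linarith)]
  set x := mesh M * K / 2 with hx
  have hx0 : 0 < x := by positivity
  have hx1 : x ≤ 1 := by linarith
  have h1 := sin_div_le hx0 hx1
  have h2 : (Real.sin x / x) ^ α ≤ Real.sin x / x := by
    have h3 := Real.rpow_le_rpow_of_exponent_ge (x := Real.sin x / x)
      (div_pos (Real.sin_pos_of_pos_of_le_one hx0 hx1) hx0)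
      (div_le_one_of_le₀ (Real.sin_le hx0.le) hx0.le) hα
    rwa [Real.rpow_one] at h3
  have h4 : mesh M ^ 2 * K ^ (α + 2) / 40 = K ^ α * (x ^ 2 / 10) := by
    rw [Real.rpow_add (by linarith), Real.rpow_two, hx]; ring
  rw [h4, ← mul_one_sub]
  exact mul_le_mul_of_nonneg_left (by linarith) (by positivity)

/-- Both solutions are explicit rotations of one wave. Interpolation, and the change of amplitude
due to averaging, contribute $O(h^{\alpha/2})$; what remains is the amplitude times the phase gap
$t(|k|^\alpha-\sigma_h(k))$, which `hkT` keeps at most one, so that the chord is comparable to it.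
-/
theorem planeWave_error_ge {α μ T R D : ℝ} (hα : 1 < α) (hα2 : α ≤ 2) (hμ : |μ| ≤ 1) (hT : 0 < T)
    (hR : 0 < R) (hD : 0 ≤ D) {k : ZMod (2 * M)} (hk : 1 ≤ k.valMinAbs)
    (hkM : mesh M * (k.valMinAbs : ℝ) ≤ 1)
    (hkT : T * (mesh M ^ 2 * (k.valMinAbs : ℝ) ^ (α + 2)) ≤ 1)
    (h : ∀ f : L2Torus, sobolevNorm (α / 2) f < ENNReal.ofReal R →
      discretizationError α μ M T f ≤ ENNReal.ofReal D) :
    R / (3 * √(weight α k.valMinAbs)) *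
        (T * (mesh M ^ 2 * (k.valMinAbs : ℝ) ^ (α + 2)) / (40 * π)) ≤
      D + 4 * (R / 3) * (2 + 2 * T * R ^ 2) * mesh M ^ (α / 2) := by
  have hα0 : 0 ≤ α := by linarith
  have hm := mesh_pos M
  have hw : 1 ≤ √(weight α k.valMinAbs) := Real.one_le_sqrt.mpr (one_le_weight hα0 _)
  have hK : (1 : ℝ) ≤ k.valMinAbs := by exact_mod_cast hk
  -- The wave then has Sobolev norm $\sqrt{2\pi}\,R/3$, which is below $R$ as $\sqrt{2\pi}<3$.
  set a := R / (3 * √(weight α k.valMinAbs)) with ha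
  have ha0 : 0 < a := by positivity
  have haR : a ≤ R := div_le_self hR.le (by linarith)
  have hna : ‖(a : ℂ)‖ = a := by rw [Complex.norm_real, Real.norm_of_nonneg ha0.le]
  have hwa : √(weight α k.valMinAbs) * ‖(a : ℂ)‖ = R / 3 := by
    rw [hna, ha]; field_simp
  have hS : SobLE α (R / 3) ((a : ℂ) • planeWave k.valMinAbs) :=
    sobLE_smul_planeWave _ hwa.le
  have hsR : sobolevNorm (α / 2) ((a : ℂ) • planeWave k.valMinAbs) < ENNReal.ofReal R := by
    refine ((sobolevNorm_le_iff (by positivity) _).mpr hS).trans_lt ?_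
    rw [ENNReal.ofReal_lt_ofReal_iff hR]
    have : √(2 * π) < 3 := by
      rw [Real.sqrt_lt' (by norm_num)]; linarith [Real.pi_lt_d2]
    nlinarith
  obtain ⟨t, ⟨ht0, ht1⟩, ht⟩ := exists_l2Norm_le_of_discretizationError_le hT (h _ hsR)
  set m := avgSymbol M k.valMinAbs with hmdef
  have hm1 : ‖m‖ ≤ 1 := norm_avgSymbol_le_one _
  have hnam : ‖(a : ℂ) * m‖ ≤ a := by
    rw [norm_mul, hna]; exact mul_le_of_le_one_right ha0.le hm1
  rw [discretize_smul_planeWave] at ht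
  simp only [solutionMap_eq hα (isSolution_planeWave hα μ _ _),
    discreteSolutionMap_eq (isDiscreteSolution_latticeWave α μ k _)] at ht
  rw [← hmdef, hna, abs_of_pos (by linarith : (0 : ℝ) < k.valMinAbs)] at ht
  set K : ℝ := (k.valMinAbs : ℝ) with hKdef
  set s := discreteSymbol α M k with hs
  set E := mesh M ^ 2 * K ^ (α + 2) with hE
  set d := 4 * (R / 3) * mesh M ^ (α / 2) with hd
  have h1 : ‖phase (t * (s + μ * ‖(a : ℂ) * m‖ ^ 2)) * (a * m) - phase (t * (K ^ α + μ * a ^ 2)) * a‖ ≤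
      d + D := by
    rw [← norm_smul_planeWave k.valMinAbs, sub_smul, ← trigInterp_smul_latticeWave]
    refine norm_trigInterp_sub_le_of_eLpNorm_le hα0 hα2 hD (dSobLE_smul_latticeWave k ?_) ?_
    · rw [norm_mul, norm_phase, one_mul, ← hwa, hna]
      exact mul_le_mul_of_nonneg_left hnam (Real.sqrt_nonneg _)
    · rw [l2Norm_eq] at ht
      refine le_trans (le_mul_of_one_le_left' ?_) ht
      rw [ENNReal.one_le_ofReal, Real.one_le_sqrt]
      linarith [Real.pi_gt_three]
  have h2 : ‖(a : ℂ) * m - a‖ ≤ d := by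
    have := norm_trigInterp_discretize_sub_le (M := M) hα0 hα2 hS
    rwa [discretize_smul_planeWave, trigInterp_smul_latticeWave, ← sub_smul,
      norm_smul_planeWave] at this
  -- Averaging changes the amplitude, and through the nonlinearity also the frequency; both effects
  -- are bounded by multiples of `d`.
  have h3 : ‖phase (t * (s + μ * ‖(a : ℂ) * m‖ ^ 2)) * (a * m) - phase (t * (s + μ * a ^ 2)) * a‖ ≤
      d + 2 * T * R ^ 2 * d := by
    have e : phase (t * (s + μ * ‖(a : ℂ) * m‖ ^ 2)) * (a * m) - phase (t * (s + μ * a ^ 2)) * a =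
        phase (t * (s + μ * ‖(a : ℂ) * m‖ ^ 2)) * (a * m - a) +
        (phase (t * (s + μ * ‖(a : ℂ) * m‖ ^ 2)) - phase (t * (s + μ * a ^ 2))) * a := by ring
    rw [e]
    refine (norm_add_le _ _).trans (add_le_add ?_ ?_)
    · rwa [norm_mul, norm_phase, one_mul]
    · rw [norm_mul, hna]
      have h4 : |‖(a : ℂ) * m‖ - a| ≤ d := by
        have := abs_norm_sub_norm_le ((a : ℂ) * m) a
        rw [hna] at this
        exact this.trans h2
      have h5 : |‖(a : ℂ) * m‖ + a| ≤ 2 * a := by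
        rw [abs_of_nonneg (by positivity)]; linarith
      have h6 : |t * (s + μ * ‖(a : ℂ) * m‖ ^ 2) - t * (s + μ * a ^ 2)| ≤ T * (1 * (d * (2 * a))) := by
        have e : t * (s + μ * ‖(a : ℂ) * m‖ ^ 2) - t * (s + μ * a ^ 2) =
            t * (μ * ((‖(a : ℂ) * m‖ - a) * (‖(a : ℂ) * m‖ + a))) := by ring
        rw [e, abs_mul, abs_mul, abs_mul, abs_of_nonneg (by linarith : 0 ≤ t)]
        gcongr
      calc _ ≤ T * (1 * (d * (2 * a))) * a :=
            mul_le_mul_of_nonneg_right ((phase_sub_le _ _).trans h6) ha0.le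
        _ = 2 * T * a ^ 2 * d := by ring
        _ ≤ _ := by gcongr
  have hlow := le_rpow_sub_discreteSymbol hα.le hk hkM
  have hup := abs_rpow_sub_discreteSymbol_le hα0 hα2 k
  rw [abs_of_pos (by linarith : 0 < K)] at hup
  have hE0 : 0 ≤ E := by positivity
  have h7 : a * (T * E / (40 * π)) ≤
      ‖phase (t * (s + μ * a ^ 2)) * a - phase (t * (K ^ α + μ * a ^ 2)) * a‖ := by
    have e : t * (K ^ α + μ * a ^ 2) - t * (s + μ * a ^ 2) = t * (K ^ α - s) := by ring
    have ht2 : 0 ≤ t := by linarith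
    have hge : T / 2 * (E / 40) ≤ t * (K ^ α - s) := by gcongr
    have hle : t * (K ^ α - s) ≤ 1 :=
      (mul_le_mul ht1 hup ((by positivity : (0 : ℝ) ≤ E / 40).trans hlow) hT.le).trans hkT
    have h8 := le_norm_phase_sub (x := t * (s + μ * a ^ 2)) (y := t * (K ^ α + μ * a ^ 2))
      (by linarith [show 0 ≤ T / 2 * (E / 40) by positivity]) (by rw [e]; exact hle)
    rw [e] at h8
    rw [← sub_mul, norm_mul, hna, mul_comm a]
    refine mul_le_mul_of_nonneg_right (le_trans ?_ h8) ha0.le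
    calc T * E / (40 * π) = 2 / π * (T / 2 * (E / 40)) := by field_simp
      _ ≤ _ := by gcongr
  have h9 := norm_sub_le_norm_sub_add_norm_sub (phase (t * (s + μ * a ^ 2)) * a)
    (phase (t * (s + μ * ‖(a : ℂ) * m‖ ^ 2)) * (a * m)) (phase (t * (K ^ α + μ * a ^ 2)) * a)
  rw [norm_sub_rev (phase (t * (s + μ * a ^ 2)) * a)
    (phase (t * (s + μ * ‖(a : ℂ) * m‖ ^ 2)) * (a * m))] at h9
  have h10 : 4 * (R / 3) * (2 + 2 * T * R ^ 2) * mesh M ^ (α / 2) = (2 + 2 * T * R ^ 2) * d := by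
    rw [hd]; ring
  rw [h10]
  linarith

theorem sqrt_weight_le {α : ℝ} (hα0 : 0 ≤ α) (hα2 : α ≤ 2) {N : ℤ} (hN : 1 ≤ N) :
    √(weight α N) ≤ 2 * (N : ℝ) ^ (α / 2) := by
  have hN' : (1 : ℝ) ≤ N := by exact_mod_cast hN
  rw [Real.sqrt_le_left (by positivity)]
  calc weight α N ≤ (4 * (N : ℝ) ^ 2) ^ (α / 2) :=
        Real.rpow_le_rpow (by positivity) (by nlinarith) (by linarith)
    _ = 4 ^ (α / 2) * ((N : ℝ) ^ (α / 2)) ^ 2 := by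
        rw [Real.mul_rpow (by norm_num) (by positivity), ← Real.rpow_natCast, ← Real.rpow_natCast,
          ← Real.rpow_mul (by linarith), ← Real.rpow_mul (by linarith), mul_comm (α / 2)]
    _ ≤ 4 * ((N : ℝ) ^ (α / 2)) ^ 2 := by
        gcongr
        simpa using Real.rpow_le_rpow_of_exponent_le (by norm_num : (1 : ℝ) ≤ 4)
          (by linarith : α / 2 ≤ 1)
    _ = _ := by ring

/-- The frequency is $n=\lfloor\kappa h^{-2/(2+\alpha)}\rfloor$: then $h^2n^{\alpha+2}$ is bounded
above and below, while the admissible amplitude is at least a constant times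
$h^{\alpha/(2+\alpha)}$. A small `κ` keeps the phase gap at most one. -/
theorem mesh_rpow_le_of_error_le {α μ T R D κ : ℝ} (hα : 1 < α) (hα2 : α ≤ 2) (hμ : |μ| ≤ 1)
    (hT : 0 < T) (hR : 0 < R) (hD : 0 ≤ D) (hκ0 : 0 < κ) (hκ1 : κ ≤ 1) (hκT : T * κ ≤ 1)
    (hM1 : mesh M ^ (2 / (2 + α)) ≤ κ) (hM2 : κ * mesh M ^ (α / (2 + α)) ≤ 1)
    (h : ∀ f : L2Torus, sobolevNorm (α / 2) f < ENNReal.ofReal R →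
      discretizationError α μ M T f ≤ ENNReal.ofReal D) :
    R * (T * (κ / 2) ^ (α + 2)) / (240 * π) * mesh M ^ (α / (2 + α)) ≤
      D + 4 * (R / 3) * (2 + 2 * T * R ^ 2) * mesh M ^ (α / 2) := by
  have hm := mesh_pos M
  have hα0 : 0 < 2 + α := by linarith
  set b := mesh M ^ (-(2 / (2 + α))) with hb
  have hb0 : 0 < b := Real.rpow_pos_of_pos hm _
  set X := κ * b with hX
  have hX1 : 1 ≤ X := by
    rw [hX, hb, Real.rpow_neg hm.le, ← div_eq_mul_inv, one_le_div (by positivity)]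
    exact hM1
  have hmX : mesh M * X = κ * mesh M ^ (α / (2 + α)) := by
    rw [hX, hb, mul_left_comm]
    congr 1
    nth_rw 1 [← Real.rpow_one (mesh M)]
    rw [← Real.rpow_add hm]
    congr 1; field_simp; ring
  have hmX2 : ∀ c : ℝ, 0 ≤ c → mesh M ^ 2 * (c * b) ^ (α + 2) = c ^ (α + 2) := by
    intro c hc
    rw [Real.mul_rpow hc hb0.le, hb, ← Real.rpow_mul hm.le,
      show -(2 / (2 + α)) * (α + 2) = -((2 : ℕ) : ℝ) by push_cast; field_simp; ring,
      Real.rpow_neg hm.le, Real.rpow_natCast]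
    field_simp
  set n := ⌊X⌋₊ with hn
  have hn1 : 1 ≤ n := Nat.one_le_floor_iff X |>.mpr hX1
  have hnX : (n : ℝ) ≤ X := Nat.floor_le (by linarith)
  -- Since `X ≥ 1`, the floor loses at most a factor of two.
  have hXn : κ / 2 * b ≤ n := by
    have h1 := Nat.lt_floor_add_one X
    have h2 : (1 : ℝ) ≤ n := by exact_mod_cast hn1
    rw [← hn] at h1
    linarith
  have hmn : mesh M * n ≤ 1 := by
    refine le_trans ?_ hM2
    rw [← hmX]; gcongr
  have hnM : (n : ℤ) ≤ M := by
    have h1 : mesh M * n ≤ mesh M * M := by rw [mesh_mul]; linarith [Real.pi_gt_three]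
    exact_mod_cast le_of_mul_le_mul_left h1 hm
  obtain ⟨k, hk⟩ : ∃ k : ZMod (2 * M), k.valMinAbs = (n : ℤ) := by
    refine ⟨((n : ℤ) : ZMod (2 * M)), (ZMod.valMinAbs_spec _ _).mpr ⟨rfl, ?_⟩⟩
    have := NeZero.pos M
    constructor <;> push_cast <;> omega
  have hkr : (k.valMinAbs : ℝ) = n := by rw [hk]; simp
  have hk1 : 1 ≤ k.valMinAbs := by rw [hk]; exact_mod_cast hn1
  have hup : mesh M ^ 2 * (n : ℝ) ^ (α + 2) ≤ κ := by
    calc mesh M ^ 2 * (n : ℝ) ^ (α + 2) ≤ mesh M ^ 2 * X ^ (α + 2) := by gcongr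
      _ = κ ^ (α + 2) := hmX2 κ hκ0.le
      _ ≤ κ ^ (1 : ℝ) := Real.rpow_le_rpow_of_exponent_ge hκ0 hκ1 (by linarith)
      _ = κ := Real.rpow_one κ
  have hlow : (κ / 2) ^ (α + 2) ≤ mesh M ^ 2 * (n : ℝ) ^ (α + 2) := by
    rw [← hmX2 (κ / 2) (by linarith)]; gcongr
  have hw : √(weight α k.valMinAbs) * mesh M ^ (α / (2 + α)) ≤ 2 := by
    have h1 := sqrt_weight_le (by linarith : 0 ≤ α) hα2 hk1
    rw [hkr] at h1
    have h2 : (n : ℝ) ^ (α / 2) ≤ b ^ (α / 2) := by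
      refine Real.rpow_le_rpow (by positivity) (hnX.trans ?_) (by linarith)
      exact mul_le_of_le_one_left hb0.le hκ1
    have h3 : b ^ (α / 2) * mesh M ^ (α / (2 + α)) = 1 := by
      rw [hb, ← Real.rpow_mul hm.le, ← Real.rpow_add hm,
        show -(2 / (2 + α)) * (α / 2) + α / (2 + α) = 0 by field_simp; ring, Real.rpow_zero]
    calc _ ≤ 2 * b ^ (α / 2) * mesh M ^ (α / (2 + α)) := by gcongr; linarith
      _ = 2 := by rw [mul_assoc, h3, mul_one]
  have key := planeWave_error_ge hα hα2 hμ hT hR hD hk1 (by rwa [hkr])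
    (by rw [hkr]; exact (mul_le_mul_of_nonneg_left hup hT.le).trans hκT) h
  rw [hkr] at key
  refine le_trans ?_ key
  have hw0 : 0 < √(weight α k.valMinAbs) := Real.sqrt_pos.mpr (weight_pos _ _)
  -- The constant is `240 = 6 * 40`, where `6` is the `3` of the amplitude times the `2` that bounds
  -- the weight.
  calc R * (T * (κ / 2) ^ (α + 2)) / (240 * π) * mesh M ^ (α / (2 + α))
      = R * mesh M ^ (α / (2 + α)) / 6 * (T * (κ / 2) ^ (α + 2) / (40 * π)) := by
        field_simp; norm_num
    _ ≤ R / (3 * √(weight α k.valMinAbs)) * (T * (mesh M ^ 2 * (n : ℝ) ^ (α + 2)) / (40 * π)) := by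
        refine mul_le_mul ?_ (by gcongr) (by positivity) (by positivity)
        rw [div_le_div_iff₀ (by norm_num) (by positivity)]
        nlinarith

end Sharpness

/-! ### The largest admissible exponent. -/

section Rates

/-- For larger `p`, dividing the lower bound by $h^{\alpha/(2+\alpha)}$ leaves a positive constant
below positive powers of $h$, because $\alpha/2>\alpha/(2+\alpha)$ as well; this fails as $h\to0$.
-/
theorem le_of_mem_convergenceRates {α μ T R p : ℝ} (hα : 1 < α) (hα2 : α ≤ 2) (hμ : |μ| ≤ 1)
    (hT : 0 < T) (hR : 0 < R) (hp : p ∈ convergenceRates α μ T R) : p ≤ α / (2 + α) := by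
  obtain ⟨hp0, C, hC, hsup⟩ := hp
  by_contra! hlt
  have hα0 : 0 < 2 + α := by linarith
  -- This choice ensures both `κ ≤ 1` and `T * κ ≤ 1`.
  set κ := 1 / (1 + T) with hκ
  have hκ0 : 0 < κ := by positivity
  have hκ1 : κ ≤ 1 := by rw [hκ, div_le_one (by linarith)]; linarith
  have hκT : T * κ ≤ 1 := by rw [hκ, mul_one_div, div_le_one (by linarith)]; linarith
  have hq2 : α / (2 + α) < α / 2 := div_lt_div_of_pos_left (by linarith) two_pos (by linarith)
  set c := R * (T * (κ / 2) ^ (α + 2)) / (240 * π) with hc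
  have hc0 : 0 < c := by positivity
  set C' := 4 * (R / 3) * (2 + 2 * T * R ^ 2) with hC'
  have e1 := (tendsto_mesh_rpow (show 0 < 2 / (2 + α) by positivity)).eventually_le_const hκ0
  have e2 : ∀ᶠ n : ℕ in atTop, κ * mesh (n + 1) ^ (α / (2 + α)) ≤ 1 := by
    have := (tendsto_mesh_rpow (show 0 < α / (2 + α) by positivity)).const_mul κ
    rw [mul_zero] at this
    exact this.eventually_le_const one_pos
  have e3 : ∀ᶠ n : ℕ in atTop, C * mesh (n + 1) ^ (p - α / (2 + α)) +
      C' * mesh (n + 1) ^ (α / 2 - α / (2 + α)) < c := by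
    have := ((tendsto_mesh_rpow (sub_pos.mpr hlt)).const_mul C).add
      ((tendsto_mesh_rpow (sub_pos.mpr hq2)).const_mul C')
    rw [mul_zero, mul_zero, add_zero] at this
    exact this.eventually_lt_const hc0
  obtain ⟨n, h1, h2, h3⟩ := (e1.and (e2.and e3)).exists
  have hm := mesh_pos (n + 1)
  have h4 := mesh_rpow_le_of_error_le (M := n + 1) (μ := μ) hα hα2 hμ hT hR
    (mul_nonneg hC.le (Real.rpow_nonneg hm.le p)) hκ0 hκ1 hκT h1 h2
    fun f hf => (le_iSup₂ (f := fun (f : L2Torus) (_ : sobolevNorm (α / 2) f < ENNReal.ofReal R) =>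
      discretizationError α μ (n + 1) T f) f hf).trans (hsup (n + 1))
  have hq0 : 0 < mesh (n + 1) ^ (α / (2 + α)) := Real.rpow_pos_of_pos hm _
  rw [← hC', ← hc] at h4
  have h5 := mul_lt_mul_of_pos_right h3 hq0
  rw [add_mul, mul_assoc, mul_assoc, ← Real.rpow_add hm, ← Real.rpow_add hm, sub_add_cancel,
    sub_add_cancel] at h5
  linarith

theorem mem_convergenceRates {α μ T R : ℝ} (hα : 1 < α) (hα2 : α ≤ 2) (hμ : |μ| ≤ 1) (hR : 0 < R) :
    α / (2 + α) ∈ convergenceRates α μ T R := by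
  obtain ⟨C, hC, h⟩ := exists_discretizationError_le (A := R / √(2 * π)) (T := T) hα hα2
  refine ⟨by positivity, C, hC, fun M _ => iSup₂_le fun f hf => h μ f hμ ?_ M⟩
  refine (sobolevNorm_le_iff (by positivity) f).mp ?_
  rw [mul_div_cancel₀ R (by positivity)]
  exact hf.le

end Rates

end FracNLS

end

theorem mainTheorem4 (α μ : ℝ) (hα₁ : 1 < α) (hα₂ : α ≤ 2) (hμ : μ = 1 ∨ μ = -1) :
    (∀ u₀ : FracNLS.L2Torus, FracNLS.sobolevNorm (α / 2) u₀ < ∞ →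
      ∃! u : ℝ → FracNLS.L2Torus, FracNLS.IsSolution α μ u₀ u) ∧
    (∀ (M : ℕ) [NeZero M] (v₀ : FracNLS.Lattice M),
      ∃! v : ℝ → FracNLS.Lattice M, FracNLS.IsDiscreteSolution α μ M v₀ v) ∧
    ∀ T R : ℝ, 0 < T → 0 < R →
      IsGreatest (FracNLS.convergenceRates α μ T R) (α / (2 + α)) := by
  have hμ' : |μ| ≤ 1 := by rcases hμ with rfl | rfl <;> simp
  exact ⟨fun u₀ hu₀ => FracNLS.existsUnique_isSolution hα₁ hα₂ hμ' hu₀,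
    fun M _ v₀ => FracNLS.existsUnique_isDiscreteSolution α μ v₀,
    fun T R hT hR => ⟨FracNLS.mem_convergenceRates hα₁ hα₂ hμ' hR,
      fun p hp => FracNLS.le_of_mem_convergenceRates hα₁ hα₂ hμ' hT hR hp⟩⟩
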